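/- Let $k$ be an algebraically closed field of characteristic zero and let $H$ be a finite-dimensional factorizable ribbon Hopf algebra over $k$, with coproduct $\Delta$, antipode $S$, R-matrix $R$ and ribbon element $v$ (so $\Delta(v)=(v\otimes v)Q^{-1}$). Factorizable means that the monodromy matrix $Q=R_{21}R$ can be written as $\sum_\ell h_\ell\otimes k_\ell$ with two bases $\{h_\ell\}$, $\{k_\ell\}$ of $H$. Put $t=uv^{-1}$ with $u$ the Drinfeld element, the image of $R_{21}$ under $a\otimes b\mapsto S(a)\,b$. Regard the category $H\text{-Mod}$ of finite-dimensional left $H$-modules as a ribbon category with duals $(h.f)(x)=f(S(h)x)$, braiding $x\otimes y\mapsto\tau(R\,(x\otimes y))$, where $\tau$ is the flip, and sovereign structure $f\mapsto f(t\,\cdot\,)$. Regard the category $H\text{-Bimod}$ of finite-dimensional $H$-bimodules, with the tensor product over $k$ made a bimodule through the coproduct, as a ribbon category with duals $(h.f.h')(x)=f(S(h)\,x\,S^{-1}(h'))$, braiding $x\otimes y\mapsto\tau(R_{21}^{-1}(x\otimes y)R_{21})$ and sovereign structure $f\mapsto f(t\,\cdot\,t)$. Let $L=\int^{U}U^\vee\otimes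 U$ be the coend in $H\text{-Mod}$, realized as $H^*$ with the coadjoint action and dinatural maps $\iota_U(f\otimes x)=(h\mapsto f(hx))$, and let $K=\int^{X}X^\vee\otimes X$ be the coend in $H\text{-Bimod}$, realized as $H^*\otimes H^*$ with the left coadjoint action on the first factor, the right coadjoint action on the second, and dinatural maps $\iota_X(f\otimes x)=(h\otimes h'\mapsto f(hxh'))$. Both are algebras (indeed Hopf algebras) inside their categories, with product determined by $m\circ(\iota_U\otimes\iota_V)=\iota_{V\otimes U}\circ(\gamma_{U,V}\otimes\mathrm{id})\circ(\mathrm{id}\otimes c_{U,V^\vee\otimes V})$ and unit $\iota_{\mathbf 1}$, where $c$ is the braiding and $\gamma_{U,V}:U^\vee\otimes V^\vee\to(V\otimes U)^\vee$ the canonical isomorphism. The coend acts on every object $V$ by partial monodromy: the action $\rho_V$ is determined by $\rho_V\circ(\iota_U\otimes\mathrm{id}_V)=(d_U\otimes\mathrm{id}_V)\circ(\mathrm{id}\otimes c_{V,U}c_{U,V})$, with $d_U$ the evaluation. The character of $V$ is the partial trace of $\rho_V$ in the sovereign category; it is denoted $\chi^L_V$ for $L$ and $\chi^K_X$ for $K$.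 Let $(S_i)_{i\in I}$ be representatives of the isomorphism classes of simple $H$-modules, $P_i$ a projective cover of $S_i$, $\bar\imath$ the label with $S_{\bar\imath}\cong S_i^\vee$, $c_{i,j}=[P_i:S_j]$ (Jordan--Hölder multiplicity) the Cartan matrix of $H\text{-Mod}$, and $\chi^L_i=\chi^L_{S_i}$. Let $F$ be the bulk Frobenius algebra, whose underlying object is the coregular bimodule: $H^*$ with $(h.f.h')(x)=f(S(h)\,x\,S^{-1}(h'))$. Then $I$ is finite, each $S_i$ is an $L$-module and $F$ is a $K$-module by the above actions, $\chi^L_i\in\mathrm{Hom}_{H}(L,\mathbf 1)$, the character $Z=\chi^K_F$ lies in $\mathrm{Hom}_{H|H}(K,\mathbf 1)$, and, under $K= L\otimes_k L$ as vector spaces, $$Z=\sum_{i,j\in I}c_{\bar\imath,j}\;\chi^L_i\otimes\chi^L_j .$$ -/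

import Mathlib

open scoped TensorProduct

universe u v

noncomputable section

open MulOpposite

namespace CardyCartan

/-! ### Ribbon Hopf algebras -/

section Ribbon

variable (k H : Type u) [Field k] [Ring H] [HopfAlgebra k H]

/-- The flip `x ⊗ y ↦ y ⊗ x` of `H ⊗ H`, as an algebra automorphism. -/
abbrev flip : (H ⊗[k] H) ≃ₐ[k] (H ⊗[k] H) := Algebra.TensorProduct.comm k H H

/-- `x ⊗ y ↦ x ⊗ y ⊗ 1`. -/
def leg12 : H ⊗[k] H →ₗ[k] H ⊗[k] (H ⊗[k] H) :=
  LinearMap.lTensor H (Algebra.TensorProduct.includeLeft (R := k) (S := k) (A := H)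
    (B := H)).toLinearMap

/-- `x ⊗ y ↦ x ⊗ 1 ⊗ y`. -/
def leg13 : H ⊗[k] H →ₗ[k] H ⊗[k] (H ⊗[k] H) :=
  LinearMap.lTensor H (Algebra.TensorProduct.includeRight (R := k) (A := H)
    (B := H)).toLinearMap

/-- `x ⊗ y ↦ 1 ⊗ x ⊗ y`. -/
def leg23 : H ⊗[k] H →ₗ[k] H ⊗[k] (H ⊗[k] H) :=
  (Algebra.TensorProduct.includeRight (R := k) (A := H) (B := H ⊗[k] H)).toLinearMap

/-- A ribbon structure on a Hopf algebra `H`: an R-matrix together with a ribbon element. -/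
structure RibbonStructure where
  /-- the R-matrix -/
  R : (H ⊗[k] H)ˣ
  /-- `R` intertwines the coproduct and the opposite coproduct -/
  R_comul (h : H) : (R : H ⊗[k] H) * Coalgebra.comul h = flip k H (Coalgebra.comul h) * (R : H ⊗[k] H)
  /-- `(Δ ⊗ id) R = R₁₃ R₂₃` -/
  comul_rTensor_R :
    TensorProduct.assoc k H H H (LinearMap.rTensor H Coalgebra.comul (R : H ⊗[k] H)) =
      leg13 k H R * leg23 k H R
  /-- `(id ⊗ Δ) R = R₁₃ R₁₂` -/
  comul_lTensor_R :
    LinearMap.lTensor H Coalgebra.comul (R : H ⊗[k] H) = leg13 k H R * leg12 k H R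
  /-- the ribbon element -/
  v : Hˣ
  v_central (h : H) : (v : H) * h = h * v
  antipode_v : HopfAlgebra.antipode k (v : H) = v
  counit_v : Coalgebra.counit (R := k) (v : H) = 1
  /-- `Δ v = (v ⊗ v) Q⁻¹` with `Q = R₂₁ R` the monodromy matrix -/
  comul_v : Coalgebra.comul (R := k) (v : H) =
    ((v : H) ⊗ₜ[k] (v : H)) *
      (((Units.map (flip k H : H ⊗[k] H →* H ⊗[k] H) R * R)⁻¹ : (H ⊗[k] H)ˣ) : H ⊗[k] H)

namespace RibbonStructure

variable {k H} (r : RibbonStructure k H)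

/-- `R₂₁`, as an invertible element. -/
def R21 : (H ⊗[k] H)ˣ := Units.map (flip k H : H ⊗[k] H →* H ⊗[k] H) r.R

/-- The monodromy matrix `Q = R₂₁ R`. -/
def Q : (H ⊗[k] H)ˣ := r.R21 * r.R

/-- The Drinfeld element `u = m ∘ (S ⊗ id) (R₂₁)`. -/
def drinfeldElement : H :=
  LinearMap.mul' k H (LinearMap.rTensor H (HopfAlgebra.antipode k) (r.R21 : H ⊗[k] H))

/-- `t = u v⁻¹`. -/
def t : H := r.drinfeldElement * ((r.v⁻¹ : Hˣ) : H)

/-- The monodromy matrix can be written as `Q = ∑ h_ℓ ⊗ k_ℓ` with two bases of `H`. -/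
def IsFactorizable : Prop :=
  ∃ (n : ℕ) (b c : Module.Basis (Fin n) k H), (r.Q : H ⊗[k] H) = ∑ l, b l ⊗ₜ[k] c l

open HopfAlgebra Coalgebra in
theorem phi_flip_comul_mul (p : H) (z : H ⊗[k] H) :
    LinearMap.mul' k H (LinearMap.rTensor H (antipode k) (flip k H (flip k H (comul p) * z))) =
      counit (R := k) p •
        LinearMap.mul' k H (LinearMap.rTensor H (antipode k) (flip k H z)) := by
  induction z with
  | zero => simp
  | add z w hz hw => simp only [mul_add, map_add, hz, hw, smul_add]
  | tmul x y =>
    have key : ∀ d : H ⊗[k] H,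
        LinearMap.mul' k H (LinearMap.rTensor H (antipode k)
          (flip k H (flip k H d * x ⊗ₜ[k] y))) =
        antipode k y * LinearMap.mul' k H (LinearMap.rTensor H (antipode k) d) * x := by
      intro d
      induction d with
      | zero => simp
      | add d e hd he => simp only [add_mul, mul_add, map_add, hd, he]
      | tmul a b => simp [antipode_mul_antidistrib, mul_assoc]
    rw [key, mul_antipode_rTensor_comul_apply]
    simp [Algebra.algebraMap_eq_smul_one]

open HopfAlgebra Coalgebra in
/-- `S² (h) u = u h` for the Drinfeld element `u`. -/
theorem sq_antipode_mul_drinfeldElement (h : H) :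
    antipode k (antipode k h) * r.drinfeldElement = r.drinfeldElement * h := by
  have hu : r.drinfeldElement =
      LinearMap.mul' k H (LinearMap.rTensor H (antipode k) (flip k H (r.R : H ⊗[k] H))) := rfl
  set ph : H ⊗[k] H →ₗ[k] H := LinearMap.mul' k H ∘ₗ LinearMap.rTensor H (antipode k) ∘ₗ
    (flip k H).toLinearMap with hph
  have hu' : r.drinfeldElement = ph (r.R : H ⊗[k] H) := rfl
  set w := r.drinfeldElement with hw
  set N : H ⊗[k] H →ₗ[k] H := antipode k ∘ₗ LinearMap.mul' k H ∘ₗ LinearMap.lTensor H (antipode k)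
    with hN
  set G : H ⊗[k] (H ⊗[k] H) →ₗ[k] H := LinearMap.mul' k H ∘ₗ
    TensorProduct.map N (LinearMap.mulLeft k w) ∘ₗ
      (TensorProduct.comm k H (H ⊗[k] H)).toLinearMap with hG
  have h1 : ∀ p q : H, antipode k (antipode k q) * ph ((r.R : H ⊗[k] H) * comul p) =
      counit (R := k) p • (antipode k (antipode k q) * w) := by
    intro p q
    rw [r.R_comul]
    have := phi_flip_comul_mul p (r.R : H ⊗[k] H)
    rw [show ph (flip k H (comul p) * (r.R : H ⊗[k] H)) = counit (R := k) p • w from this]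
    simp
  have h2 : ∀ p q : H, antipode k (antipode k q) * ph ((r.R : H ⊗[k] H) * comul p) =
      G (TensorProduct.assoc k H H H (comul p ⊗ₜ q)) := by
    intro p q
    rw [hu'] at hG
    have key : ∀ (z d : H ⊗[k] H), antipode k (antipode k q) * ph (z * d) =
        (LinearMap.mul' k H ∘ₗ TensorProduct.map N (LinearMap.mulLeft k (ph z)) ∘ₗ
      (TensorProduct.comm k H (H ⊗[k] H)).toLinearMap)
          (TensorProduct.assoc k H H H (d ⊗ₜ q)) := by
      intro z d
      induction d with
      | zero => simp
      | add d e hd he => simp only [mul_add, map_add, TensorProduct.add_tmul, hd, he]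
      | tmul a b =>
        induction z with
        | zero => simp
        | add x y hx hy =>
          simp only [mul_add, add_mul, map_add, hx, hy]
          simp [mul_add, add_mul]
        | tmul x y => simp [hph, hN, antipode_mul_antidistrib, mul_assoc]
    rw [key, hG]
  have h3 : ∀ d : H ⊗[k] H, G (TensorProduct.assoc k H H H (LinearMap.rTensor H comul d)) =
      antipode k (antipode k (TensorProduct.lid k H (LinearMap.rTensor H counit d))) * w := by
    intro d
    induction d with
    | zero => simp
    | add d e hd he => simp only [map_add, hd, he, add_mul]
    | tmul a b =>
      rw [LinearMap.rTensor_tmul, ← h2, h1]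
      simp
  have h4 : ∀ d : H ⊗[k] H, G (LinearMap.lTensor H comul d) =
      w * (TensorProduct.rid k H (LinearMap.lTensor H counit d)) := by
    intro d
    induction d with
    | zero => simp
    | add d e hd he => simp only [map_add, hd, he, mul_add]
    | tmul a b =>
      simp [hG, hN, Algebra.algebraMap_eq_smul_one]
  have h5 := h3 (comul h)
  rw [Coalgebra.coassoc_apply, h4] at h5
  simpa using h5.symm

open HopfAlgebra Coalgebra in
theorem antipode_injective (r : RibbonStructure k H) :
    Function.Injective (antipode k : H →ₗ[k] H) := by
  set ps : H ⊗[k] H →ₗ[k] H := LinearMap.mul' k H ∘ₗ TensorProduct.map (antipode k)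
    (antipode k ∘ₗ antipode k) ∘ₗ (TensorProduct.comm k H H).toLinearMap with hps
  have key : ∀ (z d : H ⊗[k] H),
      (∀ c, antipode k (antipode k c) * LinearMap.mul' k H (LinearMap.rTensor H (antipode k)
        (flip k H z)) = LinearMap.mul' k H (LinearMap.rTensor H (antipode k) (flip k H z)) * c) →
      LinearMap.mul' k H (LinearMap.rTensor H (antipode k) (flip k H (z * d))) =
        ps d * LinearMap.mul' k H (LinearMap.rTensor H (antipode k) (flip k H z)) := by
    intro z d hz
    have key2 : ∀ c e : H, LinearMap.mul' k H (LinearMap.rTensor H (antipode k)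
        (flip k H (z * c ⊗ₜ e))) = antipode k e * (LinearMap.mul' k H
          (LinearMap.rTensor H (antipode k) (flip k H z)) * c) := by
      intro c e
      clear hz
      induction z with
      | zero => simp
      | add x y hx hy => simp only [add_mul, mul_add, map_add, hx, hy]
      | tmul x y => simp [antipode_mul_antidistrib, mul_assoc]
    induction d with
    | zero => simp
    | add d e hd he => simp only [mul_add, add_mul, map_add, hd, he]
    | tmul c e => rw [key2, ← hz]; simp [hps, mul_assoc]
  have h1 := key (r.R : H ⊗[k] H) ((r.R⁻¹ : (H ⊗[k] H)ˣ) : H ⊗[k] H)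
    (fun c => r.sq_antipode_mul_drinfeldElement c)
  rw [Units.mul_inv] at h1
  have h2 : ps ((r.R⁻¹ : (H ⊗[k] H)ˣ) : H ⊗[k] H) * r.drinfeldElement = 1 := by
    refine Eq.trans h1.symm ?_
    simp [Algebra.TensorProduct.one_def]
  rw [injective_iff_map_eq_zero]
  intro h hh
  have h3 := r.sq_antipode_mul_drinfeldElement h
  rw [hh, map_zero, zero_mul] at h3
  calc h = ps ((r.R⁻¹ : (H ⊗[k] H)ˣ) : H ⊗[k] H) * (r.drinfeldElement * h) := by
        rw [← mul_assoc, h2, one_mul]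
    _ = 0 := by rw [← h3, mul_zero]

variable [FiniteDimensional k H]

/-- The antipode as a bijection; a ribbon structure and finite dimension make it invertible. -/
def antipodeEquiv : H ≃ₗ[k] H :=
  LinearEquiv.ofInjectiveEndo (HopfAlgebra.antipode k) r.antipode_injective

/-- The inverse antipode, as an algebra homomorphism from `H` to the opposite algebra. -/
def antipodeInvAlgHomOp : H →ₐ[k] Hᵐᵒᵖ :=
  .ofLinearMap ((opLinearEquiv k).toLinearMap ∘ₗ r.antipodeEquiv.symm.toLinearMap)
    (by
      apply unop_injective
      apply r.antipodeEquiv.injective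
      simp [antipodeEquiv])
    (fun x y => by
      apply unop_injective
      apply r.antipodeEquiv.injective
      have h (z : H) : HopfAlgebra.antipode k (r.antipodeEquiv.symm z) = z :=
        r.antipodeEquiv.apply_symm_apply z
      have h' (z : H) : r.antipodeEquiv z = HopfAlgebra.antipode k z := rfl
      simp [h, h', HopfAlgebra.antipode_mul_antidistrib])

end RibbonStructure

end Ribbon

/-- The opposite algebra of a bialgebra, with unchanged coproduct and counit. -/
instance instBialgebraOp (k H : Type u) [Field k] [Ring H] [Bialgebra k H] :
    Bialgebra k Hᵐᵒᵖ :=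
  Bialgebra.mk' k Hᵐᵒᵖ
    (by simp [MulOpposite.counit_def])
    (fun {a b} => by simp [MulOpposite.counit_def, mul_comm])
    (by simp [MulOpposite.comul_def, Algebra.TensorProduct.one_def])
    (fun {a b} => by
      have key : ∀ x y : H ⊗[k] H,
          TensorProduct.map (opLinearEquiv k (M := H)).toLinearMap
            (opLinearEquiv k (M := H)).toLinearMap (y * x) =
          TensorProduct.map (opLinearEquiv k (M := H)).toLinearMap
            (opLinearEquiv k (M := H)).toLinearMap x *
          TensorProduct.map (opLinearEquiv k (M := H)).toLinearMap
            (opLinearEquiv k (M := H)).toLinearMap y := by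
        intro x y
        induction x with
        | zero => simp
        | add x x' hx hx' => simp only [mul_add, add_mul, map_add, hx, hx']
        | tmul a b =>
          induction y with
          | zero => simp
          | add y y' hy hy' => simp only [mul_add, add_mul, map_add, hy, hy']
          | tmul c d => simp
      simp [MulOpposite.comul_def, key])

/-! ### Finite-dimensional modules and their structure -/

section Modules

variable (k A : Type u) [Field k] [Ring A]

/-- Finite-dimensional left modules over the `k`-algebra `A`. -/
structure FDMod [Algebra k A] : Type (u + 1) where
  carrier : Type u
  [addCommGroup : AddCommGroup carrier]
  [module : Module k carrier]
  [finiteDimensional : FiniteDimensional k carrier]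
  /-- the action of `A` -/
  ρ : A →ₐ[k] Module.End k carrier

instance [Algebra k A] : CoeSort (FDMod k A) (Type u) := ⟨FDMod.carrier⟩

attribute [instance] FDMod.addCommGroup FDMod.module FDMod.finiteDimensional

/-- The structure of an `A`-module in the sense of Mathlib. -/
instance [Algebra k A] (V : FDMod k A) : Module A V :=
  Module.compHom V (V.ρ : A →+* Module.End k V)

/-- For a bialgebra `A`, the data from which duals, braiding and sovereign structure of the
category of finite-dimensional `A`-modules are built. It is only ever used for the two
instances `chiral` and `bulk` below. -/
structure CatData [Algebra k A] where
  /-- the antipode -/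
  S : A →ₐ[k] Aᵐᵒᵖ
  /-- the R-matrix -/
  R : A ⊗[k] A
  /-- the element that implements the sovereign structure -/
  t : A

variable {k A}

/-- Transposition, `x ↦ (α ↦ α ∘ x)`, as an algebra homomorphism. -/
def transposeAlgHom (W : Type u) [AddCommGroup W] [Module k W] :
    (Module.End k W)ᵐᵒᵖ →ₐ[k] Module.End k (Module.Dual k W) :=
  .ofLinearMap ((Module.Dual.transpose (R := k) (M := W) (M' := W)) ∘ₗ
    (opLinearEquiv k).symm.toLinearMap) (by ext; rfl) (fun x y => by ext; rfl)

/-- On `A*`: `a ↦ (α ↦ α (a · _))`. -/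
def dualLeft (A : Type u) [Ring A] [Algebra k A] :
    Aᵐᵒᵖ →ₐ[k] Module.End k (Module.Dual k A) :=
  (transposeAlgHom A).comp (AlgHom.op (Algebra.lmul k A))

/-- On `A*`: `a ↦ (α ↦ α (_ · a))`. -/
def dualRight (A : Type u) [Ring A] [Algebra k A] :
    A →ₐ[k] Module.End k (Module.Dual k A) :=
  .ofLinearMap ((Module.Dual.transpose (R := k) (M := A) (M' := A)) ∘ₗ (LinearMap.mul k A).flip)
    (by ext; simp [Module.Dual.transpose]) (fun x y => by ext; simp [Module.Dual.transpose, mul_assoc])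

namespace FDMod

section General

variable [Algebra k A]

/-- `f` is a morphism of `A`-modules. -/
def IsHom {V W : FDMod k A} (f : V →ₗ[k] W) : Prop :=
  ∀ (a : A) (x : V), f (V.ρ a x) = W.ρ a (f x)

/-- Isomorphism of `A`-modules. -/
def Iso (V W : FDMod k A) : Prop := Nonempty (V ≃ₗ[A] W)

/-- The family `S` is a full set of representatives of the isomorphism classes of simple
modules. -/
structure IsSimpleRepresentatives {I : Type v} (S : I → FDMod k A) : Prop where
  simple (i : I) : IsSimpleModule A (S i)
  eq_of_iso (i j : I) : Iso (S i) (S j) → i = j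
  exists_iso (V : FDMod k A) : IsSimpleModule A V → ∃ i, Iso V (S i)

/-- `P` is a projective cover of `V`: it is projective and there is a surjection `P → V` with
superfluous kernel. -/
def IsProjectiveCover (P V : FDMod k A) : Prop :=
  Module.Projective A P ∧ ∃ p : P →ₗ[A] V, Function.Surjective p ∧
    ∀ N : Submodule A P, N ⊔ LinearMap.ker p = ⊤ → N = ⊤

open Classical in
/-- The Jordan-Hölder multiplicity `[V : S]`, the number of subquotients isomorphic to `S` in a
composition series of `V` (which exists, since `V` is finite-dimensional). -/
def multiplicity (V S : FDMod k A) : ℕ :=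
  if h : ∃ s : CompositionSeries (Submodule A V), s.head = ⊥ ∧ s.last = ⊤ then
    (Finset.univ.filter fun l : Fin h.choose.length =>
      Nonempty ((↥(h.choose l.succ) ⧸
        (h.choose l.castSucc).comap (h.choose l.succ).subtype) ≃ₗ[A] S)).card
  else 0

variable (k A) in
/-- The algebra `A` as a left module over itself. -/
def regular [FiniteDimensional k A] : FDMod k A where
  carrier := A
  ρ := Algebra.lmul k A

end General

section Bialgebra

variable [Bialgebra k A] (D : CatData k A)

variable (k A) in
/-- The tensor unit. -/
def unit : FDMod k A where
  carrier := k
  ρ := (Algebra.lmul k k).comp (Bialgebra.counitAlgHom k A)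

/-- The action of `A ⊗ A` on `V ⊗ W`. -/
def tensorAct (V W : FDMod k A) : A ⊗[k] A →ₐ[k] Module.End k (V ⊗[k] W) :=
  (Module.endTensorEndAlgHom (R := k) (S := k) (A := k)).comp
    (Algebra.TensorProduct.map V.ρ W.ρ)

/-- The tensor product of modules. -/
def tensor (V W : FDMod k A) : FDMod k A where
  carrier := V ⊗[k] W
  ρ := (tensorAct V W).comp (Bialgebra.comulAlgHom k A)

/-- The dual `V^∨` with action `(a f) (x) = f (S(a) x)`. -/
def dual (V : FDMod k A) : FDMod k A where
  carrier := Module.Dual k V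
  ρ := ((transposeAlgHom V).comp (AlgHom.op V.ρ)).comp D.S

/-- The braiding `c_{V,W} = τ ∘ R`. -/
def braiding (V W : FDMod k A) : V ⊗[k] W →ₗ[k] W ⊗[k] V :=
  (TensorProduct.comm k V W).toLinearMap ∘ₗ tensorAct V W D.R

theorem tensorAct_map {V V' W W' : FDMod k A} {f : V →ₗ[k] V'} {g : W →ₗ[k] W'} (hf : IsHom f)
    (hg : IsHom g) (d : A ⊗[k] A) (z : V ⊗[k] W) :
    tensorAct V' W' d (TensorProduct.map f g z) = TensorProduct.map f g (tensorAct V W d z) := by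
  induction d with
  | zero => simp
  | add d e hd he => simp only [map_add, LinearMap.add_apply, hd, he]
  | tmul a b =>
    induction z with
    | zero => simp
    | add x y hx hy => simp only [map_add, hx, hy]
    | tmul x y =>
      change (V'.ρ a (f x)) ⊗ₜ[k] (W'.ρ b (g y)) = f (V.ρ a x) ⊗ₜ[k] g (W.ρ b y)
      rw [hf, hg]

theorem braiding_map {V V' W W' : FDMod k A} {f : V →ₗ[k] V'} {g : W →ₗ[k] W'} (hf : IsHom f)
    (hg : IsHom g) (z : V ⊗[k] W) :
    braiding D V' W' (TensorProduct.map f g z) = TensorProduct.map g f (braiding D V W z) := by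
  refine (congrArg (TensorProduct.comm k V' W') (tensorAct_map hf hg D.R z)).trans ?_
  exact (TensorProduct.map_comm g f _).symm

theorem isHom_id (V : FDMod k A) : IsHom (V := V) (W := V) LinearMap.id := fun _ _ => rfl

theorem isHom_map {V V' W W' : FDMod k A} {f : V →ₗ[k] V'} {g : W →ₗ[k] W'} (hf : IsHom f)
    (hg : IsHom g) : IsHom (V := V.tensor W) (W := V'.tensor W') (TensorProduct.map f g) :=
  fun a z => (tensorAct_map hf hg (Coalgebra.comul a) z).symm

/-- The transpose `f^∨ : W^∨ → V^∨` of `f : V → W`. -/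
def dualMap {V W : FDMod k A} (f : V →ₗ[k] W) : W.dual D →ₗ[k] V.dual D :=
  Module.Dual.transpose (R := k) f

theorem isHom_dualMap {V W : FDMod k A} {f : V →ₗ[k] W} (hf : IsHom f) :
    IsHom (dualMap D f) := by
  intro a g
  apply LinearMap.ext
  intro x
  exact congrArg (show Module.Dual k W from g) (hf _ x).symm

/-- The evaluation `d_V : V^∨ ⊗ V → 1`. -/
def ev (V : FDMod k A) : V.dual D ⊗[k] V →ₗ[k] k := contractLeft k V

/-- The coevaluation `b_V : 1 → V ⊗ V^∨`. -/
def coev (V : FDMod k A) : k →ₗ[k] V ⊗[k] V.dual D := coevaluation k V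

/-- The sovereignty isomorphism `π_V : V^∨ → ^∨V`, `f ↦ f (t · _)`; the right dual and the left
dual have the same underlying vector space. -/
def sov (V : FDMod k A) : V.dual D →ₗ[k] Module.Dual k V :=
  Module.Dual.transpose (R := k) (V.ρ D.t)

/-- The evaluation `V ⊗ ^∨V → 1` of the left duality. -/
def evLeft (V : FDMod k A) : V ⊗[k] Module.Dual k V →ₗ[k] k := contractRight k V

/-- `γ_{U,V} : U^∨ ⊗ V^∨ → (V ⊗ U)^∨`, `(f ⊗ g) ↦ (y ⊗ x ↦ g (y) f (x))`. -/
def gamma (U V : FDMod k A) : U.dual D ⊗[k] V.dual D →ₗ[k] Module.Dual k (V ⊗[k] U) :=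
  TensorProduct.dualDistrib k V U ∘ₗ
    (TensorProduct.comm k (Module.Dual k U) (Module.Dual k V)).toLinearMap

/-! ### The coend `∫^U U^∨ ⊗ U` -/

/-- Dinaturality of a family of linear maps `U^∨ ⊗ U → B`. -/
def IsDinatural {B : Type u} [AddCommGroup B] [Module k B]
    (φ : ∀ U : FDMod k A, U.dual D ⊗[k] U →ₗ[k] B) : Prop :=
  ∀ (U V : FDMod k A) (f : U →ₗ[k] V), IsHom f →
    ∀ (g : V.dual D) (x : U), φ U (dualMap D f g ⊗ₜ x) = φ V (g ⊗ₜ f x)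

/-- `(L, ι)` is a coend of the functor `(U, V) ↦ U^∨ ⊗ V`. -/
structure IsCoend (L : FDMod k A) (ι : ∀ U : FDMod k A, U.dual D ⊗[k] U →ₗ[k] L) : Prop where
  isHom (U : FDMod k A) : IsHom (V := (U.dual D).tensor U) (ι U)
  dinatural : IsDinatural D ι
  universal (B : FDMod k A) (φ : ∀ U : FDMod k A, U.dual D ⊗[k] U →ₗ[k] B) :
    (∀ U : FDMod k A, IsHom (V := (U.dual D).tensor U) (φ U)) → IsDinatural D φ →
      ∃! κ : L →ₗ[k] B, IsHom κ ∧ ∀ U, κ ∘ₗ ι U = φ U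

/-- `a ⊗ b ↦ (α ↦ α (S(a) · _ · b))`. -/
def coadjointAct : A ⊗[k] A →ₐ[k] Module.End k (Module.Dual k A) :=
  Algebra.TensorProduct.lift ((dualLeft A).comp D.S) (dualRight A)
    (fun a b => by
      apply LinearMap.ext; intro α; apply LinearMap.ext; intro x
      simp [dualLeft, dualRight, transposeAlgHom, Module.Dual.transpose, mul_assoc])

theorem coadjointAct_tmul (a b : A) (α : Module.Dual k A) (x : A) :
    coadjointAct D (a ⊗ₜ b) α x = α ((D.S a).unop * x * b) := by
  simp [coadjointAct, dualLeft, dualRight, transposeAlgHom, Module.Dual.transpose, mul_assoc]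

variable [FiniteDimensional k A]

/-- The coend as a module: `A*` with the coadjoint action
`(a α) (x) = α (S(a₍₁₎) x a₍₂₎)`. -/
def coend : FDMod k A where
  carrier := Module.Dual k A
  ρ := (coadjointAct D).comp (Bialgebra.comulAlgHom k A)

/-- The dinatural family `ι_U : U^∨ ⊗ U → A*`, `f ⊗ x ↦ (a ↦ f (a x))`. -/
def coendι (U : FDMod k A) : U.dual D ⊗[k] U →ₗ[k] coend D :=
  (TensorProduct.lift (LinearMap.mk₂ k
    (fun (f : Module.Dual k U) (x : U) => f ∘ₗ LinearMap.applyₗ x ∘ₗ U.ρ.toLinearMap)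
    (fun _ _ _ => by ext; simp) (fun _ _ _ => by ext; simp)
    (fun _ _ _ => by ext; simp) (fun _ _ _ => by ext; simp)) :
      Module.Dual k U ⊗[k] U →ₗ[k] Module.Dual k A)

/-- `α ↦ α ⊗ 1`, a linear section of `ι_A`. Hence a linear map `κ` out of the coend is
`α ↦ φ_A (α ⊗ 1)` when `κ ∘ ι_U = φ_U` for all `U`. -/
def coendSection : coend D →ₗ[k] (regular k A).dual D ⊗[k] regular k A :=
  (TensorProduct.mk k (Module.Dual k A) A).flip 1

theorem coendι_apply (U : FDMod k A) (f : Module.Dual k U) (x : U) (a : A) :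
    (show Module.Dual k A from coendι D U (f ⊗ₜ x)) a = f (U.ρ a x) := rfl

theorem coendι_coendSection (α : coend D) : coendι D (regular k A) (coendSection D α) = α := by
  apply LinearMap.ext
  intro a
  exact congrArg (show Module.Dual k A from α) (mul_one a)

theorem coendι_isHom (U : FDMod k A) : IsHom (V := (U.dual D).tensor U) (coendι D U) := by
  have key : ∀ d : A ⊗[k] A,
      (coendι D U : Module.Dual k U ⊗[k] U →ₗ[k] Module.Dual k A) ∘ₗ
        (tensorAct (U.dual D) U d : Module.Dual k U ⊗[k] U →ₗ[k] Module.Dual k U ⊗[k] U) =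
      coadjointAct D d ∘ₗ (coendι D U : Module.Dual k U ⊗[k] U →ₗ[k] Module.Dual k A) := by
    intro d
    induction d with
    | zero =>
      rw [map_zero, map_zero]
      exact (LinearMap.comp_zero _).trans (LinearMap.zero_comp _).symm
    | add d e hd he =>
      rw [map_add, map_add]
      exact (LinearMap.comp_add _ _ _).trans
        ((congrArg₂ (· + ·) hd he).trans (LinearMap.add_comp _ _ _).symm)
    | tmul b c =>
      apply TensorProduct.ext'
      intro f x
      apply LinearMap.ext
      intro y
      refine Eq.trans ?_ (coadjointAct_tmul D b c _ y).symm
      change (show Module.Dual k U from f) (U.ρ (D.S b).unop (U.ρ y (U.ρ c x))) =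
        (show Module.Dual k U from f) (U.ρ ((D.S b).unop * y * c) x)
      simp
  intro a z
  exact LinearMap.congr_fun (key (Coalgebra.comul a)) z

/-- The map `α ↦ φ_A (α ⊗ 1)` induced by a dinatural family `φ`. -/
theorem IsDinatural.comp_coendι {D : CatData k A} {B : Type u} [AddCommGroup B] [Module k B]
    {φ : ∀ U : FDMod k A, U.dual D ⊗[k] U →ₗ[k] B} (hd : IsDinatural D φ) (U : FDMod k A) :
    (φ (regular k A) ∘ₗ coendSection D) ∘ₗ coendι D U = φ U := by
  apply TensorProduct.ext'
  intro f x
  have h1 : IsHom (V := regular k A) (W := U) (LinearMap.applyₗ x ∘ₗ U.ρ.toLinearMap) := by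
    intro a b
    change U.ρ (a * (show A from b)) x = U.ρ a (U.ρ (show A from b) x)
    rw [map_mul]
    rfl
  refine (hd (regular k A) U _ h1 f (1 : A)).trans ?_
  congr 2
  change U.ρ 1 x = x
  simp

theorem coendι_dinatural : IsDinatural D (coendι D) := by
  intro U V f hf g x
  apply LinearMap.ext
  intro a
  exact congrArg (show Module.Dual k V from g) (hf a x)

theorem coend_isCoend : IsCoend D (coend D) (coendι D) where
  isHom := coendι_isHom D
  dinatural := coendι_dinatural D
  universal B φ hφ hd := by
    have hφι : ∀ U, (φ (regular k A) ∘ₗ coendSection D) ∘ₗ coendι D U = φ U :=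
      hd.comp_coendι
    refine ⟨φ (regular k A) ∘ₗ coendSection D, ⟨?_, hφι⟩, ?_⟩
    · intro a α
      have h3 : ∀ z, (φ (regular k A) ∘ₗ coendSection D) (coendι D (regular k A) z) =
          φ (regular k A) z := fun z => LinearMap.congr_fun (hφι (regular k A)) z
      have h4 := (coendι_isHom D (regular k A) a (coendSection D α)).trans
        (congrArg _ (coendι_coendSection D α))
      rw [← h4]
      exact (h3 _).trans (hφ (regular k A) a (coendSection D α))
    · rintro κ ⟨-, hκ⟩
      apply LinearMap.ext
      intro α
      rw [LinearMap.comp_apply, ← hκ, LinearMap.comp_apply, coendι_coendSection]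

/-! ### The algebra structure of the coend and its modules -/

/-- The counit of the coend, `ε ∘ ι_U = d_U`. -/
def coendCounit : coend D →ₗ[k] k := ev D (regular k A) ∘ₗ coendSection D

theorem coendCounit_comp_coendι (U : FDMod k A) : coendCounit D ∘ₗ coendι D U = ev D U :=
  IsDinatural.comp_coendι (φ := ev D) (fun _ _ _ _ _ _ => rfl) U

/-- The unit of the coend, `η = ι_1`. -/
def coendUnit : k →ₗ[k] coend D :=
  coendι D (unit k A) ∘ₗ (TensorProduct.mk k (Module.Dual k k) k LinearMap.id)

/-- `ι_{V ⊗ U}`, with the underlying vector spaces written out. -/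
def coendιTensor (V U : FDMod k A) :
    Module.Dual k (V ⊗[k] U) ⊗[k] (V ⊗[k] U) →ₗ[k] coend D := coendι D (V.tensor U)

/-- `ι_{V ⊗ U} ∘ (γ_{U,V} ⊗ id) : U^∨ ⊗ V^∨ ⊗ V ⊗ U → A*`. -/
def mulTail (U V : FDMod k A) :
    U.dual D ⊗[k] ((V.dual D ⊗[k] V) ⊗[k] U) →ₗ[k] coend D :=
  coendιTensor D V U ∘ₗ
    LinearMap.rTensor (V ⊗[k] U) (gamma D U V) ∘ₗ
    (TensorProduct.assoc k (U.dual D) (V.dual D) (V ⊗[k] U)).symm.toLinearMap ∘ₗ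
    LinearMap.lTensor (U.dual D) (TensorProduct.assoc k (V.dual D) V U).toLinearMap

/-- The family `ι_{V ⊗ U} ∘ (γ_{U,V} ⊗ id) ∘ (id ⊗ c_{U, V^∨ ⊗ V})`. -/
def mulFamily (U V : FDMod k A) :
    (U.dual D ⊗[k] U) ⊗[k] (V.dual D ⊗[k] V) →ₗ[k] coend D :=
  mulTail D U V ∘ₗ
    LinearMap.lTensor (U.dual D) (braiding D U ((V.dual D).tensor V)) ∘ₗ
    (TensorProduct.assoc k (U.dual D) U (V.dual D ⊗[k] V)).toLinearMap

/-- The product of the coend, `m ∘ (ι_U ⊗ ι_V) = mulFamily U V`. -/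
def coendMul : coend D ⊗[k] coend D →ₗ[k] coend D :=
  mulFamily D (regular k A) (regular k A) ∘ₗ
    TensorProduct.map (coendSection D) (coendSection D)

theorem coendMul_comp_coendι (U V : FDMod k A) :
    coendMul D ∘ₗ TensorProduct.map (coendι D U) (coendι D V) = mulFamily D U V := by
  have hd : ∀ (V : FDMod k A) (y : V.dual D ⊗[k] V), IsDinatural D (B := coend D)
      (fun U => mulFamily D U V ∘ₗ
        (TensorProduct.mk k (U.dual D ⊗[k] U) (V.dual D ⊗[k] V)).flip y) := by
    intro V y U W f hf g x
    have h1 : ∀ w : (V.dual D ⊗[k] V) ⊗[k] U,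
        mulTail D U V (dualMap D f g ⊗ₜ w) =
        mulTail D W V (g ⊗ₜ TensorProduct.map LinearMap.id f w) := by
      intro w
      induction w with
      | zero => simp
      | add a b ha hb => simp only [map_add, TensorProduct.tmul_add, ha, hb]
      | tmul a b =>
        induction a with
        | zero => simp
        | add c d hc hd => simp only [map_add, TensorProduct.tmul_add, TensorProduct.add_tmul, hc, hd]
        | tmul p q =>
          refine Eq.trans ?_ (coendι_dinatural D (V.tensor U) (V.tensor W)
            (TensorProduct.map LinearMap.id f) (isHom_map (isHom_id V) hf)
            (gamma D W V (g ⊗ₜ p)) (q ⊗ₜ b))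
          refine congrArg (fun s => coendιTensor D V U (s ⊗ₜ (q ⊗ₜ b))) ?_
          apply TensorProduct.ext'
          intro _ _
          rfl
    refine (h1 (braiding D U ((V.dual D).tensor V) (x ⊗ₜ y))).trans ?_
    exact congrArg (fun s => mulTail D W V (g ⊗ₜ s))
      (braiding_map D hf (isHom_id ((V.dual D).tensor V)) (x ⊗ₜ y)).symm
  have hd' : ∀ (U : FDMod k A) (x : U.dual D ⊗[k] U), IsDinatural D (B := coend D)
      (fun V => mulFamily D U V ∘ₗ
        TensorProduct.mk k (U.dual D ⊗[k] U) (V.dual D ⊗[k] V) x) := by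
    intro U z V W f hf g y
    have h1 : ∀ (p : U.dual D) (w : (W.dual D ⊗[k] V) ⊗[k] U),
        mulTail D U V (p ⊗ₜ TensorProduct.map
          (TensorProduct.map (dualMap D f) LinearMap.id) LinearMap.id w) =
        mulTail D U W (p ⊗ₜ TensorProduct.map
          (TensorProduct.map LinearMap.id f) LinearMap.id w) := by
      intro p w
      induction w with
      | zero => simp
      | add a b ha hb => simp only [map_add, TensorProduct.tmul_add, ha, hb]
      | tmul a b =>
        induction a with
        | zero => simp
        | add c d hc hd => simp only [map_add, TensorProduct.tmul_add, TensorProduct.add_tmul, hc, hd]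
        | tmul q s =>
          refine Eq.trans ?_ (coendι_dinatural D (V.tensor U) (W.tensor U)
            (TensorProduct.map f LinearMap.id) (isHom_map hf (isHom_id U))
            (gamma D U W (p ⊗ₜ q)) (s ⊗ₜ b))
          refine congrArg (fun e => coendιTensor D V U (e ⊗ₜ (s ⊗ₜ b))) ?_
          apply TensorProduct.ext'
          intro _ _
          rfl
    have hA := isHom_map (isHom_dualMap D hf) (isHom_id V)
    have hB := isHom_map (isHom_id (W.dual D)) hf
    induction z with
    | zero => simp
    | add a b ha hb =>
      simp only [LinearMap.comp_apply, map_add, LinearMap.add_apply] at ha hb ⊢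
      rw [ha, hb]
    | tmul p x =>
      have e1 := braiding_map D (isHom_id U) hA (x ⊗ₜ (g ⊗ₜ y))
      have e2 := braiding_map D (isHom_id U) hB (x ⊗ₜ (g ⊗ₜ y))
      refine (congrArg (fun s => mulTail D U V (p ⊗ₜ s)) e1).trans ?_
      refine Eq.trans ?_ (congrArg (fun s => mulTail D U W (p ⊗ₜ s)) e2).symm
      exact h1 p _
  apply TensorProduct.ext'
  intro z w
  refine (LinearMap.congr_fun ((hd (regular k A) (coendSection D (coendι D V w))).comp_coendι U)
    z).trans ?_
  exact LinearMap.congr_fun ((hd' U z).comp_coendι V) w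

/-- The family `(ι_U ⊗ id_V) ∘ (id ⊗ (c_{V,U} ∘ c_{U,V}))`. -/
def monodromyFamily (U V : FDMod k A) :
    (U.dual D ⊗[k] U) ⊗[k] V →ₗ[k] coend D ⊗[k] V :=
  LinearMap.rTensor V (coendι D U) ∘ₗ
    (TensorProduct.assoc k (U.dual D) U V).symm.toLinearMap ∘ₗ
    LinearMap.lTensor (U.dual D) (braiding D V U ∘ₗ braiding D U V) ∘ₗ
    (TensorProduct.assoc k (U.dual D) U V).toLinearMap

/-- The partial monodromy of `V` with respect to the coend,
`Q_V ∘ (ι_U ⊗ id_V) = monodromyFamily U V`. -/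
def partialMonodromy (V : FDMod k A) : coend D ⊗[k] V →ₗ[k] coend D ⊗[k] V :=
  monodromyFamily D (regular k A) V ∘ₗ LinearMap.rTensor V (coendSection D)

theorem partialMonodromy_comp_coendι (U V : FDMod k A) :
    partialMonodromy D V ∘ₗ LinearMap.rTensor V (coendι D U) = monodromyFamily D U V := by
  have hd : ∀ y : V, IsDinatural D (B := coend D ⊗[k] V)
      (fun U => monodromyFamily D U V ∘ₗ (TensorProduct.mk k (U.dual D ⊗[k] U) V).flip y) := by
    intro y U W f hf g x
    have h1 : ∀ w : U ⊗[k] V, LinearMap.rTensor V (coendι D U)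
        ((TensorProduct.assoc k (U.dual D) U V).symm
          (dualMap D f g ⊗ₜ w)) =
        LinearMap.rTensor V (coendι D W) ((TensorProduct.assoc k (W.dual D) W V).symm
          (g ⊗ₜ TensorProduct.map f LinearMap.id w)) := by
      intro w
      induction w with
      | zero => simp
      | add a b ha hb => simp only [map_add, TensorProduct.tmul_add, ha, hb]
      | tmul a b => exact congrArg (· ⊗ₜ[k] b) (coendι_dinatural D U W f hf g a)
    refine (h1 (braiding D V U (braiding D U V (x ⊗ₜ y)))).trans ?_
    rw [← braiding_map D (isHom_id V) hf, ← braiding_map D hf (isHom_id V)]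
    rfl
  apply TensorProduct.ext'
  intro z y
  exact LinearMap.congr_fun ((hd y).comp_coendι U) z

/-- The action of the coend on `V`, `(ε ⊗ id_V) ∘ Q_V`. -/
def coendAct (V : FDMod k A) : coend D ⊗[k] V →ₗ[k] V :=
  (TensorProduct.lid k V).toLinearMap ∘ₗ LinearMap.rTensor V (coendCounit D) ∘ₗ
    partialMonodromy D V

/-- `act` makes `V` a module over the algebra `coend D` internal to the category of
`A`-modules. -/
structure IsCoendModule (V : FDMod k A) (act : coend D ⊗[k] V →ₗ[k] V) : Prop where
  isHom : IsHom (V := (coend D).tensor V) act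
  unit_act : act ∘ₗ LinearMap.rTensor V (coendUnit D) = (TensorProduct.lid k V).toLinearMap
  mul_act : act ∘ₗ LinearMap.rTensor V (coendMul D) =
    act ∘ₗ LinearMap.lTensor (coend D) act ∘ₗ
      (TensorProduct.assoc k (coend D) (coend D) V).toLinearMap

/-- The character of the module `(V, act)` over the coend: the partial trace of `act` in the
sovereign category of `A`-modules. -/
def character (V : FDMod k A) (act : coend D ⊗[k] V →ₗ[k] V) : coend D →ₗ[k] k :=
  evLeft V ∘ₗ TensorProduct.map act (sov D V) ∘ₗ
    (TensorProduct.assoc k (coend D) V (V.dual D)).symm.toLinearMap ∘ₗ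
    LinearMap.lTensor (coend D) (coev D V) ∘ₗ
    (TensorProduct.rid k (coend D)).symm.toLinearMap

end Bialgebra

end FDMod

end Modules

/-! ### Left modules and bimodules over a ribbon Hopf algebra -/

section ChiralBulk

variable {k H : Type u} [Field k] [Ring H] [HopfAlgebra k H]

/-- The structure of the category of left `H`-modules. -/
def chiral (r : RibbonStructure k H) : CatData k H where
  S := HopfAlgebra.antipodeAlgHomOp k H
  R := (r.R : H ⊗[k] H)
  t := r.t

variable [FiniteDimensional k H] (r : RibbonStructure k H)

variable (k H) in
/-- Finite-dimensional `H`-bimodules, as left `H ⊗ Hᵒᵖ`-modules; `h ⊗ op h'` acts as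
`x ↦ h x h'`. The tensor product over `k` of two bimodules is a bimodule via the coproduct of
`H`, for the left as well as for the right actions. -/
abbrev Bimod : Type (u + 1) := FDMod k (H ⊗[k] Hᵐᵒᵖ)

/-- The structure of the category of `H`-bimodules:
* the dual of `X` is `X*` with `(h f) (x) = f (S(h) x)` and `(f h) (x) = f (x S⁻¹(h))`;
* the braiding is `x ⊗ y ↦ τ (R₂₁⁻¹ · (x ⊗ y) · R₂₁)`, so that the monodromy is
  `x ⊗ y ↦ Q⁻¹ · (x ⊗ y) · Q`;
* the sovereign structure is `f ↦ f (t · _ · t)`. -/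
def bulk : CatData k (H ⊗[k] Hᵐᵒᵖ) where
  S := (Algebra.TensorProduct.opAlgEquiv k k H Hᵐᵒᵖ).toAlgHom.comp
    (Algebra.TensorProduct.map (HopfAlgebra.antipodeAlgHomOp k H)
      (AlgHom.op r.antipodeInvAlgHomOp))
  R := TensorProduct.tensorTensorTensorComm k H H Hᵐᵒᵖ Hᵐᵒᵖ
    (((r.R21⁻¹ : (H ⊗[k] H)ˣ) : H ⊗[k] H) ⊗ₜ
      TensorProduct.map (opLinearEquiv k).toLinearMap (opLinearEquiv k).toLinearMap
        (r.R21 : H ⊗[k] H))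
  t := r.t ⊗ₜ op r.t

/-- The coregular bimodule: `H*` with `(h f) (x) = f (S(h) x)` and `(f h) (x) = f (x S⁻¹(h))`. -/
def coregular : Bimod k H where
  carrier := Module.Dual k H
  ρ := Algebra.TensorProduct.lift ((dualLeft H).comp (HopfAlgebra.antipodeAlgHomOp k H))
    ((dualRight H).comp (AlgHom.opComm r.antipodeInvAlgHomOp))
    (fun a b => by
      apply LinearMap.ext; intro α; apply LinearMap.ext; intro x
      simp [dualLeft, dualRight, transposeAlgHom, Module.Dual.transpose, mul_assoc])

open FDMod

/-- The chiral Hopf algebra: the coend `∫^U U^∨ ⊗ U` in the category of left `H`-modules. -/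
abbrev chiralL : FDMod k H := coend (chiral r)

/-- The bulk Hopf algebra: the coend `∫^X X^∨ ⊗ X` in the category of `H`-bimodules. -/
abbrev bulkK : Bimod k H := coend (bulk r)

/-- The identification `α ⊗ β ↦ (h ⊗ op h' ↦ α (h) β (h'))` of `L ⊗ L` with `K`. -/
def chiralTensorEquivBulk : chiralL r ⊗[k] chiralL r ≃ₗ[k] bulkK r :=
  (TensorProduct.dualDistribEquiv k H H ≪≫ₗ
    (TensorProduct.congr (LinearEquiv.refl k H) (opLinearEquiv k (M := H)).symm).dualMap :
    Module.Dual k H ⊗[k] Module.Dual k H ≃ₗ[k] Module.Dual k (H ⊗[k] Hᵐᵒᵖ))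

/-- The character `χ^L_V` of the left `H`-module `V`, as a module over `L`. -/
def chiralCharacter (V : FDMod k H) : chiralL r →ₗ[k] k :=
  character (chiral r) V (coendAct (chiral r) V)

/-- The character `χ^K_X` of the `H`-bimodule `X`, as a module over `K`. -/
def bulkCharacter (X : Bimod k H) : bulkK r →ₗ[k] k :=
  character (bulk r) X (coendAct (bulk r) X)

end ChiralBulk

end CardyCartan

end

/-! A linear form α in the coend acts on an object V as the element (α ⊗ id)(M), with M the
monodromy matrix (`coendAct_tmul`). The sovereign partial trace therefore gives χ_V(α) = tr_V(t · (α
⊗ id)(M)) (`character_coendAct`). This holds for the data of any `CatData`; with the axioms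
`CatData.IsQuasitriangular` it also yields the module axioms and the invariance of characters, so
one argument serves both H and H ⊗ Hᵒᵖ.

For bimodules, M consists of Q⁻¹ on the left legs and Q on the right ones (`bulk_monodromy`), so Z
is governed by the trace of a ⊗ op b on the coregular bimodule. Transposition and conjugation by S
turn this into the trace of x ↦ b x S²(a) on H. The core is the identity tr(x ↦ a x b) = ∑
tr_{P_i}(a) tr_{S_i}(b) for a finite-dimensional algebra (`trace_mulLeft_comp_mulRight`), the
numerical form of the fact that A has the same bimodule composition factors as ⊕ P_i ⊗ S_i^*. No
bimodule filtration is needed: for fixed a the trace is a combination of simple characters in b, and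
a dual basis of P_i isolates the i-th coefficient because dim Hom(P_i, S_j) = δ_ij. Since S² is
inner it disappears under tr_{S_i}, and tr_{P_i} = ∑ c_{i,j} tr_{S_j}.

The result is Z(α ⊗ β) = ∑ c_{i,j} tr_{S_i}(t · (α ⊗ id)(Q⁻¹)) χ_j(β). The remaining factor is a
loop with inverse crossings around S_i. Reversing the strand makes it an ordinary loop around the
dual (`RibbonStructure.pairing_monodromy_inv`, `pairing_dual_monodromy_inv`), and reindexing by i ↦
ī puts ī into the Cartan matrix. -/

noncomputable section

open MulOpposite

namespace CardyCartan

/-! ### Traces on finite-dimensional modules -/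

section Trace

variable {k : Type*} [Field k]

/-- The trace is additive on short exact sequences. -/
theorem trace_eq_add_of_exact {N M Q : Type*} [AddCommGroup N] [Module k N] [AddCommGroup M]
    [Module k M] [AddCommGroup Q] [Module k Q] [FiniteDimensional k N] [FiniteDimensional k M]
    [FiniteDimensional k Q] {i : N →ₗ[k] M} {p : M →ₗ[k] Q} (hi : Function.Injective i)
    (hp : Function.Surjective p) (hip : Function.Exact i p) {gN : Module.End k N}
    {g : Module.End k M} {gQ : Module.End k Q} (hN : g ∘ₗ i = i ∘ₗ gN) (hQ : p ∘ₗ g = gQ ∘ₗ p) :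
    LinearMap.trace k M g = LinearMap.trace k N gN + LinearMap.trace k Q gQ := by
  obtain ⟨r, hr⟩ := i.exists_leftInverse_of_injective (LinearMap.ker_eq_bot.2 hi)
  obtain ⟨s, hs⟩ := p.exists_rightInverse_of_surjective (LinearMap.range_eq_top.2 hp)
  have hpi : p ∘ₗ i = 0 := LinearMap.ext fun x => (hip (i x)).2 ⟨x, rfl⟩
  -- the section `s` is corrected so that the retraction `r` kills it
  set s' := s - i ∘ₗ r ∘ₗ s with hs'
  have hs1 : p ∘ₗ s' = LinearMap.id := by
    rw [hs', LinearMap.comp_sub, hs, ← LinearMap.comp_assoc, hpi, LinearMap.zero_comp, sub_zero]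
  -- `M` splits linearly as `N ⊕ Q`, so the trace of `g` is the sum of the traces of its diagonal
  -- blocks r g i and p g s'.
  have hid : i ∘ₗ r + s' ∘ₗ p = LinearMap.id := by
    ext x
    have h1 : p (x - s (p x)) = 0 := by
      rw [map_sub, show p (s (p x)) = p x from LinearMap.congr_fun hs _, sub_self]
    obtain ⟨y, hy⟩ := (hip _).1 h1
    have h2 : r (x - s (p x)) = y := by
      rw [← hy]; exact LinearMap.congr_fun hr y
    have h3 : i (r x) - i (r (s (p x))) = x - s (p x) := by
      rw [← map_sub, ← map_sub, h2, hy]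
    simp only [hs', LinearMap.add_apply, LinearMap.comp_apply, LinearMap.sub_apply,
      LinearMap.id_apply]
    calc i (r x) + (s (p x) - i (r (s (p x))))
        = (i (r x) - i (r (s (p x)))) + s (p x) := by abel
      _ = x := by rw [h3]; abel
  calc LinearMap.trace k M g = LinearMap.trace k M (g ∘ₗ (i ∘ₗ r + s' ∘ₗ p)) := by
        rw [hid, LinearMap.comp_id]
    _ = LinearMap.trace k M ((g ∘ₗ i) ∘ₗ r) + LinearMap.trace k M ((g ∘ₗ s') ∘ₗ p) := by
        rw [LinearMap.comp_add, map_add, LinearMap.comp_assoc, LinearMap.comp_assoc]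
    _ = LinearMap.trace k N (r ∘ₗ g ∘ₗ i) + LinearMap.trace k Q (p ∘ₗ g ∘ₗ s') := by
        rw [LinearMap.trace_comp_comm' (g ∘ₗ i), LinearMap.trace_comp_comm' (g ∘ₗ s')]
    _ = _ := by
        rw [hN, ← LinearMap.comp_assoc s' g p, hQ, LinearMap.comp_assoc s' p gQ, hs1,
          LinearMap.comp_id, ← LinearMap.comp_assoc, hr, LinearMap.id_comp]

end Trace

/-! ### Traces of modules as linear forms on the algebra -/

section ActTrace

variable {k A : Type*} [Field k] [Ring A] [Algebra k A]

/-- The linear form `a ↦ tr_M (a)` of a module `M`. -/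
def actTrace (k : Type*) {A : Type*} [Field k] [Ring A] [Algebra k A] (M : Type*)
    [AddCommGroup M] [Module k M] [Module A M] [IsScalarTower k A M] : A →ₗ[k] k :=
  LinearMap.trace k M ∘ₗ (Algebra.lsmul k k M).toLinearMap

variable {M N : Type*} [AddCommGroup M] [Module k M] [Module A M] [IsScalarTower k A M]
  [AddCommGroup N] [Module k N] [Module A N] [IsScalarTower k A N]

theorem actTrace_apply (a : A) :
    actTrace k M a = LinearMap.trace k M (Algebra.lsmul k k M a) := rfl

theorem actTrace_mul_comm (a b : A) : actTrace k M (a * b) = actTrace k M (b * a) := by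
  rw [actTrace_apply, actTrace_apply, map_mul (Algebra.lsmul k k M),
    map_mul (Algebra.lsmul k k M), LinearMap.trace_mul_comm]

theorem actTrace_congr (e : M ≃ₗ[A] N) :
    (actTrace k M : A →ₗ[k] k) = actTrace k N := by
  ext a
  rw [actTrace_apply, actTrace_apply, ← LinearMap.trace_conj' _ (e.restrictScalars k)]
  congr 1
  ext x
  simp [LinearEquiv.conj_apply]

theorem finiteDimensional_submodule [FiniteDimensional k M] (N : Submodule A M) :
    FiniteDimensional k N :=
  inferInstanceAs (FiniteDimensional k (N.restrictScalars k))

theorem finiteDimensional_quotient [FiniteDimensional k M] (N : Submodule A M) :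
    FiniteDimensional k (M ⧸ N) :=
  Module.Finite.of_surjective (N.mkQ.restrictScalars k) N.mkQ_surjective

/-- The endomorphism `g` is carried along for the induction in `exists_trace_comp_eq_sum`; `g = id`
gives additivity of `actTrace`. -/
theorem trace_submodule_quotient [FiniteDimensional k M] (N : Submodule A M) (g : M →ₗ[A] M)
    (hN : N ≤ N.comap g) (a : A) :
    LinearMap.trace k M (Algebra.lsmul k k M a ∘ₗ g.restrictScalars k) =
      LinearMap.trace k N (Algebra.lsmul k k N a ∘ₗ (g.restrict hN).restrictScalars k) +
        LinearMap.trace k (M ⧸ N)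
          (Algebra.lsmul k k (M ⧸ N) a ∘ₗ (N.mapQ N g hN).restrictScalars k) := by
  have : FiniteDimensional k N := finiteDimensional_submodule N
  have : FiniteDimensional k (M ⧸ N) := finiteDimensional_quotient N
  refine trace_eq_add_of_exact (i := N.subtype.restrictScalars k) (p := N.mkQ.restrictScalars k)
    N.injective_subtype N.mkQ_surjective ?_ ?_ ?_
  · intro x
    simp
  · ext x
    rfl
  · ext x
    rfl

theorem actTrace_submodule_quotient [FiniteDimensional k M] (N : Submodule A M) :
    (actTrace k M : A →ₗ[k] k) = actTrace k N + actTrace k (M ⧸ N) := by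
  ext a
  refine (trace_submodule_quotient N LinearMap.id le_rfl a).trans ?_
  rw [LinearMap.add_apply, actTrace_apply, actTrace_apply]
  congr 2
  ext x
  simp

end ActTrace

/-! ### Simple modules and projective covers -/

namespace FDMod

section Simple

variable {k A : Type u} [Field k] [Ring A] [Algebra k A]

instance (V : FDMod k A) : IsScalarTower k A V where
  smul_assoc c a x := by
    change V.ρ (c • a) x = c • V.ρ a x
    rw [map_smul, LinearMap.smul_apply]

theorem actTrace_eq (V : FDMod k A) (a : A) : actTrace k V a = LinearMap.trace k V (V.ρ a) := rfl

/-- A finite-dimensional module, as an object of `FDMod`. -/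
def ofModule (k : Type u) {A : Type u} [Field k] [Ring A] [Algebra k A] (M : Type u)
    [AddCommGroup M] [Module k M] [Module A M] [IsScalarTower k A M] [FiniteDimensional k M] :
    FDMod k A where
  carrier := M
  ρ := Algebra.lsmul k k M

/-- `ofModule k M` is `M`. -/
def ofModuleEquiv (M : Type u) [AddCommGroup M] [Module k M] [Module A M] [IsScalarTower k A M]
    [FiniteDimensional k M] : M ≃ₗ[A] ofModule (A := A) k M where
  toFun x := x
  invFun x := x
  map_add' _ _ := rfl
  map_smul' _ _ := rfl

variable {I : Type v} {S P : I → FDMod k A}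

namespace IsSimpleRepresentatives

theorem exists_equiv (hS : IsSimpleRepresentatives S) (M : Type u) [AddCommGroup M] [Module k M]
    [Module A M] [IsScalarTower k A M] [FiniteDimensional k M] [IsSimpleModule A M] :
    ∃ i, Nonempty (M ≃ₗ[A] S i) := by
  obtain ⟨i, ⟨e⟩⟩ := hS.exists_iso (ofModule k M) (IsSimpleModule.congr (ofModuleEquiv M).symm)
  exact ⟨i, ⟨(ofModuleEquiv M).trans e⟩⟩

/-- There are finitely many simple modules, for each is a subquotient of `A`. -/
theorem finite [FiniteDimensional k A] (hS : IsSimpleRepresentatives S) : Finite I := by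
  have : IsArtinian A A := isArtinian_of_tower k inferInstance
  have : IsNoetherian A A := isNoetherian_of_tower k inferInstance
  obtain ⟨s, h0, h1⟩ := exists_compositionSeries_of_isNoetherian_isArtinian A A
  have key : ∀ i, ∃ l : Fin s.length,
      Nonempty ((↥(s l.succ) ⧸ (s l.castSucc).comap (s l.succ).subtype) ≃ₗ[A] S i) := by
    intro i
    have := hS.simple i
    have := IsSimpleModule.nontrivial A (S i)
    obtain ⟨x, hx⟩ := exists_ne (0 : S i)
    set f := LinearMap.toSpanSingleton A (S i) x with hf
    -- Consider the least index at which the chain leaves the kernel of `f`. It is a successor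
    -- because the chain starts at `⊥`, and the factor ending there maps nontrivially to `S i`,
    -- hence isomorphically, both being simple.
    have hex : ∃ n, ∃ h : n < s.length + 1, ¬ s ⟨n, h⟩ ≤ LinearMap.ker f := by
      refine ⟨s.length, Nat.lt_succ_self _, fun h => hx ?_⟩
      have h2 : (1 : A) ∈ s.last := by rw [h1]; trivial
      simpa [hf] using h h2
    classical
    have hsp := Nat.find_spec hex
    have hmin := fun m => Nat.find_min hex (m := m)
    rcases hn : Nat.find hex with _ | n
    · rw [hn] at hsp
      obtain ⟨h, hs⟩ := hsp
      refine absurd ?_ hs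
      change s.head ≤ _
      rw [h0]
      exact bot_le
    rw [hn] at hsp
    obtain ⟨hlt, hs⟩ := hsp
    let l : Fin s.length := ⟨n, Nat.lt_of_succ_lt_succ hlt⟩
    have hle : s l.castSucc ≤ LinearMap.ker f := by
      by_contra h
      exact hmin n (by rw [hn]; exact Nat.lt_succ_self n) ⟨Nat.lt_succ_of_lt l.2, h⟩
    have hsimple : IsSimpleModule A (↥(s l.succ) ⧸ (s l.castSucc).comap (s l.succ).subtype) :=
      (covBy_iff_quot_is_simple (s.step l).le).1 (s.step l)
    refine ⟨l, ⟨LinearEquiv.ofBijective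
      (((s l.castSucc).comap (s l.succ).subtype).liftQ (f ∘ₗ (s l.succ).subtype)
        (fun y hy => hle hy)) (LinearMap.bijective_of_ne_zero fun h => hs fun y hy => ?_)⟩⟩
    exact LinearMap.congr_fun h (Submodule.Quotient.mk ⟨y, hy⟩)
  choose l hl using key
  refine Finite.of_injective l fun i j hij => hS.eq_of_iso i j ?_
  obtain ⟨e⟩ := hl i
  obtain ⟨e'⟩ := hl j
  rw [← hij] at e'
  exact ⟨e.symm.trans e'⟩

end IsSimpleRepresentatives

open Classical in
theorem _root_.Finset.sum_eq_sum_card_filter_smul {R G L J : Type*} [Semiring R] [AddCommMonoid G]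
    [Module R G] [Fintype L] [Fintype J] {f : L → G} {p : L → J → Prop} {g : J → G}
    (h : ∀ l, f l = ∑ j, if p l j then g j else 0) :
    ∑ l, f l = ∑ j, ((Finset.univ.filter fun l => p l j).card : R) • g j := by
  simp only [h]
  rw [Finset.sum_comm]
  refine Finset.sum_congr rfl fun j _ => ?_
  rw [← Finset.sum_filter, Finset.sum_const, Nat.cast_smul_eq_nsmul]

theorem _root_.Fin.eq_sum_of_succ_eq_add {G : Type*} [AddCommMonoid G] {n : ℕ}
    {f : Fin (n + 1) → G} {d : Fin n → G} (h0 : f 0 = 0)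
    (h : ∀ l, f l.succ = f l.castSucc + d l) : f (Fin.last n) = ∑ l, d l := by
  induction n with
  | zero => simpa using h0
  | succ n ih =>
    rw [Fin.sum_univ_castSucc, ← Fin.succ_last, h]
    congr 1
    exact ih (f := fun l => f l.castSucc) (d := fun l => d l.castSucc) h0 fun l => h l.castSucc

open Classical in
theorem IsSimpleRepresentatives.actTrace_eq_sum_ite [Fintype I] (hS : IsSimpleRepresentatives S)
    (M : Type u) [AddCommGroup M] [Module k M] [Module A M] [IsScalarTower k A M]
    [FiniteDimensional k M] [IsSimpleModule A M] :
    (actTrace k M : A →ₗ[k] k) =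
      ∑ j, if Nonempty (M ≃ₗ[A] S j) then (actTrace k (S j) : A →ₗ[k] k) else 0 := by
  obtain ⟨i, ⟨e⟩⟩ := hS.exists_equiv M
  rw [Finset.sum_eq_single i, if_pos ⟨e⟩, actTrace_congr e]
  · rintro j - hj
    rw [if_neg]
    rintro ⟨e'⟩
    exact hj (hS.eq_of_iso j i ⟨e'.symm.trans e⟩)
  · simp

open Classical in
theorem IsSimpleRepresentatives.actTrace_quotient_eq_sum_ite [Fintype I]
    (hS : IsSimpleRepresentatives S) {M : Type u} [AddCommGroup M] [Module k M] [Module A M]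
    [IsScalarTower k A M] [FiniteDimensional k M] {N N' : Submodule A M} (h : N ⋖ N') :
    (actTrace k (↥N' ⧸ N.comap N'.subtype) : A →ₗ[k] k) =
      ∑ j, if Nonempty ((↥N' ⧸ N.comap N'.subtype) ≃ₗ[A] S j) then
        (actTrace k (S j) : A →ₗ[k] k) else 0 := by
  have : FiniteDimensional k N' := finiteDimensional_submodule N'
  have : FiniteDimensional k (↥N' ⧸ N.comap N'.subtype) := finiteDimensional_quotient _
  have : IsSimpleModule A (↥N' ⧸ N.comap N'.subtype) := (covBy_iff_quot_is_simple h.le).1 h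
  exact hS.actTrace_eq_sum_ite _

theorem actTrace_eq_sum_compositionSeries {M : Type u} [AddCommGroup M] [Module k M] [Module A M]
    [IsScalarTower k A M] [FiniteDimensional k M] (s : CompositionSeries (Submodule A M))
    (h0 : s.head = ⊥) (h1 : s.last = ⊤) :
    (actTrace k M : A →ₗ[k] k) = ∑ l : Fin s.length,
      actTrace k (↥(s l.succ) ⧸ (s l.castSucc).comap (s l.succ).subtype) := by
  have hfd : ∀ N : Submodule A M, FiniteDimensional k N := finiteDimensional_submodule
  have hbot : ∀ N : Submodule A M, N = ⊥ → (actTrace k N : A →ₗ[k] k) = 0 := by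
    rintro N rfl
    ext a
    rw [actTrace_apply, Subsingleton.elim (Algebra.lsmul k k (⊥ : Submodule A M) a) 0]
    simp
  have htop : ∀ N : Submodule A M, N = ⊤ → (actTrace k M : A →ₗ[k] k) = actTrace k N := by
    rintro N rfl
    exact actTrace_congr Submodule.topEquiv.symm
  rw [htop s.last h1]
  refine Fin.eq_sum_of_succ_eq_add (f := fun l => (actTrace k (s l) : A →ₗ[k] k))
    (hbot s.head h0) fun l => ?_
  rw [actTrace_submodule_quotient (k := k) ((s l.castSucc).comap (s l.succ).subtype),
    actTrace_congr (k := k) (Submodule.comapSubtypeEquivOfLe (s.step l).le)]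

open Classical in
theorem actTrace_eq_sum_card [Fintype I] (hS : IsSimpleRepresentatives S)
    {M : Type u} [AddCommGroup M] [Module k M] [Module A M]
    [IsScalarTower k A M] [FiniteDimensional k M] (s : CompositionSeries (Submodule A M))
    (h0 : s.head = ⊥) (h1 : s.last = ⊤) :
    (actTrace k M : A →ₗ[k] k) = ∑ j, ((Finset.univ.filter fun l : Fin s.length =>
      Nonempty ((↥(s l.succ) ⧸ (s l.castSucc).comap (s l.succ).subtype) ≃ₗ[A] S j)).card : k) •
        actTrace k (S j) := by
  refine (actTrace_eq_sum_compositionSeries s h0 h1).trans ?_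
  exact Finset.sum_eq_sum_card_filter_smul (R := k)
    (f := fun l : Fin s.length => (actTrace k
      (↥(s l.succ) ⧸ (s l.castSucc).comap (s l.succ).subtype) : A →ₗ[k] k))
    (p := fun l j => Nonempty
      ((↥(s l.succ) ⧸ (s l.castSucc).comap (s l.succ).subtype) ≃ₗ[A] S j))
    (g := fun j => actTrace k (S j)) fun l => hS.actTrace_quotient_eq_sum_ite (s.step l)

/-- The trace on `V` is the sum of the traces on its composition factors. -/
theorem actTrace_eq_sum_multiplicity [Fintype I] (hS : IsSimpleRepresentatives S)
    (V : FDMod k A) :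
    (actTrace k V : A →ₗ[k] k) = ∑ j, (V.multiplicity (S j) : k) • actTrace k (S j) := by
  have hex : ∃ s : CompositionSeries (Submodule A V), s.head = ⊥ ∧ s.last = ⊤ := by
    have : IsArtinian A V := isArtinian_of_tower k inferInstance
    have : IsNoetherian A V := isNoetherian_of_tower k inferInstance
    exact exists_compositionSeries_of_isNoetherian_isArtinian A V
  -- The trace formula holds for every composition series, in particular for the one chosen in
  -- `multiplicity`; Jordan–Hölder uniqueness plays no role.
  rw [actTrace_eq_sum_card hS hex.choose hex.choose_spec.1 hex.choose_spec.2]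
  refine Finset.sum_congr rfl fun j _ => ?_
  rw [multiplicity, dif_pos hex]

variable [IsAlgClosed k]

/-- Schur's lemma: `g` has an eigenvalue c over an algebraically closed field, and g - c is then a
module map with nonzero kernel, hence zero. -/
theorem exists_eq_smul_of_isSimpleModule {M : Type*} [AddCommGroup M] [Module k M] [Module A M]
    [IsScalarTower k A M] [FiniteDimensional k M] [IsSimpleModule A M] (g : M →ₗ[A] M) :
    ∃ c : k, ∀ x, g x = c • x := by
  have := IsSimpleModule.nontrivial A M
  obtain ⟨c, hc⟩ := Module.End.exists_eigenvalue (g.restrictScalars k : Module.End k M)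
  obtain ⟨x, hx⟩ := hc.exists_hasEigenvector
  refine ⟨c, fun y => ?_⟩
  have h := (LinearMap.bijective_or_eq_zero (g - c • LinearMap.id)).resolve_left fun h =>
    hx.2 (h.1 (by
      rw [map_zero, LinearMap.sub_apply, LinearMap.smul_apply, LinearMap.id_apply, sub_eq_zero]
      exact hx.apply_eq_smul))
  have := LinearMap.congr_fun h y
  rwa [LinearMap.sub_apply, LinearMap.smul_apply, LinearMap.id_apply, LinearMap.zero_apply,
    sub_eq_zero] at this

/-- An eigenspace of `g` is a nonzero `A`-submodule, so it contains a simple submodule T on which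
`g` is a scalar. T contributes a multiple of one simple trace, and induction on the dimension treats
M/T. -/
theorem exists_trace_comp_eq_sum [Fintype I] (hS : IsSimpleRepresentatives S) (n : ℕ) :
    ∀ (M : Type u) [AddCommGroup M] [Module k M] [Module A M] [IsScalarTower k A M]
      [FiniteDimensional k M] (g : M →ₗ[A] M), Module.finrank k M = n →
      ∃ c : I → k, ∀ a : A,
        LinearMap.trace k M (Algebra.lsmul k k M a ∘ₗ g.restrictScalars k) =
          ∑ i, c i * actTrace k (S i) a := by
  induction n using Nat.strong_induction_on with
  | _ n ih =>
  intro M _ _ _ _ _ g hn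
  rcases subsingleton_or_nontrivial M with hM | hM
  · refine ⟨0, fun a => ?_⟩
    rw [Subsingleton.elim (Algebra.lsmul k k M a ∘ₗ g.restrictScalars k) 0]
    simp
  obtain ⟨c, hc⟩ := Module.End.exists_eigenvalue (g.restrictScalars k : Module.End k M)
  obtain ⟨x, hx⟩ := hc.exists_hasEigenvector
  have hart : IsArtinian A M := isArtinian_of_tower k inferInstance
  have hE : LinearMap.ker (g - c • LinearMap.id) ≠ ⊥ := fun h => hx.2 (by
    rw [← Submodule.mem_bot A, ← h, LinearMap.mem_ker, LinearMap.sub_apply, LinearMap.smul_apply,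
      LinearMap.id_apply, sub_eq_zero]
    exact hx.apply_eq_smul)
  obtain ⟨T, hT, hTE⟩ := (eq_bot_or_exists_atom_le _).resolve_left hE
  have hnt : Nontrivial T := Submodule.nontrivial_iff_ne_bot.2 hT.1
  have hTs : IsSimpleModule A T := isSimpleModule_iff_isAtom.2 hT
  have hgT : ∀ y ∈ T, g y = c • y := fun y hy => by
    have := hTE hy
    rwa [LinearMap.mem_ker, LinearMap.sub_apply, LinearMap.smul_apply, LinearMap.id_apply,
      sub_eq_zero] at this
  have hTg : T ≤ T.comap g := fun y hy => by
    rw [Submodule.mem_comap, hgT y hy]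
    exact (T.restrictScalars k).smul_mem c hy
  have hfT : FiniteDimensional k T := finiteDimensional_submodule T
  have hfQ : FiniteDimensional k (M ⧸ T) := finiteDimensional_quotient T
  have hlt : Module.finrank k (M ⧸ T) < n := by
    rw [← hn]
    have h1 := Submodule.finrank_quotient_add_finrank (T.restrictScalars k)
    have h2 : 0 < Module.finrank k (T.restrictScalars k) :=
      Module.finrank_pos_iff.2 (inferInstanceAs (Nontrivial T))
    change Module.finrank k (M ⧸ T) + _ = _ at h1
    omega
  obtain ⟨d, hd⟩ := ih _ hlt (M ⧸ T) (T.mapQ T g hTg) rfl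
  obtain ⟨i, ⟨e⟩⟩ := hS.exists_equiv T
  classical
  refine ⟨d + Pi.single i c, fun a => ?_⟩
  rw [trace_submodule_quotient T g hTg, hd]
  have h1 : Algebra.lsmul k k T a ∘ₗ (g.restrict hTg).restrictScalars k =
      c • Algebra.lsmul k k T a := by
    ext y
    have : g.restrict hTg y = c • y := Subtype.ext (hgT y y.2)
    simp [this, smul_comm a c]
  rw [h1, map_smul, ← actTrace_apply, actTrace_congr (k := k) e]
  simp [add_mul, Finset.sum_add_distrib, Pi.single_apply, add_comm]

/-- `dim Hom (P i, S j) = δ i j` for projective covers `P i` of the simple modules `S i`. -/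
theorem finrank_hom_projectiveCover [DecidableEq I] (hS : IsSimpleRepresentatives S)
    (hP : ∀ i, IsProjectiveCover (P i) (S i)) (i j : I) :
    Module.finrank k (P i →ₗ[A] S j) = if i = j then 1 else 0 := by
  obtain ⟨-, p, hp, hsup⟩ := hP i
  have hi := hS.simple i
  have hj := hS.simple j
  have hfactor : ∀ w : P i →ₗ[A] S j, ∃ g : S i →ₗ[A] S j, g ∘ₗ p = w := by
    intro w
    -- A nonzero map to a simple module has a maximal kernel. If it did not contain ker p, the two
    -- together would span `P i`, and superfluity of ker p would force w = 0.
    have hker : LinearMap.ker p ≤ LinearMap.ker w := by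
      rcases eq_or_ne w 0 with rfl | hw
      · simp
      have hco : IsCoatom (LinearMap.ker w) := by
        rw [← isSimpleModule_iff_isCoatom]
        exact IsSimpleModule.congr (w.quotKerEquivOfSurjective (LinearMap.surjective_of_ne_zero hw))
      rcases hco.le_iff.1 (le_sup_left : LinearMap.ker w ≤ LinearMap.ker w ⊔ LinearMap.ker p) with
        h | h
      · exact absurd (hsup _ h) hco.1
      · rw [← h]; exact le_sup_right
    refine ⟨(LinearMap.ker p).liftQ w hker ∘ₗ
      (p.quotKerEquivOfSurjective hp).symm.toLinearMap, ?_⟩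
    ext x
    have : (p.quotKerEquivOfSurjective hp).symm (p x) = Submodule.Quotient.mk x := by
      rw [LinearEquiv.symm_apply_eq]; rfl
    simp [this]
  split_ifs with hij
  · subst hij
    have hp0 : p ≠ 0 := by
      rintro rfl
      have := IsSimpleModule.nontrivial A (S i)
      obtain ⟨x, hx⟩ := exists_ne (0 : S i)
      obtain ⟨y, hy⟩ := hp x
      exact hx (by rw [← hy]; rfl)
    refine finrank_eq_one p hp0 fun w => ?_
    obtain ⟨g, rfl⟩ := hfactor w
    obtain ⟨c, hc⟩ := exists_eq_smul_of_isSimpleModule (k := k) g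
    exact ⟨c, LinearMap.ext fun x => (hc (p x)).symm⟩
  · have : Subsingleton (P i →ₗ[A] S j) := by
      refine ⟨fun w w' => ?_⟩
      have h0 : ∀ w : P i →ₗ[A] S j, w = 0 := by
        intro w
        obtain ⟨g, rfl⟩ := hfactor w
        rcases LinearMap.bijective_or_eq_zero g with h | h
        · exact absurd (hS.eq_of_iso i j ⟨LinearEquiv.ofBijective g h⟩) hij
        · rw [h, LinearMap.zero_comp]
      rw [h0 w, h0 w']
    exact Module.finrank_zero_of_subsingleton

end Simple

end FDMod

/-! ### Dual bases of projective modules: traces and dimensions of Hom spaces -/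

section DualBasis

variable {k A : Type*} [Field k] [Ring A] [Algebra k A]
  {P S : Type*} [AddCommGroup P] [Module k P] [Module A P] [IsScalarTower k A P]
  [FiniteDimensional k P] [AddCommGroup S] [Module k S] [Module A S] [IsScalarTower k A S]
  [FiniteDimensional k S] {ι : Type*} [Fintype ι] {x : ι → P} {f : ι → P →ₗ[A] A}

/-- `P` is a retract of a finite free module: the x s are the images of the standard basis, the f s
the coordinates of the section. -/
theorem exists_dualBasis_of_projective (k A P : Type*) [Field k] [Ring A] [Algebra k A]
    [AddCommGroup P] [Module k P] [Module A P] [IsScalarTower k A P]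
    [FiniteDimensional k P] [Module.Projective A P] :
    ∃ (n : ℕ) (x : Fin n → P) (f : Fin n → P →ₗ[A] A), ∀ p, ∑ s, f s p • x s = p := by
  have : Module.Finite A P := Module.Finite.of_restrictScalars_finite k A P
  obtain ⟨n, π, ι, -, -, h⟩ := Module.Finite.exists_comp_eq_id_of_projective A P
  refine ⟨n, fun s => π (Pi.single s 1), fun s => LinearMap.proj s ∘ₗ ι, fun p => ?_⟩
  have h1 := LinearMap.congr_fun h p
  rw [LinearMap.comp_apply, pi_eq_sum_univ' (ι p), map_sum] at h1
  simp only [map_smul, LinearMap.id_apply] at h1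
  exact h1

/-- The trace on a projective module, by means of a dual basis. -/
theorem actTrace_eq_sum_dualBasis [FiniteDimensional k A] (h : ∀ p, ∑ s, f s p • x s = p) (a : A) :
    actTrace k P a = ∑ s, LinearMap.trace k A
      (LinearMap.mulLeft k a ∘ₗ LinearMap.mulRight k (f s (x s))) := by
  -- Each summand passes through `A`: f s, then left multiplication by `a`, then b ↦ b • x s.
  -- Cyclicity moves the trace to `A`, where f s after b ↦ b • x s is right multiplication by f s (x
  -- s).
  have h1 : Algebra.lsmul k k P a = ∑ s,
      ((LinearMap.toSpanSingleton A P (x s)).restrictScalars k ∘ₗ LinearMap.mulLeft k a) ∘ₗ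
        (f s).restrictScalars k := by
    ext p
    rw [Algebra.lsmul_coe]
    conv_lhs => rw [← h p]
    simp [Finset.smul_sum, mul_smul]
  rw [actTrace_apply, h1, map_sum]
  refine Finset.sum_congr rfl fun s _ => ?_
  rw [LinearMap.trace_comp_comm', ← LinearMap.comp_assoc, LinearMap.trace_comp_comm']
  congr 1
  ext b
  simp

/-- The dimension of the space of maps out of a projective module, by means of a dual basis. -/
theorem finrank_hom_eq_sum_dualBasis (h : ∀ p, ∑ s, f s p • x s = p) :
    (Module.finrank k (P →ₗ[A] S) : k) = ∑ s, actTrace k S (f s (x s)) := by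
  have hinj : Function.Injective (LinearMap.restrictScalarsₗ k A P S k) :=
    LinearMap.restrictScalars_injective k
  have : FiniteDimensional k (P →ₗ[A] S) := Module.Finite.of_injective _ hinj
  let C : ι → (P →ₗ[A] S) →ₗ[k] S := fun s =>
    { toFun := fun φ => φ (x s)
      map_add' := fun _ _ => rfl
      map_smul' := fun _ _ => rfl }
  let B : ι → S →ₗ[k] (P →ₗ[A] S) := fun s =>
    { toFun := fun y => LinearMap.toSpanSingleton A S y ∘ₗ f s
      map_add' := fun y z => by ext; simp
      map_smul' := fun c y => by ext; simp [smul_comm c] }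
  -- The dual basis writes the identity of the Hom space as a sum of maps through `S`. Its trace is
  -- the dimension, as an element of `k`, and cyclicity evaluates each summand on `S`.
  have hid : (LinearMap.id : Module.End k (P →ₗ[A] S)) = ∑ s, B s ∘ₗ C s := by
    ext φ p
    conv_lhs => rw [← h p]
    simp [B, C]
  rw [← LinearMap.trace_id, hid, map_sum]
  refine Finset.sum_congr rfl fun s _ => ?_
  rw [LinearMap.trace_comp_comm']
  rfl

end DualBasis

/-! ### The trace of two-sided multiplication -/

namespace FDMod

variable {k A : Type u} [Field k] [Ring A] [Algebra k A] [FiniteDimensional k A]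
  {I : Type v} {S P : I → FDMod k A}

/-- The dual of `A` as a left `A`-module, `(a α) (x) = α (x a)`. -/
def rightDual (k A : Type u) [Field k] [Ring A] [Algebra k A] [FiniteDimensional k A] :
    FDMod k A where
  carrier := Module.Dual k A
  ρ := dualRight A

/-- Transposition preserves traces; it turns a two-sided multiplication on `A` into the action of b
on a left module composed with an operator depending on a alone. -/
theorem trace_dualRight_mul_dualLeft (a b : A) :
    LinearMap.trace k (Module.Dual k A) (dualRight A b * dualLeft A (op a)) =
      LinearMap.trace k A (LinearMap.mulLeft k a ∘ₗ LinearMap.mulRight k b) := by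
  exact LinearMap.trace_transpose' (LinearMap.mulLeft k a ∘ₗ LinearMap.mulRight k b)

variable [IsAlgClosed k]

/-- The trace of the two-sided multiplications of `A`, in terms of the simple modules `S i` and
their projective covers `P i`. -/
theorem trace_mulLeft_comp_mulRight [Fintype I] (hS : IsSimpleRepresentatives S)
    (hP : ∀ i, IsProjectiveCover (P i) (S i)) (a b : A) :
    LinearMap.trace k A (LinearMap.mulLeft k a ∘ₗ LinearMap.mulRight k b) =
      ∑ i, actTrace k (P i) a * actTrace k (S i) b := by
  classical
  -- Left multiplication by `a` commutes with right multiplications, so its transpose is a module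
  -- endomorphism. Hence, for fixed a, the trace is a combination of the simple traces in b with
  -- coefficients c still to be found.
  let g : rightDual k A →ₗ[A] rightDual k A :=
    { toFun := dualLeft A (op a)
      map_add' := map_add _
      map_smul' := fun c α => LinearMap.ext fun y => by
        change (show Module.Dual k A from α) (a * y * c) =
          (show Module.Dual k A from α) (a * (y * c))
        rw [mul_assoc] }
  obtain ⟨c, hc⟩ := exists_trace_comp_eq_sum hS _ (rightDual k A) g rfl
  have hc' : ∀ b, LinearMap.trace k A (LinearMap.mulLeft k a ∘ₗ LinearMap.mulRight k b) =
      ∑ i, c i * actTrace k (S i) b := by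
    intro b
    rw [← trace_dualRight_mul_dualLeft]
    exact hc b
  rw [hc']
  refine Finset.sum_congr rfl fun i _ => ?_
  have := (hP i).1
  obtain ⟨n, x, f, h⟩ := exists_dualBasis_of_projective k A (P i)
  congr 1
  -- The coefficient c i is detected on `P i`: summing over b = f s (x s) gives tr_{P i}(a) on the
  -- one hand and ∑ c j · dim Hom(P i, S j) = c i on the other.
  rw [actTrace_eq_sum_dualBasis h]
  simp only [hc']
  rw [Finset.sum_comm]
  simp only [← Finset.mul_sum, ← finrank_hom_eq_sum_dualBasis h,
    finrank_hom_projectiveCover hS hP]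
  simp

end FDMod

/-! ### Quasitriangular bialgebras -/

section Legs

variable (k A : Type*) [Field k] [Ring A] [Algebra k A]

/-- `x ⊗ y ↦ x ⊗ y ⊗ 1`, as an algebra homomorphism. -/
def algLeg12 : A ⊗[k] A →ₐ[k] A ⊗[k] (A ⊗[k] A) :=
  Algebra.TensorProduct.map (AlgHom.id k A) Algebra.TensorProduct.includeLeft

/-- `x ⊗ y ↦ x ⊗ 1 ⊗ y`, as an algebra homomorphism. -/
def algLeg13 : A ⊗[k] A →ₐ[k] A ⊗[k] (A ⊗[k] A) :=
  Algebra.TensorProduct.map (AlgHom.id k A) Algebra.TensorProduct.includeRight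

/-- `x ⊗ y ↦ 1 ⊗ x ⊗ y`, as an algebra homomorphism. -/
def algLeg23 : A ⊗[k] A →ₐ[k] A ⊗[k] (A ⊗[k] A) :=
  Algebra.TensorProduct.includeRight

/-- `x ⊗ y ⊗ z ↦ z ⊗ x ⊗ y`. -/
def legRotate : A ⊗[k] (A ⊗[k] A) ≃ₐ[k] A ⊗[k] (A ⊗[k] A) :=
  (Algebra.TensorProduct.assoc k k k A A A).symm.trans (Algebra.TensorProduct.comm k (A ⊗[k] A) A)

/-- `x ⊗ y ⊗ z ↦ y ⊗ x ⊗ z`. -/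
def legSwap : A ⊗[k] (A ⊗[k] A) ≃ₐ[k] A ⊗[k] (A ⊗[k] A) :=
  Algebra.TensorProduct.leftComm k A A A

variable {k A}

@[simp] theorem algLeg12_tmul (x y : A) : algLeg12 k A (x ⊗ₜ y) = x ⊗ₜ (y ⊗ₜ 1) := rfl
@[simp] theorem algLeg13_tmul (x y : A) : algLeg13 k A (x ⊗ₜ y) = x ⊗ₜ (1 ⊗ₜ y) := rfl
@[simp] theorem algLeg23_tmul (x y : A) : algLeg23 k A (x ⊗ₜ y) = 1 ⊗ₜ (x ⊗ₜ y) := rfl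
@[simp] theorem legRotate_tmul (x y z : A) :
    legRotate k A (x ⊗ₜ (y ⊗ₜ z)) = z ⊗ₜ (x ⊗ₜ y) := rfl
@[simp] theorem legSwap_tmul (x y z : A) :
    legSwap k A (x ⊗ₜ (y ⊗ₜ z)) = y ⊗ₜ (x ⊗ₜ z) := rfl

/-- `x ⊗ y ↦ y ⊗ x`. -/
local notation "τ" => Algebra.TensorProduct.comm k A A

theorem legRotate_leg13 (z : A ⊗[k] A) :
    legRotate k A (algLeg13 k A z) = algLeg12 k A (τ z) := by
  induction z with
  | zero => simp
  | add x y hx hy => simp only [map_add, hx, hy]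
  | tmul x y => simp

theorem legRotate_leg23 (z : A ⊗[k] A) :
    legRotate k A (algLeg23 k A z) = algLeg13 k A (τ z) := by
  induction z with
  | zero => simp
  | add x y hx hy => simp only [map_add, hx, hy]
  | tmul x y => simp

theorem legSwap_leg13 (z : A ⊗[k] A) : legSwap k A (algLeg13 k A z) = algLeg23 k A z := by
  induction z with
  | zero => simp
  | add x y hx hy => simp only [map_add, hx, hy]
  | tmul x y => simp

theorem legSwap_leg23 (z : A ⊗[k] A) : legSwap k A (algLeg23 k A z) = algLeg13 k A z := by
  induction z with
  | zero => simp
  | add x y hx hy => simp only [map_add, hx, hy]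
  | tmul x y => simp

end Legs

section Quasitriangular

variable {k A : Type*} [Field k] [Ring A] [Bialgebra k A]

local notation "τ" => Algebra.TensorProduct.comm k A A
local notation "Δ" => Coalgebra.comul (R := k) (A := A)
local notation "e12" => algLeg12 k A
local notation "e13" => algLeg13 k A
local notation "e23" => algLeg23 k A

/-- `x ⊗ y ↦ Δ(x) ⊗ y`. -/
def comulLeft : A ⊗[k] A →ₐ[k] A ⊗[k] (A ⊗[k] A) :=
  (Algebra.TensorProduct.assoc k k k A A A).toAlgHom.comp
    (Algebra.TensorProduct.map (Bialgebra.comulAlgHom k A) (AlgHom.id k A))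

/-- `x ⊗ y ↦ x ⊗ Δ(y)`. -/
def comulRight : A ⊗[k] A →ₐ[k] A ⊗[k] (A ⊗[k] A) :=
  Algebra.TensorProduct.map (AlgHom.id k A) (Bialgebra.comulAlgHom k A)

theorem comulLeft_tmul (x y : A) :
    comulLeft (x ⊗ₜ[k] y) = TensorProduct.assoc k A A A (Δ x ⊗ₜ y) := rfl

theorem comulRight_tmul (x y : A) : comulRight (x ⊗ₜ[k] y) = x ⊗ₜ Δ y := rfl

theorem legRotate_assoc (d : A ⊗[k] A) (y : A) :
    legRotate k A (TensorProduct.assoc k A A A (d ⊗ₜ y)) = y ⊗ₜ d :=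
  congrArg (Algebra.TensorProduct.comm k (A ⊗[k] A) A)
    ((TensorProduct.assoc k A A A).symm_apply_apply (d ⊗ₜ y))

theorem legRotate_comulLeft (z : A ⊗[k] A) :
    legRotate k A (comulLeft z) = comulRight (τ z) := by
  induction z with
  | zero => simp
  | add x y hx hy => simp only [map_add, hx, hy]
  | tmul x y => rw [comulLeft_tmul, legRotate_assoc]; rfl

/-- The axioms of an R-matrix. -/
structure IsRMatrix (R : A ⊗[k] A) : Prop where
  isUnit : IsUnit R
  mul_comul (a : A) : R * Δ a = τ (Δ a) * R
  comulLeft : comulLeft R = e13 R * e23 R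
  comulRight : comulRight R = e13 R * e12 R

namespace IsRMatrix

variable {R : A ⊗[k] A} (hR : IsRMatrix R)

include hR

theorem comul_mul_comm (a : A) : Δ a * τ R = τ R * τ (Δ a) := by
  have h := congrArg τ (hR.mul_comul a)
  rw [map_mul, map_mul] at h
  have h2 : τ (τ (Δ a)) = Δ a := TensorProduct.comm_comm _ _ _ _
  rw [h2] at h
  exact h.symm

/-- Passing through R replaces Δ by its opposite, and passing through R₂₁ restores it. -/
theorem monodromy_comul (a : A) : τ R * R * Δ a = Δ a * (τ R * R) := by
  rw [mul_assoc, hR.mul_comul, ← mul_assoc, ← hR.comul_mul_comm, mul_assoc]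

theorem comulRight_comm : CardyCartan.comulRight (τ R) = e12 (τ R) * e13 (τ R) := by
  rw [← legRotate_comulLeft, hR.comulLeft, map_mul, legRotate_leg13, legRotate_leg23]

theorem comulLeft_comm : CardyCartan.comulLeft (τ R) = e23 (τ R) * e13 (τ R) := by
  apply (legRotate k A).injective
  rw [legRotate_comulLeft, map_mul, legRotate_leg13, legRotate_leg23]
  have h2 : τ (τ R) = R := TensorProduct.comm_comm _ _ _ _
  rw [h2, hR.comulRight]

theorem comulLeft_mul_leg12 (z : A ⊗[k] A) :
    CardyCartan.comulLeft z * e12 (τ R) = e12 (τ R) * legSwap k A (CardyCartan.comulLeft z) := by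
  have key : ∀ (d w : A ⊗[k] A) (y : A),
      TensorProduct.assoc k A A A (d ⊗ₜ y) * e12 w = TensorProduct.assoc k A A A ((d * w) ⊗ₜ y) ∧
      e12 w * TensorProduct.assoc k A A A (d ⊗ₜ y) =
        TensorProduct.assoc k A A A ((w * d) ⊗ₜ y) := by
    intro d w y
    induction d with
    | zero => simp
    | add a b ha hb =>
      simp only [TensorProduct.add_tmul, map_add, add_mul, mul_add, ha, hb, and_self]
    | tmul a b =>
      induction w with
      | zero => simp
      | add c d hc hd =>
        simp only [TensorProduct.add_tmul, map_add, add_mul, mul_add, hc, hd, and_self]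
      | tmul c d => simp
  have key2 : ∀ (d : A ⊗[k] A) (y : A), legSwap k A (TensorProduct.assoc k A A A (d ⊗ₜ y)) =
      TensorProduct.assoc k A A A (τ d ⊗ₜ y) := by
    intro d y
    induction d with
    | zero => simp
    | add a b ha hb => simp only [TensorProduct.add_tmul, map_add, ha, hb]
    | tmul a b => simp
  induction z with
  | zero => simp
  | add x y hx hy => simp only [map_add, add_mul, mul_add, hx, hy]
  | tmul x y =>
    rw [comulLeft_tmul, (key _ _ _).1, key2, (key _ _ _).2, hR.comul_mul_comm]

theorem leg23_mul_comulRight (z : A ⊗[k] A) :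
    e23 (τ R * R) * CardyCartan.comulRight z = CardyCartan.comulRight z * e23 (τ R * R) := by
  induction z with
  | zero => simp
  | add x y hx hy => simp only [map_add, add_mul, mul_add, hx, hy]
  | tmul x y =>
    rw [comulRight_tmul]
    change (1 ⊗ₜ (τ R * R)) * _ = _ * (1 ⊗ₜ (τ R * R))
    rw [Algebra.TensorProduct.tmul_mul_tmul, Algebra.TensorProduct.tmul_mul_tmul,
      hR.monodromy_comul, one_mul, mul_one]

/-- Moving R₂₁ in legs 1 and 2 across Δ ⊗ id flips the coproduct. Then R₂₁ in legs 1, 2 times R₂₁ in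
legs 1, 3 appears, which is (id ⊗ Δ)(R₂₁), and the monodromy in legs 2, 3 commutes with it. -/
theorem comulLeft_monodromy_mul :
    CardyCartan.comulLeft (τ R * R) * e12 (τ R) = e23 (τ R * R) * e12 (τ R) * e13 (τ R * R) := by
  rw [hR.comulLeft_mul_leg12, map_mul CardyCartan.comulLeft, hR.comulLeft, hR.comulLeft_comm,
    map_mul (legSwap k A), map_mul (legSwap k A), map_mul (legSwap k A), legSwap_leg23,
    legSwap_leg13, legSwap_leg13, legSwap_leg23]
  calc e12 (τ R) * (e13 (τ R) * e23 (τ R) * (e23 R * e13 R))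
      = (e12 (τ R) * e13 (τ R)) * e23 (τ R * R) * e13 R := by rw [map_mul e23]; noncomm_ring
    _ = e23 (τ R * R) * (e12 (τ R) * e13 (τ R)) * e13 R := by
        rw [← hR.comulRight_comm, hR.leg23_mul_comulRight]
    _ = _ := by rw [map_mul e13]; noncomm_ring

/-- Applying ε to the first leg of (Δ ⊗ id)R = R₁₃ R₂₃ gives R = (1 ⊗ e) R with e = (ε ⊗ id)R, and R
is invertible. -/
theorem counit_left : TensorProduct.lid k A (LinearMap.rTensor A Coalgebra.counit R) = 1 := by
  let F : A ⊗[k] (A ⊗[k] A) →ₐ[k] A ⊗[k] A :=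
    (Algebra.TensorProduct.lid k (A ⊗[k] A)).toAlgHom.comp
      (Algebra.TensorProduct.map (Bialgebra.counitAlgHom k A) (AlgHom.id k (A ⊗[k] A)))
  let E : A ⊗[k] A →ₗ[k] A :=
    (TensorProduct.lid k A).toLinearMap ∘ₗ LinearMap.rTensor A Coalgebra.counit
  have h1 : ∀ (d : A ⊗[k] A) (y : A), F (TensorProduct.assoc k A A A (d ⊗ₜ y)) = E d ⊗ₜ y := by
    intro d y
    induction d with
    | zero => simp
    | add a b ha hb => simp only [TensorProduct.add_tmul, map_add, ha, hb]
    | tmul a b => simp [F, E, TensorProduct.smul_tmul']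
  have h2 : ∀ z, F (CardyCartan.comulLeft z) = z := by
    intro z
    induction z with
    | zero => simp
    | add a b ha hb => simp only [map_add, ha, hb]
    | tmul a b =>
      rw [comulLeft_tmul, h1]
      simp [E]
  have h3 : ∀ z, F (e13 z) = 1 ⊗ₜ E z := by
    intro z
    induction z with
    | zero => simp
    | add a b ha hb => simp only [map_add, TensorProduct.tmul_add, ha, hb]
    | tmul a b => simp [F, E]
  have h4 : ∀ z, F (e23 z) = z := by
    intro z
    change F (1 ⊗ₜ z) = z
    simp [F]
  have h := congrArg F hR.comulLeft
  rw [map_mul, h2, h3, h4] at h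
  have h5 : (1 : A) ⊗ₜ[k] E R = 1 := by
    apply hR.isUnit.mul_right_cancel
    rw [one_mul]
    exact h.symm
  have h6 := congrArg E h5
  simpa [E, Algebra.TensorProduct.one_def] using h6

theorem counit_right : TensorProduct.rid k A (LinearMap.lTensor A Coalgebra.counit R) = 1 := by
  let F : A ⊗[k] (A ⊗[k] A) →ₐ[k] A ⊗[k] A :=
    Algebra.TensorProduct.map (AlgHom.id k A) ((Algebra.TensorProduct.rid k k A).toAlgHom.comp
      (Algebra.TensorProduct.map (AlgHom.id k A) (Bialgebra.counitAlgHom k A)))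
  let E : A ⊗[k] A →ₗ[k] A :=
    (TensorProduct.rid k A).toLinearMap ∘ₗ LinearMap.lTensor A Coalgebra.counit
  have h1 : ∀ (d : A ⊗[k] A) (y : A), F (y ⊗ₜ d) = y ⊗ₜ E d := by
    intro d y
    induction d with
    | zero => simp
    | add a b ha hb => simp only [TensorProduct.tmul_add, map_add, ha, hb]
    | tmul a b => simp [F, E]
  have h2 : ∀ z, F (CardyCartan.comulRight z) = z := by
    intro z
    induction z with
    | zero => simp
    | add a b ha hb => simp only [map_add, ha, hb]
    | tmul a b =>
      rw [comulRight_tmul, h1]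
      simp [E]
  have h3 : ∀ z, F (e13 z) = E z ⊗ₜ 1 := by
    intro z
    induction z with
    | zero => simp
    | add a b ha hb => simp only [map_add, TensorProduct.add_tmul, ha, hb]
    | tmul a b => simp [F, E, TensorProduct.smul_tmul']
  have h4 : ∀ z, F (e12 z) = z := by
    intro z
    induction z with
    | zero => simp
    | add a b ha hb => simp only [map_add, ha, hb]
    | tmul a b => simp [F]
  have h := congrArg F hR.comulRight
  rw [map_mul, h2, h3, h4] at h
  have h5 : E R ⊗ₜ[k] (1 : A) = 1 := by
    apply hR.isUnit.mul_right_cancel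
    rw [one_mul]
    exact h.symm
  have h6 := congrArg E h5
  simpa [E, Algebra.TensorProduct.one_def] using h6

end IsRMatrix

end Quasitriangular

/-! ### Contracting legs of a tensor with linear forms -/

section Slices

variable {k A : Type*} [Field k] [Ring A] [Algebra k A]

/-- `x ⊗ y ↦ α(x) y`. -/
def sliceLeft (α : Module.Dual k A) : A ⊗[k] A →ₗ[k] A :=
  (TensorProduct.lid k A).toLinearMap ∘ₗ LinearMap.rTensor A α

@[simp] theorem sliceLeft_tmul (α : Module.Dual k A) (x y : A) :
    sliceLeft α (x ⊗ₜ y) = α x • y := by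
  simp [sliceLeft]

/-- `x ⊗ y ↦ α(x) β(y)`. -/
def pairing (α β : Module.Dual k A) : A ⊗[k] A →ₗ[k] k := β ∘ₗ sliceLeft α

@[simp] theorem pairing_tmul (α β : Module.Dual k A) (x y : A) :
    pairing α β (x ⊗ₜ y) = α x * β y := by
  simp [pairing]

theorem sliceLeft_mul_left (α : Module.Dual k A) (z : A ⊗[k] A) (a : A) :
    sliceLeft α ((1 ⊗ₜ a) * z) = a * sliceLeft α z := by
  induction z with
  | zero => simp
  | add x y hx hy => simp only [map_add, mul_add, hx, hy]
  | tmul x y => simp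

end Slices

/-! ### The action of the coend and its character -/

section

variable {k A : Type u} [Field k] [Ring A] [Bialgebra k A]

/-- The axioms of a quasitriangular Hopf algebra with a pivotal element, for the data of a
`CatData`. -/
structure CatData.IsQuasitriangular (D : CatData k A) : Prop where
  isRMatrix : IsRMatrix D.R
  antipode_left (a : A) : LinearMap.mul' k A (LinearMap.rTensor A
    ((opLinearEquiv k).symm.toLinearMap ∘ₗ D.S.toLinearMap) (Coalgebra.comul (R := k) a)) =
      algebraMap k A (Coalgebra.counit (R := k) a)
  antipode_right (a : A) : LinearMap.mul' k A (LinearMap.lTensor A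
    ((opLinearEquiv k).symm.toLinearMap ∘ₗ D.S.toLinearMap) (Coalgebra.comul (R := k) a)) =
      algebraMap k A (Coalgebra.counit (R := k) a)
  antipode_sq (a : A) : (D.S (D.S a).unop).unop * D.t = D.t * a

/-- The monodromy matrix `R₂₁ R`. -/
def CatData.monodromy (D : CatData k A) : A ⊗[k] A :=
  Algebra.TensorProduct.comm k A A D.R * D.R

namespace FDMod

variable (D : CatData k A)

local notation "τ" => Algebra.TensorProduct.comm k A A
local notation "Δ" => Coalgebra.comul (R := k) (A := A)
local notation "e12" => algLeg12 k A
local notation "e13" => algLeg13 k A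
local notation "e23" => algLeg23 k A

theorem tensorAct_tmul (V W : FDMod k A) (a b : A) (x : V) (y : W) :
    tensorAct V W (a ⊗ₜ b) (x ⊗ₜ y) = V.ρ a x ⊗ₜ W.ρ b y := rfl

theorem braiding_braiding (V W : FDMod k A) (z : V ⊗[k] W) :
    braiding D W V (braiding D V W z) = tensorAct V W D.monodromy z := by
  have h : ∀ (d : A ⊗[k] A) (w : V ⊗[k] W),
      TensorProduct.comm k W V (tensorAct W V d (TensorProduct.comm k V W w)) =
        tensorAct V W (τ d) w := by
    intro d w
    induction d with
    | zero => simp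
    | add a b ha hb => simp only [map_add, LinearMap.add_apply, ha, hb]
    | tmul a b =>
      induction w with
      | zero => simp
      | add x y hx hy => simp only [map_add, hx, hy]
      | tmul x y => rfl
  refine (h _ _).trans ?_
  rw [CatData.monodromy, map_mul]
  rfl

variable [FiniteDimensional k A]

/-- An element of the coend, as a linear form. -/
def coendToDual : coend D ≃ₗ[k] Module.Dual k A := LinearEquiv.refl k (Module.Dual k A)

theorem _root_.CardyCartan.lid_rTensor_contractLeft {U V : Type*} [AddCommGroup U] [Module k U]
    [AddCommGroup V] [Module k V] (f : Module.Dual k U) (w : U ⊗[k] V) :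
    TensorProduct.lid k V (LinearMap.rTensor V (contractLeft k U)
      ((TensorProduct.assoc k (Module.Dual k U) U V).symm (f ⊗ₜ w))) =
      TensorProduct.lid k V (LinearMap.rTensor V f w) := by
  induction w with
  | zero => simp
  | add x y hx hy => simp only [map_add, TensorProduct.tmul_add, hx, hy]
  | tmul x y => simp

/-- Here `e` is the unit of `A` seen in the regular module; `hαβ` and `he` record the identification
of `regular k A` with `A`. -/
theorem lid_rTensor_tensorAct (V : FDMod k A) (α : Module.Dual k (regular k A))
    (β : Module.Dual k A) (hαβ : ∀ a : A, α (show regular k A from a) = β a)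
    (e : regular k A) (he : ∀ a : A, (regular k A).ρ a e = (show regular k A from a)) (y : V)
    (z : A ⊗[k] A) :
    TensorProduct.lid k V (LinearMap.rTensor V α (tensorAct (regular k A) V z (e ⊗ₜ y))) =
      V.ρ (sliceLeft β z) y := by
  induction z with
  | zero => simp only [map_zero, LinearMap.zero_apply]
  | add a b ha hb => simp only [map_add, LinearMap.add_apply, ha, hb]
  | tmul a b =>
    rw [tensorAct_tmul, he, sliceLeft_tmul, map_smul, LinearMap.smul_apply, LinearMap.rTensor_tmul,
      TensorProduct.lid_tmul, hαβ]

/-- Every form is ι_A (α ⊗ 1), so the double braiding with the regular module, evaluated at 1, is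
the monodromy matrix with its first leg fed to α. -/
theorem coendAct_tmul (V : FDMod k A) (α : coend D) (y : V) :
    coendAct D V (α ⊗ₜ y) = V.ρ (sliceLeft (coendToDual D α) D.monodromy) y := by
  rw [← lid_rTensor_tensorAct V (show Module.Dual k (regular k A) from α) (coendToDual D α)
    (fun _ => rfl) (show regular k A from (1 : A)) (fun a => mul_one a), ← braiding_braiding,
    ← lid_rTensor_contractLeft]
  have h : ∀ w : ((regular k A).dual D ⊗[k] regular k A) ⊗[k] V,
      LinearMap.rTensor V (coendCounit D) (LinearMap.rTensor V (coendι D (regular k A)) w) =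
        LinearMap.rTensor V (ev D (regular k A)) w := by
    intro w
    rw [← LinearMap.comp_apply, ← LinearMap.rTensor_comp, coendCounit_comp_coendι]
  exact congrArg (TensorProduct.lid k V) (h _)

/-- Expanding the coevaluation in a basis turns the contraction into the sum of diagonal matrix
entries. -/
theorem _root_.CardyCartan.contractRight_map_coevaluation {B V : Type u} [AddCommGroup B]
    [Module k B] [AddCommGroup V] [Module k V] [FiniteDimensional k V] (f : B ⊗[k] V →ₗ[k] V)
    (g : Module.End k V) (α : B) :
    contractRight k V (TensorProduct.map f (Module.Dual.transpose (R := k) g)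
      ((TensorProduct.assoc k B V (Module.Dual k V)).symm (α ⊗ₜ coevaluation k V 1))) =
      LinearMap.trace k V (g ∘ₗ f ∘ₗ TensorProduct.mk k B V α) := by
  classical
  rw [coevaluation_apply_one, LinearMap.trace_eq_matrix_trace k (Module.Basis.ofVectorSpace k V),
    Matrix.trace]
  simp only [TensorProduct.tmul_sum, map_sum]
  refine Finset.sum_congr rfl fun i _ => ?_
  rw [Matrix.diag_apply, LinearMap.toMatrix_apply]
  rfl

theorem character_coendAct (V : FDMod k A) (α : coend D) :
    character D V (coendAct D V) α =
      actTrace k V (D.t * sliceLeft (coendToDual D α) D.monodromy) := by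
  refine (contractRight_map_coevaluation (coendAct D V) (V.ρ D.t) α).trans ?_
  rw [actTrace_eq, map_mul]
  congr 1
  ext y
  exact congrArg (V.ρ D.t) (coendAct_tmul D V α y)

/-- The antipode of `D`, as a linear map. -/
abbrev _root_.CardyCartan.CatData.antipode {k A : Type u} [Field k] [Ring A] [Algebra k A]
    (D : CatData k A) : A →ₗ[k] A :=
  (opLinearEquiv k).symm.toLinearMap ∘ₗ D.S.toLinearMap

omit [FiniteDimensional k A] in
theorem _root_.CardyCartan.CatData.antipode_mul (D : CatData k A) (a b : A) :
    D.antipode (a * b) = D.antipode b * D.antipode a := by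
  simp

/-- `b ⊗ c ⊗ d ↦ (S(b) ⊗ 1) (M (c ⊗ d))`. -/
def antipodeMulLeft : A ⊗[k] (A ⊗[k] A) →ₗ[k] A ⊗[k] A :=
  TensorProduct.lift
    ((LinearMap.mul k (A ⊗[k] A)) ∘ₗ
      (TensorProduct.mk k A A).flip 1 ∘ₗ D.antipode)

omit [FiniteDimensional k A] in
theorem antipodeMulLeft_tmul (a : A) (z : A ⊗[k] A) :
    antipodeMulLeft D (a ⊗ₜ z) = (D.antipode a ⊗ₜ 1) * z := rfl

variable {D} (hD : D.IsQuasitriangular)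

omit [FiniteDimensional k A] in
include hD in
-- In Sweedler notation: S(a₁)a₂ ⊗ a₃ = 1 ⊗ a, by coassociativity and the antipode axiom.
theorem antipodeMulLeft_comul (a : A) :
    antipodeMulLeft D (LinearMap.lTensor A Δ (Δ a)) = 1 ⊗ₜ a := by
  have h : ∀ (d : A ⊗[k] A) (c : A), antipodeMulLeft D (TensorProduct.assoc k A A A (d ⊗ₜ c)) =
      LinearMap.mul' k A (LinearMap.rTensor A D.antipode d) ⊗ₜ c := by
    intro d c
    induction d with
    | zero => simp
    | add x y hx hy => simp only [TensorProduct.add_tmul, map_add, hx, hy]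
    | tmul x y => simp [antipodeMulLeft_tmul]
  have h2 : ∀ d : A ⊗[k] A, antipodeMulLeft D (TensorProduct.assoc k A A A
      (LinearMap.rTensor A Δ d)) =
      1 ⊗ₜ (TensorProduct.lid k A (LinearMap.rTensor A Coalgebra.counit d)) := by
    intro d
    induction d with
    | zero => simp
    | add x y hx hy => simp only [TensorProduct.tmul_add, map_add, hx, hy]
    | tmul x y =>
      rw [LinearMap.rTensor_tmul, h, hD.antipode_left, Algebra.algebraMap_eq_smul_one]
      simp [TensorProduct.smul_tmul]
  rw [← Coalgebra.coassoc_apply, h2]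
  simp

/-- `b ⊗ c ↦ (b α ⊗ id)(M) c`, for the coadjoint action on `α`. -/
def coadjointSlice (D : CatData k A) (α : Module.Dual k A) : A ⊗[k] A →ₗ[k] A :=
  TensorProduct.lift (LinearMap.mk₂ k
    (fun b c => sliceLeft (coadjointAct D (Δ b) α) D.monodromy * c)
    (fun _ _ _ => by simp [sliceLeft, LinearMap.rTensor_add, add_mul])
    (fun _ _ _ => by simp [sliceLeft, LinearMap.rTensor_smul])
    (fun _ _ _ => by simp [mul_add]) (fun _ _ _ => by simp))

omit [FiniteDimensional k A] in
theorem coadjointSlice_tmul (α : Module.Dual k A) (b c : A) :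
    coadjointSlice D α (b ⊗ₜ c) = sliceLeft (coadjointAct D (Δ b) α) D.monodromy * c := rfl

omit [FiniteDimensional k A] in
include hD in
-- The left side is (α ⊗ id) of (S(a₁) ⊗ 1) M (a₂ ⊗ a₃). The monodromy commutes with coproducts, so
-- a₂ ⊗ a₃ moves to the left of M, where S(a₁)a₂ ⊗ a₃ collapses to 1 ⊗ a. This is what makes the
-- action of the coend `A`-linear.
theorem coadjointSlice_comul (α : Module.Dual k A) (a : A) :
    coadjointSlice D α (Δ a) = a * sliceLeft α D.monodromy := by
  have h : ∀ (w z : A ⊗[k] A) (c : A), sliceLeft (coadjointAct D w α) z * c =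
      sliceLeft α (antipodeMulLeft D (LinearMap.lTensor A (LinearMap.mulLeft k z)
        (TensorProduct.assoc k A A A (w ⊗ₜ c)))) := by
    intro w z c
    induction w with
    | zero => simp [sliceLeft]
    | add x y hx hy =>
      simp only [TensorProduct.add_tmul, map_add, ← hx, ← hy]
      simp [sliceLeft, LinearMap.rTensor_add, add_mul]
    | tmul a b =>
      rw [TensorProduct.assoc_tmul, LinearMap.lTensor_tmul, antipodeMulLeft_tmul,
        LinearMap.mulLeft_apply]
      induction z with
      | zero => simp
      | add x y hx hy => simp only [map_add, add_mul, mul_add, hx, hy]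
      | tmul x y => simp [coadjointAct_tmul, mul_assoc]
  have h2 : ∀ d : A ⊗[k] A, coadjointSlice D α d =
      sliceLeft α (antipodeMulLeft D (LinearMap.lTensor A (LinearMap.mulLeft k D.monodromy)
        (TensorProduct.assoc k A A A (LinearMap.rTensor A Δ d)))) := by
    intro d
    induction d with
    | zero => simp
    | add x y hx hy => simp only [map_add, hx, hy]
    | tmul x y => rw [coadjointSlice_tmul, h, LinearMap.rTensor_tmul]
  have h3 : ∀ d : A ⊗[k] A, antipodeMulLeft D (LinearMap.lTensor A
      (LinearMap.mulLeft k D.monodromy) (LinearMap.lTensor A Δ d)) =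
        antipodeMulLeft D (LinearMap.lTensor A Δ d) * D.monodromy := by
    intro d
    induction d with
    | zero => simp
    | add x y hx hy => simp only [map_add, hx, hy, add_mul]
    | tmul x y =>
      rw [LinearMap.lTensor_tmul, LinearMap.lTensor_tmul, antipodeMulLeft_tmul,
        antipodeMulLeft_tmul, mul_assoc, LinearMap.mulLeft_apply, CatData.monodromy,
        hD.isRMatrix.monodromy_comul]
  rw [h2, Coalgebra.coassoc_apply, h3, antipodeMulLeft_comul hD, sliceLeft_mul_left]

include hD in
theorem coendAct_isHom (V : FDMod k A) :
    IsHom (V := (coend D).tensor V) (coendAct D V) := by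
  intro a z
  have h : ∀ (α : coend D) (y : V) (d : A ⊗[k] A),
      coendAct D V (tensorAct (coend D) V d (α ⊗ₜ y)) =
        V.ρ (coadjointSlice D (coendToDual D α) d) y := by
    intro α y d
    induction d with
    | zero => simp
    | add x y hx hy => simp only [map_add, LinearMap.add_apply, hx, hy]
    | tmul b c =>
      rw [tensorAct_tmul, coendAct_tmul, coadjointSlice_tmul, map_mul]
      rfl
  have h2 : ∀ z : coend D ⊗[k] V, coendAct D V (tensorAct (coend D) V (Δ a) z) =
      V.ρ a (coendAct D V z) := by
    intro z
    induction z with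
    | zero => simp
    | add x y hx hy => simp only [map_add, hx, hy]
    | tmul α y =>
      rw [h, coadjointSlice_comul hD, coendAct_tmul, map_mul]
      rfl
  exact h2 z

omit [FiniteDimensional k A] in
include hD in
-- This is `coadjointSlice_comul` solved for the slice: multiply on the right by S of one more leg
-- of the coproduct and cancel by a₂S(a₃) = ε(a₂).
theorem sliceLeft_coend_action (α : Module.Dual k A) (a : A) :
    sliceLeft (coadjointAct D (Δ a) α) D.monodromy =
      LinearMap.mul' k A (TensorProduct.map (LinearMap.mulRight k (sliceLeft α D.monodromy))
        D.antipode (Δ a)) := by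
  let G : A ⊗[k] (A ⊗[k] A) →ₗ[k] A :=
    LinearMap.mul' k A ∘ₗ TensorProduct.map (coadjointSlice D α) D.antipode ∘ₗ
      (TensorProduct.assoc k A A A).symm.toLinearMap
  have h1 : ∀ d : A ⊗[k] A, G (TensorProduct.assoc k A A A (LinearMap.rTensor A Δ d)) =
      LinearMap.mul' k A (TensorProduct.map (LinearMap.mulRight k (sliceLeft α D.monodromy))
        D.antipode d) := by
    intro d
    induction d with
    | zero => simp
    | add x y hx hy => simp only [map_add, hx, hy]
    | tmul x y =>
      simp only [G, LinearMap.comp_apply, LinearMap.rTensor_tmul, LinearEquiv.coe_coe,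
        LinearEquiv.symm_apply_apply, TensorProduct.map_tmul, coadjointSlice_comul hD,
        LinearMap.mul'_apply, LinearMap.mulRight_apply]
  have h2 : ∀ (b : A) (d : A ⊗[k] A), G (b ⊗ₜ d) =
      sliceLeft (coadjointAct D (Δ b) α) D.monodromy *
        LinearMap.mul' k A (LinearMap.lTensor A D.antipode d) := by
    intro b d
    induction d with
    | zero => simp
    | add x y hx hy => simp only [map_add, TensorProduct.tmul_add, mul_add, hx, hy]
    | tmul x y => simp [G, coadjointSlice_tmul, mul_assoc]
  have h3 : ∀ d : A ⊗[k] A, G (LinearMap.lTensor A Δ d) =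
      sliceLeft (coadjointAct D (Δ (TensorProduct.rid k A
        (LinearMap.lTensor A Coalgebra.counit d))) α) D.monodromy := by
    intro d
    induction d with
    | zero => simp [sliceLeft]
    | add x y hx hy =>
      simp only [map_add, hx, hy]
      simp [sliceLeft, LinearMap.rTensor_add]
    | tmul x y =>
      rw [LinearMap.lTensor_tmul, h2, hD.antipode_right, Algebra.algebraMap_eq_smul_one]
      simp [sliceLeft, LinearMap.rTensor_smul]
  rw [← h1, Coalgebra.coassoc_apply, h3]
  simp

include hD in
-- With E the slice of α, cyclicity gives tr(t a₁ E S(a₂)) = tr(S(a₂) t a₁ E). Since t a₁ = S²(a₁)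
-- t, the prefix becomes S(S(a₁)a₂), which sums to ε(a).
theorem character_isHom (V : FDMod k A) :
    IsHom (V := coend D) (W := unit k A) (character D V (coendAct D V)) := by
  intro a α
  change character D V (coendAct D V) _ =
    Coalgebra.counit (R := k) a * character D V (coendAct D V) α
  rw [character_coendAct, character_coendAct]
  have h : sliceLeft (coendToDual D ((coend D).ρ a α)) D.monodromy = _ :=
    sliceLeft_coend_action hD (coendToDual D α) a
  rw [h]
  set E := sliceLeft (coendToDual D α) D.monodromy
  have h2 : ∀ d : A ⊗[k] A, actTrace k V (D.t * LinearMap.mul' k A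
      (TensorProduct.map (LinearMap.mulRight k E) D.antipode d)) =
      actTrace k V (D.antipode (LinearMap.mul' k A (LinearMap.rTensor A D.antipode d)) *
        (D.t * E)) := by
    intro d
    induction d with
    | zero => simp
    | add x y hx hy => simp only [map_add, mul_add, add_mul, hx, hy]
    | tmul x y =>
      simp only [TensorProduct.map_tmul, LinearMap.mul'_apply, LinearMap.rTensor_tmul,
        LinearMap.mulRight_apply, CatData.antipode_mul]
      have h3 : D.antipode (D.antipode x) * D.t = D.t * x := hD.antipode_sq x
      rw [← mul_assoc, actTrace_mul_comm, ← mul_assoc D.t x, ← h3]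
      simp only [mul_assoc]
  rw [h2, hD.antipode_left]
  simp [Algebra.algebraMap_eq_smul_one]

end FDMod

end

/-! ### Multiplicativity of the action of the coend -/

section

variable {k A : Type u} [Field k] [Ring A] [Bialgebra k A]

namespace FDMod

variable (D : CatData k A)

local notation "τ" => Algebra.TensorProduct.comm k A A
local notation "Δ" => Coalgebra.comul (R := k) (A := A)
local notation "e12" => algLeg12 k A
local notation "e13" => algLeg13 k A
local notation "e23" => algLeg23 k A

/-- `r ⊗ w ⊗ w' ↦ φ(S(w) ⊗ 1) d φ(w' ⊗ r)`. -/
def sandwich {B : Type*} [Ring B] [Algebra k B] (φ : A ⊗[k] A →ₐ[k] B) (d : B) :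
    A ⊗[k] (A ⊗[k] A) →ₗ[k] B :=
  TensorProduct.lift ((LinearMap.mul k B).compl₁₂
    (LinearMap.mulRight k d ∘ₗ φ.toLinearMap ∘ₗ (TensorProduct.mk k A A).flip 1 ∘ₗ D.antipode)
    (φ.toLinearMap ∘ₗ (TensorProduct.comm k A A).toLinearMap)) ∘ₗ
    (TensorProduct.leftComm k A A A).toLinearMap

variable {D}

@[simp] theorem sandwich_tmul {B : Type*} [Ring B] [Algebra k B] (φ : A ⊗[k] A →ₐ[k] B) (d : B)
    (r w w' : A) :
    sandwich D φ d (r ⊗ₜ (w ⊗ₜ w')) = φ (D.antipode w ⊗ₜ 1) * d * φ (w' ⊗ₜ r) := rfl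

theorem sandwich_add {B : Type*} [Ring B] [Algebra k B] (φ : A ⊗[k] A →ₐ[k] B) (d d' : B)
    (z : A ⊗[k] (A ⊗[k] A)) :
    sandwich D φ (d + d') z = sandwich D φ d z + sandwich D φ d' z := by
  induction z with
  | zero => simp
  | add x y hx hy => simp only [map_add, hx, hy]; abel
  | tmul x y =>
    induction y with
    | zero => simp
    | add y z hy hz => simp only [TensorProduct.tmul_add, map_add, hy, hz]; abel
    | tmul y z => simp only [sandwich_tmul, mul_add, add_mul]

theorem sandwich_zero {B : Type*} [Ring B] [Algebra k B] (φ : A ⊗[k] A →ₐ[k] B)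
    (z : A ⊗[k] (A ⊗[k] A)) : sandwich D φ 0 z = 0 := by
  have := sandwich_add (D := D) φ 0 0 z
  simpa using this

/-- A factor in legs 1 and 3 enters only the right-hand slot `w' ⊗ r`, so it can be absorbed into
`d`. -/
theorem sandwich_leg13_mul_leg12 (d : A ⊗[k] (A ⊗[k] A)) (z z' : A ⊗[k] A) :
    sandwich D e12 d (e13 z * e12 z') = sandwich D e12 (d * e12 (τ z)) (e12 z') := by
  induction z with
  | zero => simp [sandwich_zero]
  | add x y hx hy => simp only [map_add, add_mul, mul_add, sandwich_add, hx, hy]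
  | tmul r r' =>
    induction z' with
    | zero => simp
    | add x y hx hy => simp only [map_add, mul_add, hx, hy]
    | tmul s s' =>
      have h : (r' : A) ⊗ₜ[k] (r * s) = (r' ⊗ₜ r) * (1 ⊗ₜ s) := by simp
      rw [algLeg13_tmul, algLeg12_tmul, Algebra.TensorProduct.tmul_mul_tmul,
        Algebra.TensorProduct.tmul_mul_tmul, one_mul, mul_one, sandwich_tmul, sandwich_tmul,
        Algebra.TensorProduct.comm_tmul, h, map_mul]
      simp only [mul_assoc]

theorem sandwich_leg23_mul (m n z : A ⊗[k] A) (X : A ⊗[k] (A ⊗[k] A)) :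
    sandwich D e12 (e23 m * X * e13 n) (e12 z) = e23 m * sandwich D e12 X (e12 z) * e13 n := by
  have h23 : ∀ (a : A) (m : A ⊗[k] A), e12 (a ⊗ₜ 1) * e23 m = e23 m * e12 (a ⊗ₜ 1) := by
    intro a m
    induction m with
    | zero => simp
    | add x y hx hy => simp only [map_add, mul_add, add_mul, hx, hy]
    | tmul x y => simp
  have h13 : ∀ (a : A) (m : A ⊗[k] A), e13 m * e12 (1 ⊗ₜ a) = e12 (1 ⊗ₜ a) * e13 m := by
    intro a m
    induction m with
    | zero => simp
    | add x y hx hy => simp only [map_add, mul_add, add_mul, hx, hy]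
    | tmul x y => simp
  induction z with
  | zero => simp
  | add x y hx hy => simp only [map_add, mul_add, add_mul, hx, hy]
  | tmul x y =>
    rw [algLeg12_tmul, sandwich_tmul, sandwich_tmul]
    calc e12 (D.antipode y ⊗ₜ 1) * (e23 m * X * e13 n) * e12 (1 ⊗ₜ x)
        = (e12 (D.antipode y ⊗ₜ 1) * e23 m) * X * (e13 n * e12 (1 ⊗ₜ x)) := by noncomm_ring
      _ = _ := by rw [h23, h13]; noncomm_ring

variable (hD : D.IsQuasitriangular)

include hD

theorem sandwich_one_comulRight (z : A ⊗[k] A) :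
    sandwich D e12 1 (comulRight z) =
      e12 (1 ⊗ₜ TensorProduct.rid k A (LinearMap.lTensor A Coalgebra.counit z)) := by
  have h : ∀ (r : A) (w : A ⊗[k] A), sandwich D e12 1 (r ⊗ₜ w) =
      e12 (LinearMap.mul' k A (LinearMap.rTensor A D.antipode w) ⊗ₜ r) := by
    intro r w
    induction w with
    | zero => simp
    | add x y hx hy => simp only [TensorProduct.tmul_add, TensorProduct.add_tmul, map_add, hx, hy]
    | tmul x y => simp
  induction z with
  | zero => simp
  | add x y hx hy => simp only [TensorProduct.tmul_add, map_add, hx, hy]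
  | tmul x y =>
    rw [comulRight_tmul, h, hD.antipode_left, Algebra.algebraMap_eq_smul_one]
    simp [TensorProduct.smul_tmul]

/-- In (id ⊗ Δ)R = R₁₃ R₁₂ the first factor multiplies (Δ ⊗ id)(M) by R₂₁ in legs 1, 2. By
`comulLeft_monodromy_mul` the factors M₂₃ and M₁₃ then come out, and the sandwich that is left is 1
by the antipode and counit axioms. -/
theorem sandwich_comulLeft_monodromy :
    sandwich D e12 (comulLeft D.monodromy) (comulRight D.R) =
      e23 D.monodromy * e13 D.monodromy := by
  have h1 : sandwich D e12 (e12 (τ D.R)) (e12 D.R) = 1 := by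
    have := sandwich_leg13_mul_leg12 (D := D) 1 D.R D.R
    rw [one_mul] at this
    rw [← this, ← hD.isRMatrix.comulRight, sandwich_one_comulRight hD, hD.isRMatrix.counit_right,
      ← Algebra.TensorProduct.one_def, map_one]
  rw [hD.isRMatrix.comulRight, sandwich_leg13_mul_leg12, CatData.monodromy,
    hD.isRMatrix.comulLeft_monodromy_mul, sandwich_leg23_mul, h1, mul_one]

theorem sliceLeft_counit_monodromy : sliceLeft Coalgebra.counit D.monodromy = 1 := by
  let E : A ⊗[k] A →ₐ[k] A := (Algebra.TensorProduct.lid k A).toAlgHom.comp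
    (Algebra.TensorProduct.map (Bialgebra.counitAlgHom k A) (AlgHom.id k A))
  have h : ∀ z, TensorProduct.lid k A (LinearMap.rTensor A Coalgebra.counit (τ z)) =
      TensorProduct.rid k A (LinearMap.lTensor A Coalgebra.counit z) := by
    intro z
    induction z with
    | zero => simp
    | add x y hx hy => simp only [map_add, hx, hy]
    | tmul x y => simp
  have hl : E D.R = 1 := hD.isRMatrix.counit_left
  have hr : E (τ D.R) = 1 := (h D.R).trans hD.isRMatrix.counit_right
  change E (τ D.R * D.R) = 1
  rw [map_mul, hl, hr, one_mul]

omit hD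
variable [FiniteDimensional k A]

theorem coendToDual_coendUnit : coendToDual D (coendUnit D 1) = Coalgebra.counit := by
  apply LinearMap.ext
  intro a
  change Coalgebra.counit (R := k) a * 1 = _
  rw [mul_one]

/-- The product of the coend, evaluated. -/
theorem coendToDual_coendMul (α β : coend D) (a : A) :
    coendToDual D (coendMul D (α ⊗ₜ β)) a =
      pairing (coendToDual D β) (coendToDual D α)
        (sandwich D (AlgHom.id k _) (Δ a) (comulRight D.R)) := by
  -- The coproducts in the formula are peeled off one at a time: `h1` handles Δ(a), `h3` the
  -- coproduct of the second leg of R, `h4` the R-matrix itself.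
  let F : (regular k A).dual D → (regular k A).dual D ⊗[k] regular k A →ₗ[k]
      regular k A →ₗ[k] k := fun α' => TensorProduct.curry (LinearMap.applyₗ (R := k) a ∘ₗ
    (coendToDual D).toLinearMap ∘ₗ mulTail D (regular k A) (regular k A) ∘ₗ
      TensorProduct.mk k _ _ α')
  have h1 : ∀ (α' β' : (regular k A).dual D) (α₀ β₀ : Module.Dual k A)
      (_ : (show Module.Dual k A from α') = α₀) (_ : (show Module.Dual k A from β') = β₀) (p : A)
      (q r : regular k A) (q₀ r₀ : A) (_ : (show A from q) = q₀) (_ : (show A from r) = r₀)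
      (d : A ⊗[k] A), TensorProduct.dualDistrib k (regular k A) (regular k A)
        ((show Module.Dual k (regular k A) from ((regular k A).dual D).ρ p β') ⊗ₜ
          (show Module.Dual k (regular k A) from α'))
        (tensorAct (regular k A) (regular k A) d (q ⊗ₜ r)) =
      pairing β₀ α₀ (sandwich D (AlgHom.id k _) d (r₀ ⊗ₜ (p ⊗ₜ q₀))) := by
    intro α' β' α₀ β₀ hα hβ p q r q₀ r₀ hq hr d
    induction d with
    | zero => rw [map_zero, LinearMap.zero_apply, map_zero, sandwich_zero, map_zero]
    | add x y hx hy => rw [map_add, LinearMap.add_apply, map_add, hx, hy, sandwich_add, map_add]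
    | tmul x y =>
      rw [sandwich_tmul, tensorAct_tmul, TensorProduct.dualDistrib_apply]
      simp only [AlgHom.id_apply, Algebra.TensorProduct.tmul_mul_tmul, one_mul, pairing_tmul,
        mul_assoc]
      subst hα hβ hq hr
      rfl
  have h3 : ∀ (α' β' : (regular k A).dual D) (α₀ β₀ : Module.Dual k A)
      (_ : (show Module.Dual k A from α') = α₀) (_ : (show Module.Dual k A from β') = β₀)
      (e : regular k A) (he : ∀ b : A, (regular k A).ρ b e = (show regular k A from b))
      (r : regular k A) (r₀ : A) (_ : (show A from r) = r₀) (w : A ⊗[k] A),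
      F α' (tensorAct ((regular k A).dual D) (regular k A) w (β' ⊗ₜ e)) r =
      pairing β₀ α₀ (sandwich D (AlgHom.id k _) (Δ a) (r₀ ⊗ₜ w)) := by
    intro α' β' α₀ β₀ hα hβ e he r r₀ hr w
    induction w with
    | zero => simp only [map_zero, LinearMap.zero_apply, TensorProduct.tmul_zero]
    | add x y hx hy => simp only [map_add, LinearMap.add_apply, TensorProduct.tmul_add, hx, hy]
    | tmul p q =>
      rw [tensorAct_tmul, he]
      exact h1 α' β' α₀ β₀ hα hβ p _ r q r₀ rfl hr (Δ a)
  have h4 : ∀ (α' β' : (regular k A).dual D) (e : regular k A)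
      (he : ∀ b : A, (regular k A).ρ b e = (show regular k A from b))
      (E : ((regular k A).dual D).tensor (regular k A) →ₗ[k] regular k A →ₗ[k] k)
      (hE : E = F α') (b : ((regular k A).dual D).tensor (regular k A)) (hb : b = β' ⊗ₜ e)
      (z : A ⊗[k] A),
      TensorProduct.lift E.flip
        (tensorAct (regular k A) (((regular k A).dual D).tensor (regular k A)) z (e ⊗ₜ b)) =
      pairing (show Module.Dual k A from β') (show Module.Dual k A from α')
        (sandwich D (AlgHom.id k _) (Δ a) (comulRight z)) := by
    intro α' β' e he E hE b hb z
    induction z with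
    | zero => simp only [map_zero, LinearMap.zero_apply]
    | add x y hx hy => simp only [map_add, LinearMap.add_apply, hx, hy]
    | tmul r s =>
      rw [comulRight_tmul, tensorAct_tmul, he]
      subst hE hb
      exact h3 α' β' _ _ rfl rfl e he _ r rfl (Δ s)
  refine Eq.trans ?_ (h4 α β (show regular k A from (1 : A)) (fun a => mul_one a) (F α) rfl _ rfl
    D.R)
  have h5 : ∀ (α' : (regular k A).dual D)
      (z : regular k A ⊗[k] ((regular k A).dual D ⊗[k] regular k A)),
      coendToDual D (mulTail D (regular k A) (regular k A)
        (α' ⊗ₜ (TensorProduct.comm k _ _ z))) a = TensorProduct.lift (F α').flip z := by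
    intro α' z
    induction z with
    | zero => simp only [map_zero, LinearMap.zero_apply, TensorProduct.tmul_zero]
    | add x y hx hy => simp only [map_add, LinearMap.add_apply, TensorProduct.tmul_add, hx, hy]
    | tmul x y => rfl
  exact h5 α _

theorem sliceLeft_coendMul (α β : coend D) (z : A ⊗[k] A) :
    sliceLeft (coendToDual D (coendMul D (α ⊗ₜ β))) z =
      sliceLeft (coendToDual D α) (TensorProduct.lid k (A ⊗[k] A)
        (LinearMap.rTensor (A ⊗[k] A) (coendToDual D β)
          (sandwich D e12 (comulLeft z) (comulRight D.R)))) := by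
  have h : ∀ (d : A ⊗[k] A) (n : A) (W : A ⊗[k] (A ⊗[k] A)),
      pairing (coendToDual D β) (coendToDual D α) (sandwich D (AlgHom.id k _) d W) • n =
      sliceLeft (coendToDual D α) (TensorProduct.lid k (A ⊗[k] A)
        (LinearMap.rTensor (A ⊗[k] A) (coendToDual D β)
          (sandwich D e12 (TensorProduct.assoc k A A A (d ⊗ₜ n)) W))) := by
    intro d n W
    induction d with
    | zero => simp [sandwich_zero]
    | add x y hx hy => simp only [map_add, sandwich_add, TensorProduct.add_tmul, add_smul, hx, hy]
    | tmul x y =>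
      induction W with
      | zero => simp
      | add x y hx hy => simp only [map_add, add_smul, hx, hy]
      | tmul r w =>
        induction w with
        | zero => simp
        | add x y hx hy => simp only [map_add, TensorProduct.tmul_add, add_smul, hx, hy]
        | tmul p q =>
          simp only [sandwich_tmul, AlgHom.id_apply, TensorProduct.assoc_tmul, algLeg12_tmul,
            Algebra.TensorProduct.tmul_mul_tmul, one_mul, mul_one, pairing_tmul,
            LinearMap.rTensor_tmul, TensorProduct.lid_tmul, map_smul, sliceLeft_tmul, smul_smul]
  induction z with
  | zero => simp [sandwich_zero]
  | add x y hx hy => simp only [map_add, sandwich_add, hx, hy]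
  | tmul x y => rw [sliceLeft_tmul, coendToDual_coendMul, h, comulLeft_tmul]

include hD in
-- Contracting leg 1 with β and leg 2 with α turns M₂₃ M₁₃ into the product of the two slices, in
-- the order required for a left action.
theorem sliceLeft_coendMul_monodromy (α β : coend D) :
    sliceLeft (coendToDual D (coendMul D (α ⊗ₜ β))) D.monodromy =
      sliceLeft (coendToDual D α) D.monodromy * sliceLeft (coendToDual D β) D.monodromy := by
  have h : ∀ z z' : A ⊗[k] A, sliceLeft (coendToDual D α) (TensorProduct.lid k (A ⊗[k] A)
        (LinearMap.rTensor (A ⊗[k] A) (coendToDual D β) (e23 z * e13 z'))) =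
      sliceLeft (coendToDual D α) z * sliceLeft (coendToDual D β) z' := by
    intro z z'
    induction z with
    | zero => simp
    | add x y hx hy => simp only [map_add, add_mul, hx, hy]
    | tmul x y =>
      induction z' with
      | zero => simp
      | add x y hx hy => simp only [map_add, mul_add, hx, hy]
      | tmul x' y' => simp [smul_smul, mul_comm]
  rw [sliceLeft_coendMul, sandwich_comulLeft_monodromy hD, h]

include hD in
/-- Every object is a module over the coend, by partial monodromy. -/
theorem isCoendModule_coendAct (V : FDMod k A) : IsCoendModule D V (coendAct D V) where
  isHom := coendAct_isHom hD V
  unit_act := by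
    apply TensorProduct.ext'
    intro c y
    have h : coendUnit D c = c • coendUnit D 1 := by rw [← map_smul, smul_eq_mul, mul_one]
    rw [LinearMap.comp_apply, LinearMap.rTensor_tmul, h, ← TensorProduct.smul_tmul', map_smul,
      coendAct_tmul, coendToDual_coendUnit, sliceLeft_counit_monodromy hD, map_one]
    rfl
  mul_act := by
    apply TensorProduct.ext_threefold
    intro α β y
    rw [LinearMap.comp_apply, LinearMap.rTensor_tmul, coendAct_tmul,
      sliceLeft_coendMul_monodromy hD, map_mul, LinearMap.comp_apply, LinearMap.comp_apply,
      LinearEquiv.coe_coe, TensorProduct.assoc_tmul, LinearMap.lTensor_tmul, coendAct_tmul,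
      coendAct_tmul]
    rfl

end FDMod

end

/-! ### R-matrices of opposite algebras and of tensor products -/

section

variable {k A : Type*} [Field k] [Ring A] [Bialgebra k A]

local notation "τ" => Algebra.TensorProduct.comm k A A

/-- The inverse of the flipped R-matrix is an R-matrix. -/
theorem IsRMatrix.inv_flip {R R' : A ⊗[k] A} (hR : IsRMatrix R) (h1 : R' * τ R = 1)
    (h2 : τ R * R' = 1) : IsRMatrix R' where
  isUnit := ⟨⟨R', τ R, h1, h2⟩, rfl⟩
  mul_comul a := by
    calc R' * Coalgebra.comul a = R' * (Coalgebra.comul a * τ R) * R' := by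
          rw [mul_assoc, mul_assoc, h2, mul_one]
      _ = (R' * τ R) * (τ (Coalgebra.comul a) * R') := by
          rw [hR.comul_mul_comm]; noncomm_ring
      _ = _ := by rw [h1, one_mul]
  comulLeft := by
    -- Both sides of the coproduct formula are inverse to (Δ ⊗ id)(R₂₁), by the corresponding
    -- formula for R₂₁; the other leg is similar.
    have h : (algLeg13 k A R' * algLeg23 k A R') * CardyCartan.comulLeft (τ R) = 1 := by
      rw [hR.comulLeft_comm, mul_assoc, ← mul_assoc (algLeg23 k A R'), ← map_mul, h1, map_one,
        one_mul, ← map_mul, h1, map_one]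
    have h' : CardyCartan.comulLeft (τ R) * CardyCartan.comulLeft R' = 1 := by rw [← map_mul, h2, map_one]
    exact (left_inv_eq_right_inv h h').symm
  comulRight := by
    have h : (algLeg13 k A R' * algLeg12 k A R') * CardyCartan.comulRight (τ R) = 1 := by
      rw [hR.comulRight_comm, mul_assoc, ← mul_assoc (algLeg12 k A R'), ← map_mul, h1, map_one,
        one_mul, ← map_mul, h1, map_one]
    have h' : CardyCartan.comulRight (τ R) * CardyCartan.comulRight R' = 1 := by rw [← map_mul, h2, map_one]
    exact (left_inv_eq_right_inv h h').symm

end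

/-! ### Transport to the opposite algebra -/

section Op

variable (k A : Type*) [Field k] [Ring A] [Algebra k A]

/-- `x ⊗ y ↦ op x ⊗ op y`. -/
def opTensor : A ⊗[k] A →ₗ[k] Aᵐᵒᵖ ⊗[k] Aᵐᵒᵖ :=
  TensorProduct.map (opLinearEquiv k).toLinearMap (opLinearEquiv k).toLinearMap

/-- `x ⊗ y ⊗ z ↦ op x ⊗ op y ⊗ op z`. -/
def opTensor₃ : A ⊗[k] (A ⊗[k] A) →ₗ[k] Aᵐᵒᵖ ⊗[k] (Aᵐᵒᵖ ⊗[k] Aᵐᵒᵖ) :=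
  TensorProduct.map (opLinearEquiv k).toLinearMap (opTensor k A)

variable {k A}

@[simp] theorem opTensor_tmul (x y : A) : opTensor k A (x ⊗ₜ y) = op x ⊗ₜ op y := rfl

@[simp] theorem opTensor₃_tmul (x : A) (z : A ⊗[k] A) :
    opTensor₃ k A (x ⊗ₜ z) = op x ⊗ₜ opTensor k A z := rfl

theorem opTensor_one : opTensor k A 1 = 1 := rfl

theorem map_mul_antidistrib {B A' B' : Type*} [Ring B] [Algebra k B] [Ring A'] [Algebra k A']
    [Ring B'] [Algebra k B'] {f : A →ₗ[k] A'} {g : B →ₗ[k] B'} (hf : ∀ x y, f (x * y) = f y * f x)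
    (hg : ∀ x y, g (x * y) = g y * g x) (x y : A ⊗[k] B) :
    TensorProduct.map f g (x * y) = TensorProduct.map f g y * TensorProduct.map f g x := by
  induction x with
  | zero => simp
  | add x z hx hz => simp only [map_add, add_mul, mul_add, hx, hz]
  | tmul a b =>
    induction y with
    | zero => simp
    | add x z hx hz => simp only [map_add, add_mul, mul_add, hx, hz]
    | tmul c d => simp [hf, hg]

theorem opTensor_mul (x y : A ⊗[k] A) :
    opTensor k A (x * y) = opTensor k A y * opTensor k A x :=
  map_mul_antidistrib op_mul op_mul x y

theorem opTensor₃_mul (x y : A ⊗[k] (A ⊗[k] A)) :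
    opTensor₃ k A (x * y) = opTensor₃ k A y * opTensor₃ k A x :=
  map_mul_antidistrib op_mul opTensor_mul x y

theorem algLeg12_opTensor (z : A ⊗[k] A) :
    algLeg12 k Aᵐᵒᵖ (opTensor k A z) = opTensor₃ k A (algLeg12 k A z) := by
  induction z with
  | zero => simp
  | add x z hx hz => simp only [map_add, hx, hz]
  | tmul a b => simp

theorem algLeg13_opTensor (z : A ⊗[k] A) :
    algLeg13 k Aᵐᵒᵖ (opTensor k A z) = opTensor₃ k A (algLeg13 k A z) := by
  induction z with
  | zero => simp
  | add x z hx hz => simp only [map_add, hx, hz]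
  | tmul a b => simp

theorem algLeg23_opTensor (z : A ⊗[k] A) :
    algLeg23 k Aᵐᵒᵖ (opTensor k A z) = opTensor₃ k A (algLeg23 k A z) := rfl

theorem comm_opTensor (z : A ⊗[k] A) :
    Algebra.TensorProduct.comm k Aᵐᵒᵖ Aᵐᵒᵖ (opTensor k A z) =
      opTensor k A (Algebra.TensorProduct.comm k A A z) := by
  induction z with
  | zero => simp
  | add x z hx hz => simp only [map_add, hx, hz]
  | tmul a b => simp

end Op

section OpBialgebra

variable {k A : Type u} [Field k] [Ring A] [Bialgebra k A]

theorem comul_op (a : A) :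
    Coalgebra.comul (R := k) (op a) = opTensor k A (Coalgebra.comul a) := rfl

theorem comulRight_opTensor (z : A ⊗[k] A) :
    comulRight (opTensor k A z) = opTensor₃ k A (comulRight z) := by
  induction z with
  | zero => simp
  | add x z hx hz => simp only [map_add, hx, hz]
  | tmul a b => rw [opTensor_tmul, comulRight_tmul, comul_op]; rfl

theorem comulLeft_opTensor (z : A ⊗[k] A) :
    comulLeft (opTensor k A z) = opTensor₃ k A (comulLeft z) := by
  have h : ∀ (d : A ⊗[k] A) (y : A), TensorProduct.assoc k Aᵐᵒᵖ Aᵐᵒᵖ Aᵐᵒᵖ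
      (opTensor k A d ⊗ₜ op y) = opTensor₃ k A (TensorProduct.assoc k A A A (d ⊗ₜ y)) := by
    intro d y
    induction d with
    | zero => simp
    | add x z hx hz => simp only [map_add, TensorProduct.add_tmul, hx, hz]
    | tmul a b => simp
  induction z with
  | zero => simp
  | add x z hx hz => simp only [map_add, hx, hz]
  | tmul a b => rw [opTensor_tmul, comulLeft_tmul, comul_op, h, comulLeft_tmul]

/-- The flipped R-matrix is an R-matrix of the opposite algebra. -/
theorem IsRMatrix.op_flip {R : A ⊗[k] A} (hR : IsRMatrix R) :
    IsRMatrix (opTensor k A (Algebra.TensorProduct.comm k A A R)) where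
  isUnit := by
    obtain ⟨w, hw⟩ := hR.isUnit.map (Algebra.TensorProduct.comm k A A)
    rw [← hw]
    refine ⟨⟨opTensor k A w, opTensor k A (w⁻¹ : (A ⊗[k] A)ˣ), ?_, ?_⟩, rfl⟩
    · rw [← opTensor_mul, Units.inv_mul, opTensor_one]
    · rw [← opTensor_mul, Units.mul_inv, opTensor_one]
  mul_comul a := by
    obtain ⟨a, rfl⟩ := op_surjective a
    rw [comul_op, ← opTensor_mul, comm_opTensor, ← opTensor_mul, hR.comul_mul_comm]
  comulLeft := by
    rw [comulLeft_opTensor, algLeg13_opTensor, algLeg23_opTensor, ← opTensor₃_mul,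
      hR.comulLeft_comm]
  comulRight := by
    rw [comulRight_opTensor, algLeg13_opTensor, algLeg12_opTensor, ← opTensor₃_mul,
      hR.comulRight_comm]

end OpBialgebra

/-! ### Transport to the tensor product of two algebras -/

section Tensor

variable (k A B : Type*) [Field k] [Ring A] [Algebra k A] [Ring B] [Algebra k B]

/-- `(a ⊗ a') ⊗ (b ⊗ b') ↦ (a ⊗ b) ⊗ (a' ⊗ b')`. -/
def shuffle : (A ⊗[k] A) ⊗[k] (B ⊗[k] B) ≃ₐ[k] (A ⊗[k] B) ⊗[k] (A ⊗[k] B) :=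
  Algebra.TensorProduct.tensorTensorTensorComm k k k k A A B B

/-- `(a ⊗ a' ⊗ a'') ⊗ (b ⊗ b' ⊗ b'') ↦ (a ⊗ b) ⊗ (a' ⊗ b') ⊗ (a'' ⊗ b'')`. -/
def shuffle₃ : (A ⊗[k] (A ⊗[k] A)) ⊗[k] (B ⊗[k] (B ⊗[k] B)) →ₐ[k]
    (A ⊗[k] B) ⊗[k] ((A ⊗[k] B) ⊗[k] (A ⊗[k] B)) :=
  (Algebra.TensorProduct.map (AlgHom.id k (A ⊗[k] B)) (shuffle k A B).toAlgHom).comp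
    (Algebra.TensorProduct.tensorTensorTensorComm k k k k A (A ⊗[k] A) B (B ⊗[k] B)).toAlgHom

variable {k A B}

@[simp] theorem shuffle_tmul (a a' : A) (b b' : B) :
    shuffle k A B ((a ⊗ₜ a') ⊗ₜ (b ⊗ₜ b')) = (a ⊗ₜ b) ⊗ₜ (a' ⊗ₜ b') := rfl

@[simp] theorem shuffle₃_tmul (a : A) (a' : A ⊗[k] A) (b : B) (b' : B ⊗[k] B) :
    shuffle₃ k A B ((a ⊗ₜ a') ⊗ₜ (b ⊗ₜ b')) = (a ⊗ₜ b) ⊗ₜ shuffle k A B (a' ⊗ₜ b') := rfl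

theorem tmul_tmul_induction {M N M' N' G : Type*} [AddCommGroup M] [Module k M] [AddCommGroup N]
    [Module k N] [AddCommGroup M'] [Module k M'] [AddCommGroup N'] [Module k N'] [AddCommGroup G]
    [Module k G] {f g : (M ⊗[k] N) ⊗[k] (M' ⊗[k] N') →ₗ[k] G}
    (h : ∀ m n m' n', f ((m ⊗ₜ n) ⊗ₜ (m' ⊗ₜ n')) = g ((m ⊗ₜ n) ⊗ₜ (m' ⊗ₜ n')))
    (z : (M ⊗[k] N) ⊗[k] (M' ⊗[k] N')) : f z = g z :=
  LinearMap.congr_fun (TensorProduct.ext_fourfold' h) z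

theorem algLeg12_shuffle (x : A ⊗[k] A) (y : B ⊗[k] B) :
    algLeg12 k (A ⊗[k] B) (shuffle k A B (x ⊗ₜ y)) =
      shuffle₃ k A B (algLeg12 k A x ⊗ₜ algLeg12 k B y) := by
  refine tmul_tmul_induction
    (f := (algLeg12 k (A ⊗[k] B)).toLinearMap ∘ₗ (shuffle k A B).toLinearMap)
    (g := (shuffle₃ k A B).toLinearMap ∘ₗ TensorProduct.map (algLeg12 k A).toLinearMap
      (algLeg12 k B).toLinearMap) ?_ (x ⊗ₜ y)
  intro a a' b b'
  simp [Algebra.TensorProduct.one_def]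

theorem algLeg13_shuffle (x : A ⊗[k] A) (y : B ⊗[k] B) :
    algLeg13 k (A ⊗[k] B) (shuffle k A B (x ⊗ₜ y)) =
      shuffle₃ k A B (algLeg13 k A x ⊗ₜ algLeg13 k B y) := by
  refine tmul_tmul_induction
    (f := (algLeg13 k (A ⊗[k] B)).toLinearMap ∘ₗ (shuffle k A B).toLinearMap)
    (g := (shuffle₃ k A B).toLinearMap ∘ₗ TensorProduct.map (algLeg13 k A).toLinearMap
      (algLeg13 k B).toLinearMap) ?_ (x ⊗ₜ y)
  intro a a' b b'
  simp [Algebra.TensorProduct.one_def]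

theorem algLeg23_shuffle (x : A ⊗[k] A) (y : B ⊗[k] B) :
    algLeg23 k (A ⊗[k] B) (shuffle k A B (x ⊗ₜ y)) =
      shuffle₃ k A B (algLeg23 k A x ⊗ₜ algLeg23 k B y) := rfl

theorem comm_shuffle (x : A ⊗[k] A) (y : B ⊗[k] B) :
    Algebra.TensorProduct.comm k (A ⊗[k] B) (A ⊗[k] B) (shuffle k A B (x ⊗ₜ y)) =
      shuffle k A B (Algebra.TensorProduct.comm k A A x ⊗ₜ Algebra.TensorProduct.comm k B B y) := by
  refine tmul_tmul_induction
    (f := (Algebra.TensorProduct.comm k (A ⊗[k] B) (A ⊗[k] B)).toLinearMap ∘ₗ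
      (shuffle k A B).toLinearMap)
    (g := (shuffle k A B).toLinearMap ∘ₗ TensorProduct.map
      (Algebra.TensorProduct.comm k A A).toLinearMap
      (Algebra.TensorProduct.comm k B B).toLinearMap) ?_ (x ⊗ₜ y)
  intro a a' b b'
  simp

end Tensor

section TensorBialgebra

variable {k A B : Type*} [Field k] [Ring A] [Bialgebra k A] [Ring B] [Bialgebra k B]

theorem comul_tmul_eq_shuffle (a : A) (b : B) :
    Coalgebra.comul (R := k) (a ⊗ₜ[k] b) =
      shuffle k A B (Coalgebra.comul a ⊗ₜ Coalgebra.comul b) := rfl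

theorem comulRight_shuffle (x : A ⊗[k] A) (y : B ⊗[k] B) :
    comulRight (shuffle k A B (x ⊗ₜ y)) = shuffle₃ k A B (comulRight x ⊗ₜ comulRight y) := by
  refine tmul_tmul_induction
    (f := (comulRight (k := k) (A := A ⊗[k] B)).toLinearMap ∘ₗ (shuffle k A B).toLinearMap)
    (g := (shuffle₃ k A B).toLinearMap ∘ₗ TensorProduct.map comulRight.toLinearMap
      comulRight.toLinearMap) ?_ (x ⊗ₜ y)
  intro a a' b b'
  rfl

theorem comulLeft_shuffle (x : A ⊗[k] A) (y : B ⊗[k] B) :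
    comulLeft (shuffle k A B (x ⊗ₜ y)) = shuffle₃ k A B (comulLeft x ⊗ₜ comulLeft y) := by
  have h : ∀ (d : A ⊗[k] A) (e : B ⊗[k] B) (a : A) (b : B),
      TensorProduct.assoc k (A ⊗[k] B) (A ⊗[k] B) (A ⊗[k] B)
        (shuffle k A B (d ⊗ₜ e) ⊗ₜ (a ⊗ₜ b)) =
      shuffle₃ k A B (TensorProduct.assoc k A A A (d ⊗ₜ a) ⊗ₜ
        TensorProduct.assoc k B B B (e ⊗ₜ b)) := by
    intro d e a b
    induction d with
    | zero => simp
    | add x z hx hz => simp only [map_add, TensorProduct.add_tmul, hx, hz]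
    | tmul c c' =>
      induction e with
      | zero => simp
      | add x z hx hz =>
        simp only [map_add, TensorProduct.add_tmul, TensorProduct.tmul_add, hx, hz]
      | tmul d d' => simp
  refine tmul_tmul_induction
    (f := (comulLeft (k := k) (A := A ⊗[k] B)).toLinearMap ∘ₗ (shuffle k A B).toLinearMap)
    (g := (shuffle₃ k A B).toLinearMap ∘ₗ TensorProduct.map comulLeft.toLinearMap
      comulLeft.toLinearMap) ?_ (x ⊗ₜ y)
  intro a a' b b'
  exact h _ _ _ _

/-- The tensor product of two R-matrices. -/
theorem IsRMatrix.shuffle {R : A ⊗[k] A} {R' : B ⊗[k] B} (hR : IsRMatrix R) (hR' : IsRMatrix R') :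
    IsRMatrix (shuffle k A B (R ⊗ₜ R')) where
  isUnit := by
    have h : R ⊗ₜ[k] R' = (R ⊗ₜ 1) * (1 ⊗ₜ R') := by simp
    rw [h]
    refine IsUnit.map _ (IsUnit.mul ?_ ?_)
    · exact hR.isUnit.map
        (Algebra.TensorProduct.includeLeft : A ⊗[k] A →ₐ[k] (A ⊗[k] A) ⊗[k] (B ⊗[k] B))
    · exact hR'.isUnit.map
        (Algebra.TensorProduct.includeRight : B ⊗[k] B →ₐ[k] (A ⊗[k] A) ⊗[k] (B ⊗[k] B))
  mul_comul z := by
    induction z with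
    | zero => simp
    | add x z hx hz => simp only [map_add, mul_add, add_mul, hx, hz]
    | tmul a b =>
      rw [comul_tmul_eq_shuffle, comm_shuffle, ← map_mul, ← map_mul,
        Algebra.TensorProduct.tmul_mul_tmul, Algebra.TensorProduct.tmul_mul_tmul, hR.mul_comul,
        hR'.mul_comul]
  comulLeft := by
    rw [comulLeft_shuffle, algLeg13_shuffle, algLeg23_shuffle, ← map_mul,
      Algebra.TensorProduct.tmul_mul_tmul, hR.comulLeft, hR'.comulLeft]
  comulRight := by
    rw [comulRight_shuffle, algLeg13_shuffle, algLeg12_shuffle, ← map_mul,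
      Algebra.TensorProduct.tmul_mul_tmul, hR.comulRight, hR'.comulRight]

end TensorBialgebra

/-! ### Left modules and bimodules -/

section

variable {k H : Type u} [Field k] [Ring H] [HopfAlgebra k H] (r : RibbonStructure k H)

open HopfAlgebra Coalgebra

namespace RibbonStructure

theorem isRMatrix : IsRMatrix (r.R : H ⊗[k] H) where
  isUnit := r.R.isUnit
  mul_comul := r.R_comul
  comulLeft := r.comul_rTensor_R
  comulRight := r.comul_lTensor_R

theorem commute_v_inv (h : H) : ((r.v⁻¹ : Hˣ) : H) * h = h * ((r.v⁻¹ : Hˣ) : H) :=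
  (Commute.units_inv_left (show Commute (r.v : H) h from r.v_central h)).eq

theorem sq_antipode_mul_t (h : H) : antipode k (antipode k h) * r.t = r.t * h := by
  rw [t, ← mul_assoc, sq_antipode_mul_drinfeldElement, mul_assoc, mul_assoc, r.commute_v_inv]

end RibbonStructure

theorem chiral_isQuasitriangular : (chiral r).IsQuasitriangular where
  isRMatrix := r.isRMatrix
  antipode_left := mul_antipode_rTensor_comul_apply
  antipode_right := mul_antipode_lTensor_comul_apply
  antipode_sq := r.sq_antipode_mul_t

variable [FiniteDimensional k H]

namespace RibbonStructure

theorem antipode_symm_apply (h : H) : antipode k (r.antipodeEquiv.symm h) = h :=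
  r.antipodeEquiv.apply_symm_apply h

theorem symm_antipode_apply (h : H) : r.antipodeEquiv.symm (antipode k h) = h :=
  r.antipodeEquiv.symm_apply_apply h

theorem antipode_symm_mul (a b : H) : r.antipodeEquiv.symm (a * b) =
    r.antipodeEquiv.symm b * r.antipodeEquiv.symm a := by
  apply r.antipode_injective
  rw [antipode_mul_antidistrib]
  simp only [antipode_symm_apply]

theorem antipode_symm_one : r.antipodeEquiv.symm 1 = 1 := by
  apply r.antipode_injective
  rw [antipode_symm_apply, antipode_one]

/-- `S⁻¹` is an antipode of the opposite algebra. -/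
theorem mul_rTensor_antipode_symm_op (h : H) :
    LinearMap.mul' k Hᵐᵒᵖ (LinearMap.rTensor Hᵐᵒᵖ ((opLinearEquiv k).toLinearMap ∘ₗ
      r.antipodeEquiv.symm.toLinearMap ∘ₗ (opLinearEquiv k).symm.toLinearMap)
        (opTensor k H (comul h))) = algebraMap k Hᵐᵒᵖ (counit (R := k) h) := by
  have key : ∀ d : H ⊗[k] H,
      LinearMap.mul' k Hᵐᵒᵖ (LinearMap.rTensor Hᵐᵒᵖ ((opLinearEquiv k).toLinearMap ∘ₗ
        r.antipodeEquiv.symm.toLinearMap ∘ₗ (opLinearEquiv k).symm.toLinearMap)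
          (opTensor k H d)) =
      op (r.antipodeEquiv.symm (LinearMap.mul' k H (LinearMap.lTensor H (antipode k) d))) := by
    intro d
    induction d with
    | zero => simp
    | add x y hx hy => simp only [map_add, hx, hy, op_add]
    | tmul x y => simp [antipode_symm_mul, symm_antipode_apply]
  rw [key, mul_antipode_lTensor_comul_apply]
  simp [Algebra.algebraMap_eq_smul_one, antipode_symm_one]

theorem mul_lTensor_antipode_symm_op (h : H) :
    LinearMap.mul' k Hᵐᵒᵖ (LinearMap.lTensor Hᵐᵒᵖ ((opLinearEquiv k).toLinearMap ∘ₗ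
      r.antipodeEquiv.symm.toLinearMap ∘ₗ (opLinearEquiv k).symm.toLinearMap)
        (opTensor k H (comul h))) = algebraMap k Hᵐᵒᵖ (counit (R := k) h) := by
  have key : ∀ d : H ⊗[k] H,
      LinearMap.mul' k Hᵐᵒᵖ (LinearMap.lTensor Hᵐᵒᵖ ((opLinearEquiv k).toLinearMap ∘ₗ
        r.antipodeEquiv.symm.toLinearMap ∘ₗ (opLinearEquiv k).symm.toLinearMap)
          (opTensor k H d)) =
      op (r.antipodeEquiv.symm (LinearMap.mul' k H (LinearMap.rTensor H (antipode k) d))) := by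
    intro d
    induction d with
    | zero => simp
    | add x y hx hy => simp only [map_add, hx, hy, op_add]
    | tmul x y => simp [antipode_symm_mul, symm_antipode_apply]
  rw [key, mul_antipode_rTensor_comul_apply]
  simp [Algebra.algebraMap_eq_smul_one, antipode_symm_one]

end RibbonStructure

theorem bulk_antipode_tmul (a b : H) :
    ((bulk r).S (a ⊗ₜ op b)).unop = antipode k a ⊗ₜ op (r.antipodeEquiv.symm b) := rfl

theorem bulk_antipode_eq_map : (bulk r).antipode =
    TensorProduct.map (antipode k) ((opLinearEquiv k).toLinearMap ∘ₗ
      r.antipodeEquiv.symm.toLinearMap ∘ₗ (opLinearEquiv k).symm.toLinearMap) := by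
  apply TensorProduct.ext'
  intro a b
  rfl

theorem bulk_isRMatrix : IsRMatrix (bulk r).R := by
  have h1 : IsRMatrix ((r.R21⁻¹ : (H ⊗[k] H)ˣ) : H ⊗[k] H) :=
    r.isRMatrix.inv_flip (Units.inv_mul r.R21) (Units.mul_inv r.R21)
  exact h1.shuffle r.isRMatrix.op_flip

section

variable {A B : Type*} [Ring A] [Algebra k A] [Ring B] [Algebra k B]

theorem mul'_rTensor_map_shuffle (f : A →ₗ[k] A) (g : B →ₗ[k] B) (x : A ⊗[k] A) (y : B ⊗[k] B) :
    LinearMap.mul' k (A ⊗[k] B) (LinearMap.rTensor _ (TensorProduct.map f g)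
      (shuffle k A B (x ⊗ₜ y))) =
    LinearMap.mul' k A (LinearMap.rTensor A f x) ⊗ₜ
      LinearMap.mul' k B (LinearMap.rTensor B g y) := by
  refine tmul_tmul_induction
    (f := LinearMap.mul' k (A ⊗[k] B) ∘ₗ LinearMap.rTensor _ (TensorProduct.map f g) ∘ₗ
      (shuffle k A B).toLinearMap)
    (g := TensorProduct.map (LinearMap.mul' k A ∘ₗ LinearMap.rTensor A f)
      (LinearMap.mul' k B ∘ₗ LinearMap.rTensor B g)) ?_ (x ⊗ₜ y)
  intro a a' b b'
  simp

theorem mul'_lTensor_map_shuffle (f : A →ₗ[k] A) (g : B →ₗ[k] B) (x : A ⊗[k] A) (y : B ⊗[k] B) :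
    LinearMap.mul' k (A ⊗[k] B) (LinearMap.lTensor _ (TensorProduct.map f g)
      (shuffle k A B (x ⊗ₜ y))) =
    LinearMap.mul' k A (LinearMap.lTensor A f x) ⊗ₜ
      LinearMap.mul' k B (LinearMap.lTensor B g y) := by
  refine tmul_tmul_induction
    (f := LinearMap.mul' k (A ⊗[k] B) ∘ₗ LinearMap.lTensor _ (TensorProduct.map f g) ∘ₗ
      (shuffle k A B).toLinearMap)
    (g := TensorProduct.map (LinearMap.mul' k A ∘ₗ LinearMap.lTensor A f)
      (LinearMap.mul' k B ∘ₗ LinearMap.lTensor B g)) ?_ (x ⊗ₜ y)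
  intro a a' b b'
  simp

end

theorem algebraMap_tmul_algebraMap {A B : Type*} [Ring A] [Algebra k A] [Ring B] [Algebra k B]
    (c d : k) : algebraMap k A c ⊗ₜ[k] algebraMap k B d = algebraMap k (A ⊗[k] B) (d * c) := by
  simp only [Algebra.algebraMap_eq_smul_one, TensorProduct.smul_tmul_smul,
    Algebra.TensorProduct.one_def, mul_comm d c]

theorem bulk_isQuasitriangular : (bulk r).IsQuasitriangular where
  isRMatrix := bulk_isRMatrix r
  antipode_left z := by
    change LinearMap.mul' k _ (LinearMap.rTensor _ (bulk r).antipode _) = _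
    rw [bulk_antipode_eq_map]
    induction z with
    | zero => simp
    | add x y hx hy => simp only [map_add, hx, hy]
    | tmul a b =>
      obtain ⟨b, rfl⟩ := op_surjective b
      rw [comul_tmul_eq_shuffle, mul'_rTensor_map_shuffle, mul_antipode_rTensor_comul_apply,
        comul_op, r.mul_rTensor_antipode_symm_op, algebraMap_tmul_algebraMap]
      rfl
  antipode_right z := by
    change LinearMap.mul' k _ (LinearMap.lTensor _ (bulk r).antipode _) = _
    rw [bulk_antipode_eq_map]
    induction z with
    | zero => simp
    | add x y hx hy => simp only [map_add, hx, hy]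
    | tmul a b =>
      obtain ⟨b, rfl⟩ := op_surjective b
      rw [comul_tmul_eq_shuffle, mul'_lTensor_map_shuffle, mul_antipode_lTensor_comul_apply,
        comul_op, r.mul_lTensor_antipode_symm_op, algebraMap_tmul_algebraMap]
      rfl
  antipode_sq z := by
    induction z with
    | zero => simp
    | add x y hx hy => simp only [map_add, unop_add, add_mul, mul_add, hx, hy]
    | tmul a b =>
      obtain ⟨b, rfl⟩ := op_surjective b
      rw [bulk_antipode_tmul, bulk_antipode_tmul]
      change _ * (r.t ⊗ₜ op r.t) = (r.t ⊗ₜ op r.t) * _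
      rw [Algebra.TensorProduct.tmul_mul_tmul, Algebra.TensorProduct.tmul_mul_tmul,
        r.sq_antipode_mul_t, ← op_mul, ← op_mul]
      -- On the opposite factor the antipode is S⁻¹, so S²(h) t = t h is needed at h = S⁻²(b).
      have h := r.sq_antipode_mul_t (r.antipodeEquiv.symm (r.antipodeEquiv.symm b))
      rw [r.antipode_symm_apply, r.antipode_symm_apply] at h
      rw [h]

end

/-! ### Monodromy with a dual module -/

section

variable {k H : Type u} [Field k] [Ring H] [HopfAlgebra k H]

open HopfAlgebra Coalgebra

local notation "τ" => Algebra.TensorProduct.comm k H H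

/-- Apply S to leg 1 of (Δ ⊗ id)R = R₁₃ R₂₃ and multiply legs 1 and 2: one side collapses to the
counit, the other is (S ⊗ id)(R) R. -/
theorem IsRMatrix.rTensor_antipode_mul {R : H ⊗[k] H} (hR : IsRMatrix R) :
    LinearMap.rTensor H (antipode k) R * R = 1 := by
  let G : H ⊗[k] (H ⊗[k] H) →ₗ[k] H ⊗[k] H :=
    LinearMap.rTensor H (LinearMap.mul' k H ∘ₗ LinearMap.rTensor H (antipode k)) ∘ₗ
      (TensorProduct.assoc k H H H).symm.toLinearMap
  have h1 : ∀ z z' : H ⊗[k] H, G (algLeg13 k H z * algLeg23 k H z') =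
      LinearMap.rTensor H (antipode k) z * z' := by
    intro z z'
    induction z with
    | zero => simp
    | add x y hx hy => simp only [map_add, add_mul, hx, hy]
    | tmul x y =>
      induction z' with
      | zero => simp
      | add x y hx hy => simp only [map_add, mul_add, hx, hy]
      | tmul x' y' => simp [G]
  have h2 : ∀ z : H ⊗[k] H, G (CardyCartan.comulLeft z) =
      1 ⊗ₜ TensorProduct.lid k H (LinearMap.rTensor H counit z) := by
    intro z
    induction z with
    | zero => simp
    | add x y hx hy => simp only [map_add, TensorProduct.tmul_add, hx, hy]
    | tmul x y =>
      rw [comulLeft_tmul]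
      simp [G, Algebra.algebraMap_eq_smul_one, TensorProduct.smul_tmul]
  rw [← h1, ← hR.comulLeft, h2, hR.counit_left, Algebra.TensorProduct.one_def]

theorem comm_rTensor (f : H →ₗ[k] H) (z : H ⊗[k] H) :
    τ (LinearMap.rTensor H f z) = LinearMap.lTensor H f (τ z) := by
  induction z with
  | zero => simp
  | add x y hx hy => simp only [map_add, hx, hy]
  | tmul x y => simp

theorem pairing_mul_comm {α T : Module.Dual k H} (hT : ∀ x y, T (x * y) = T (y * x))
    (z : H ⊗[k] H) (h : H) : pairing α T (z * (1 ⊗ₜ h)) = pairing α T ((1 ⊗ₜ h) * z) := by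
  induction z with
  | zero => simp
  | add x y hx hy => simp only [map_add, add_mul, mul_add, hx, hy]
  | tmul x y => simp [hT]

theorem lTensor_antipode_mul (z : H ⊗[k] H) (a b : H) :
    LinearMap.lTensor H (antipode k) ((a ⊗ₜ b) * z) =
      (a ⊗ₜ 1) * LinearMap.lTensor H (antipode k) z * (1 ⊗ₜ antipode k b) := by
  induction z with
  | zero => simp
  | add x y hx hy => simp only [map_add, add_mul, mul_add, hx, hy]
  | tmul x y => simp [antipode_mul_antidistrib]

theorem lTensor_antipode_mul' (z : H ⊗[k] H) (a b : H) :
    LinearMap.lTensor H (antipode k) (z * (a ⊗ₜ b)) =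
      (1 ⊗ₜ antipode k b) * LinearMap.lTensor H (antipode k) z * (a ⊗ₜ 1) := by
  induction z with
  | zero => simp
  | add x y hx hy => simp only [map_add, add_mul, mul_add, hx, hy]
  | tmul x y => simp [antipode_mul_antidistrib]

/-- `x ⊗ y ↦ (1 ⊗ f(x)) R (y ⊗ 1)`. -/
def encircle (R : H ⊗[k] H) (f : H →ₗ[k] H) : H ⊗[k] H →ₗ[k] H ⊗[k] H :=
  TensorProduct.lift ((LinearMap.mul k (H ⊗[k] H)).compl₁₂
    (LinearMap.mulRight k R ∘ₗ TensorProduct.mk k H H 1 ∘ₗ f) ((TensorProduct.mk k H H).flip 1))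

@[simp] theorem encircle_tmul (R : H ⊗[k] H) (f : H →ₗ[k] H) (x y : H) :
    encircle R f (x ⊗ₜ y) = (1 ⊗ₜ f x) * R * (y ⊗ₜ 1) := rfl

namespace RibbonStructure

variable (r : RibbonStructure k H)

theorem rTensor_antipode_R : LinearMap.rTensor H (antipode k) (r.R : H ⊗[k] H) =
    ((r.R⁻¹ : (H ⊗[k] H)ˣ) : H ⊗[k] H) :=
  left_inv_eq_right_inv r.isRMatrix.rTensor_antipode_mul (Units.mul_inv r.R)

theorem comm_R21_inv : τ ((r.R21⁻¹ : (H ⊗[k] H)ˣ) : H ⊗[k] H) =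
    ((r.R⁻¹ : (H ⊗[k] H)ˣ) : H ⊗[k] H) := by
  have h1 : τ ((r.R21⁻¹ : (H ⊗[k] H)ˣ) : H ⊗[k] H) * r.R = 1 := by
    have h : τ (r.R21 : H ⊗[k] H) = r.R := TensorProduct.comm_comm _ _ _ _
    rw [← h, ← map_mul, Units.inv_mul, map_one]
  exact left_inv_eq_right_inv h1 (Units.mul_inv r.R)

theorem comm_R_inv : τ ((r.R⁻¹ : (H ⊗[k] H)ˣ) : H ⊗[k] H) =
    ((r.R21⁻¹ : (H ⊗[k] H)ˣ) : H ⊗[k] H) := by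
  rw [← r.comm_R21_inv]
  exact TensorProduct.comm_comm _ _ _ _

/-- R₂₁⁻¹ is again an R-matrix, so S on its first leg inverts it; flipping the legs gives the claim.
-/
theorem lTensor_antipode_R_inv : LinearMap.lTensor H (antipode k)
    ((r.R⁻¹ : (H ⊗[k] H)ˣ) : H ⊗[k] H) = r.R := by
  have h1 : IsRMatrix ((r.R21⁻¹ : (H ⊗[k] H)ˣ) : H ⊗[k] H) :=
    r.isRMatrix.inv_flip (Units.inv_mul r.R21) (Units.mul_inv r.R21)
  have h2 : LinearMap.rTensor H (antipode k) ((r.R21⁻¹ : (H ⊗[k] H)ˣ) : H ⊗[k] H) = r.R21 :=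
    left_inv_eq_right_inv h1.rTensor_antipode_mul (Units.inv_mul r.R21)
  rw [← comm_R21_inv, ← comm_rTensor, h2]
  exact TensorProduct.comm_comm _ _ _ _

theorem map_antipode_R :
    TensorProduct.map (antipode k) (antipode k) (r.R : H ⊗[k] H) = r.R := by
  rw [← LinearMap.lTensor_comp_rTensor, LinearMap.comp_apply, rTensor_antipode_R,
    lTensor_antipode_R_inv]

/-- For R = ∑ a ⊗ b one has u = ∑ S(b)a, so S(u) = ∑ S(a)S²(b); invariance of R under S ⊗ S removes
one S from each factor. -/
theorem mul'_lTensor_antipode_R : LinearMap.mul' k H (LinearMap.lTensor H (antipode k)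
    (r.R : H ⊗[k] H)) = antipode k r.drinfeldElement := by
  have h : ∀ z : H ⊗[k] H, antipode k (LinearMap.mul' k H (LinearMap.rTensor H (antipode k) (τ z))) =
      LinearMap.mul' k H (LinearMap.lTensor H (antipode k)
        (TensorProduct.map (antipode k) (antipode k) z)) := by
    intro z
    induction z with
    | zero => simp
    | add x y hx hy => simp only [map_add, hx, hy]
    | tmul x y => simp [antipode_mul_antidistrib]
  refine Eq.trans ?_ (h r.R).symm
  rw [map_antipode_R]

/-- A loop around a strand, by means of the Drinfeld element. -/
theorem pairing_drinfeldElement_mul_monodromy {α T : Module.Dual k H}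
    (hT : ∀ x y, T (x * y) = T (y * x)) :
    pairing α T ((1 ⊗ₜ r.drinfeldElement) * (τ (r.R : H ⊗[k] H) * (r.R : H ⊗[k] H))) =
      pairing α T (encircle (r.R : H ⊗[k] H)
        (LinearMap.mulRight k (antipode k r.drinfeldElement)) r.R) := by
  set R : H ⊗[k] H := (r.R : H ⊗[k] H) with hRdef
  set Ri : H ⊗[k] H := ((r.R⁻¹ : (H ⊗[k] H)ˣ) : H ⊗[k] H) with hRi
  -- Both maps will be applied to (id ⊗ Δ)R = R₁₃ R₁₂: `F` produces (1 ⊗ u) R₂₁, and `G` the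
  -- encircling form with S(u).
  let F : H ⊗[k] (H ⊗[k] H) →ₗ[k] H ⊗[k] H :=
    LinearMap.lTensor H (LinearMap.mul' k H ∘ₗ LinearMap.rTensor H (antipode k) ∘ₗ
      (TensorProduct.comm k H H).toLinearMap) ∘ₗ (TensorProduct.leftComm k H H H).toLinearMap
  let G : H ⊗[k] (H ⊗[k] H) →ₗ[k] H ⊗[k] H :=
    encircle R LinearMap.id ∘ₗ
      LinearMap.rTensor H (LinearMap.mul' k H ∘ₗ LinearMap.lTensor H (antipode k)) ∘ₗ
        (TensorProduct.assoc k H H H).symm.toLinearMap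
  have hF : ∀ z z' : H ⊗[k] H, F (algLeg13 k H z * algLeg12 k H z') =
      (1 ⊗ₜ LinearMap.mul' k H (LinearMap.rTensor H (antipode k) (τ z))) * τ z' := by
    intro z z'
    induction z with
    | zero => simp
    | add x y hx hy => simp only [map_add, add_mul, TensorProduct.tmul_add, hx, hy]
    | tmul x y =>
      induction z' with
      | zero => simp
      | add x y hx hy => simp only [map_add, mul_add, hx, hy]
      | tmul x' y' => simp [F, mul_assoc]
  have hG : ∀ z z' : H ⊗[k] H, G (algLeg13 k H z * algLeg12 k H z') =
      encircle R (LinearMap.mulRight k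
        (LinearMap.mul' k H (LinearMap.lTensor H (antipode k) z'))) z := by
    intro z z'
    induction z with
    | zero => simp
    | add x y hx hy => simp only [map_add, add_mul, hx, hy]
    | tmul x y =>
      rw [encircle_tmul]
      induction z' with
      | zero => simp
      | add x y hx hy =>
        simp only [map_add, mul_add, hx, hy, LinearMap.mulRight_apply, add_mul,
          TensorProduct.tmul_add]
      | tmul x' y' => simp [G, mul_assoc]
  -- Substituting R = (id ⊗ S)(R⁻¹) brings both expressions to the same shape, with d R⁻¹ in one and
  -- R⁻¹ τ(d) in the other. These agree when d is a coproduct. Cyclicity of T is needed for the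
  -- first.
  have hFG : ∀ (x : H) (d : H ⊗[k] H),
      pairing α T (F (x ⊗ₜ d) * R) =
        pairing α T ((1 ⊗ₜ x) * LinearMap.lTensor H (antipode k) (d * Ri)) ∧
      G (x ⊗ₜ d) = (1 ⊗ₜ x) * LinearMap.lTensor H (antipode k) (Ri * τ d) := by
    intro x d
    induction d with
    | zero => simp
    | add a b ha hb =>
      simp only [TensorProduct.tmul_add, map_add, add_mul, mul_add, ha, hb, and_self]
    | tmul c c' =>
      constructor
      · rw [lTensor_antipode_mul, lTensor_antipode_R_inv, ← mul_assoc, ← mul_assoc,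
          pairing_mul_comm hT, ← mul_assoc, ← mul_assoc]
        simp [F, hRdef]
      · rw [Algebra.TensorProduct.comm_tmul, lTensor_antipode_mul', lTensor_antipode_R_inv,
          ← mul_assoc, ← mul_assoc]
        simp [G, hRdef]
  have hcomm : ∀ y : H, comul (R := k) y * Ri = Ri * τ (comul (R := k) y) := by
    intro y
    have h := r.R_comul y
    calc comul (R := k) y * Ri = Ri * (R * comul (R := k) y) * Ri := by
          rw [← mul_assoc, hRi, hRdef, Units.inv_mul, one_mul]
      _ = Ri * τ (comul (R := k) y) * (R * Ri) := by
          rw [hRdef, h]; simp only [mul_assoc]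
      _ = _ := by rw [hRi, hRdef, Units.mul_inv, mul_one]
  have hFG' : ∀ z : H ⊗[k] H, pairing α T (F (comulRight z) * R) =
      pairing α T (G (comulRight z)) := by
    intro z
    induction z with
    | zero => simp
    | add a b ha hb => simp only [map_add, add_mul, ha, hb]
    | tmul x y => rw [comulRight_tmul, (hFG x _).1, (hFG x _).2, hcomm]
  have h := hFG' R
  rw [r.isRMatrix.comulRight, hF, hG, mul'_lTensor_antipode_R, mul_assoc] at h
  exact h

/-- This is S applied to S²(y) u = u y, read at x = S(y). -/
theorem antipode_drinfeldElement_mul (x : H) (hx : ∃ y, antipode k y = x) :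
    antipode k r.drinfeldElement * antipode k (antipode k x) =
      x * antipode k r.drinfeldElement := by
  obtain ⟨y, rfl⟩ := hx
  have h := congrArg (antipode k) (r.sq_antipode_mul_drinfeldElement y)
  rwa [antipode_mul_antidistrib, antipode_mul_antidistrib] at h

theorem antipode_v_inv : antipode k ((r.v⁻¹ : Hˣ) : H) = ((r.v⁻¹ : Hˣ) : H) := by
  have h : antipode k ((r.v⁻¹ : Hˣ) : H) * r.v = 1 := by
    have := congrArg (antipode k) (Units.mul_inv r.v)
    rw [antipode_mul_antidistrib, r.antipode_v, antipode_one] at this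
    exact this
  exact left_inv_eq_right_inv h (Units.mul_inv r.v)

/-- A loop around a strand, for the inverse monodromy and the dual of a module. -/
theorem pairing_antipode_monodromy_inv {α T : Module.Dual k H}
    (hT : ∀ x y, T (x * y) = T (y * x)) (hS : Function.Surjective (antipode k : H →ₗ[k] H)) :
    pairing α T (LinearMap.lTensor H (antipode k) ((r.Q⁻¹ : (H ⊗[k] H)ˣ) : H ⊗[k] H) *
        (1 ⊗ₜ antipode k r.drinfeldElement)) =
      pairing α T (encircle (r.R : H ⊗[k] H)
        (LinearMap.mulRight k (antipode k r.drinfeldElement)) r.R) := by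
  have hQ : ((r.Q⁻¹ : (H ⊗[k] H)ˣ) : H ⊗[k] H) =
      ((r.R⁻¹ : (H ⊗[k] H)ˣ) : H ⊗[k] H) * τ ((r.R⁻¹ : (H ⊗[k] H)ˣ) : H ⊗[k] H) := by
    rw [r.comm_R_inv, Q, mul_inv_rev, Units.val_mul]
  -- S reverses products in the second leg, so (id ⊗ S)(R⁻¹) = R ends up between the two legs of z.
  -- The relevant z is R⁻¹ = (S ⊗ id)R, which produces an S² below.
  have h1 : ∀ z : H ⊗[k] H, LinearMap.lTensor H (antipode k)
      (((r.R⁻¹ : (H ⊗[k] H)ˣ) : H ⊗[k] H) * τ z) =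
      encircle (r.R : H ⊗[k] H) (antipode k) z := by
    intro z
    induction z with
    | zero => simp
    | add a b ha hb => simp only [map_add, mul_add, ha, hb]
    | tmul x y =>
      rw [Algebra.TensorProduct.comm_tmul, lTensor_antipode_mul', lTensor_antipode_R_inv,
        encircle_tmul]
  -- Cyclicity brings S(u) in front of S²(x), and S(u) S²(x) = x S(u) removes the S².
  have h2 : ∀ z : H ⊗[k] H, pairing α T (encircle (r.R : H ⊗[k] H) (antipode k)
      (LinearMap.rTensor H (antipode k) z) * (1 ⊗ₜ antipode k r.drinfeldElement)) =
      pairing α T (encircle (r.R : H ⊗[k] H)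
        (LinearMap.mulRight k (antipode k r.drinfeldElement)) z) := by
    intro z
    induction z with
    | zero => simp
    | add a b ha hb => simp only [map_add, add_mul, ha, hb]
    | tmul x y =>
      rw [LinearMap.rTensor_tmul, encircle_tmul, encircle_tmul, pairing_mul_comm hT, ← mul_assoc,
        ← mul_assoc, Algebra.TensorProduct.tmul_mul_tmul, one_mul,
        r.antipode_drinfeldElement_mul x (hS x), LinearMap.mulRight_apply]
  rw [hQ, h1, ← r.rTensor_antipode_R, h2]

/-- The partial trace of the inverse monodromy over the dual of a module is the partial trace of
the monodromy over the module. -/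
theorem pairing_monodromy_inv {α T : Module.Dual k H} (hT : ∀ x y, T (x * y) = T (y * x))
    (hS : Function.Surjective (antipode k : H →ₗ[k] H)) :
    pairing α (T ∘ₗ antipode k ∘ₗ LinearMap.mulLeft k r.t)
        ((r.Q⁻¹ : (H ⊗[k] H)ˣ) : H ⊗[k] H) =
      pairing α (T ∘ₗ LinearMap.mulLeft k r.t) (r.Q : H ⊗[k] H) := by
  have hv := r.commute_v_inv
  -- The central factor v⁻¹ of t, which S fixes, is absorbed into the trace form. Only u and S(u)
  -- remain, and T' is still cyclic.
  set T' : Module.Dual k H := T ∘ₗ LinearMap.mulLeft k ((r.v⁻¹ : Hˣ) : H) with hT'def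
  have hT' : ∀ x y, T' (x * y) = T' (y * x) := by
    intro x y
    change T (_ * (x * y)) = T (_ * (y * x))
    rw [← mul_assoc, hT, ← mul_assoc, ← hv y, mul_assoc]
  have h1 : ∀ z : H ⊗[k] H, pairing α (T ∘ₗ LinearMap.mulLeft k r.t) z =
      pairing α T' ((1 ⊗ₜ r.drinfeldElement) * z) := by
    intro z
    induction z with
    | zero => simp
    | add a b ha hb => simp only [map_add, mul_add, ha, hb]
    | tmul x y =>
      have : r.t * y = ((r.v⁻¹ : Hˣ) : H) * (r.drinfeldElement * y) := by
        rw [t, mul_assoc, hv, hv, mul_assoc]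
      simp [hT'def, this]
  have h2 : ∀ z : H ⊗[k] H, pairing α (T ∘ₗ antipode k ∘ₗ LinearMap.mulLeft k r.t) z =
      pairing α T' (LinearMap.lTensor H (antipode k) z *
        (1 ⊗ₜ antipode k r.drinfeldElement)) := by
    intro z
    induction z with
    | zero => simp
    | add a b ha hb => simp only [map_add, add_mul, ha, hb]
    | tmul x y =>
      have : antipode k (r.t * y) =
          ((r.v⁻¹ : Hˣ) : H) * (antipode k y * antipode k r.drinfeldElement) := by
        rw [t, antipode_mul_antidistrib, antipode_mul_antidistrib, antipode_v_inv, hv, hv]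
        simp only [mul_assoc]
      simp [hT'def, this]
  rw [h1, h2, r.pairing_antipode_monodromy_inv hT' hS]
  exact (r.pairing_drinfeldElement_mul_monodromy hT').symm

end RibbonStructure

end

/-! ### The characters -/

section

variable {k H : Type u} [Field k] [Ring H] [HopfAlgebra k H] (r : RibbonStructure k H)

open HopfAlgebra Coalgebra FDMod

/-- Evaluate R R⁻¹ = 1 under a ⊗ b ↦ S(b)a: the relation S²(c) u = u c pulls u out to the right and
leaves a left inverse. -/
theorem RibbonStructure.exists_mul_drinfeldElement_eq_one : ∃ w, w * r.drinfeldElement = 1 := by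
  let φ : H ⊗[k] H →ₗ[k] H :=
    LinearMap.mul' k H ∘ₗ LinearMap.rTensor H (antipode k) ∘ₗ (flip k H).toLinearMap
  let ψ : H ⊗[k] H →ₗ[k] H := LinearMap.mul' k H ∘ₗ TensorProduct.map (antipode k)
    (antipode k ∘ₗ antipode k) ∘ₗ (TensorProduct.comm k H H).toLinearMap
  have h1 : ∀ (z : H ⊗[k] H) (c e : H), φ (z * c ⊗ₜ e) = antipode k e * (φ z * c) := by
    intro z c e
    induction z with
    | zero => simp
    | add x y hx hy => simp only [add_mul, mul_add, map_add, hx, hy]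
    | tmul x y => simp [φ, antipode_mul_antidistrib, mul_assoc]
  have h2 : ∀ d : H ⊗[k] H, φ ((r.R : H ⊗[k] H) * d) = ψ d * r.drinfeldElement := by
    intro d
    induction d with
    | zero => simp
    | add d e hd he => simp only [mul_add, add_mul, map_add, hd, he]
    | tmul c e =>
      rw [h1, show φ (r.R : H ⊗[k] H) = r.drinfeldElement from rfl,
        ← r.sq_antipode_mul_drinfeldElement]
      simp [ψ, mul_assoc]
  refine ⟨ψ ((r.R⁻¹ : (H ⊗[k] H)ˣ) : H ⊗[k] H), ?_⟩
  rw [← h2, Units.mul_inv]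
  simp [φ, Algebra.TensorProduct.one_def]

variable [FiniteDimensional k H]

include r in
-- S² is conjugation by u, whose left inverse is two-sided by finite dimension, and traces are
-- invariant under conjugation.
theorem RibbonStructure.actTrace_sq_antipode (V : FDMod k H) (x : H) :
    actTrace k V (antipode k (antipode k x)) = actTrace k V x := by
  obtain ⟨w, hw⟩ := r.exists_mul_drinfeldElement_eq_one
  have : IsArtinianRing H := isArtinian_of_tower k inferInstance
  have hw' := mul_eq_one_comm.mp hw
  calc actTrace k V (antipode k (antipode k x)) =
        actTrace k V ((antipode k (antipode k x) * r.drinfeldElement) * w) := by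
        rw [mul_assoc, hw', mul_one]
    _ = _ := by rw [sq_antipode_mul_drinfeldElement, actTrace_mul_comm, ← mul_assoc, hw, one_mul]

include r in
theorem RibbonStructure.antipode_surjective : Function.Surjective (antipode k : H →ₗ[k] H) :=
  r.antipodeEquiv.surjective

include r in
-- The antipode is a bijective antihomomorphism, so conjugating by it exchanges left and right
-- multiplications.
theorem RibbonStructure.trace_mulLeft_comp_mulRight_antipode (a b : H) :
    LinearMap.trace k H (LinearMap.mulLeft k (antipode k b) ∘ₗ LinearMap.mulRight k (antipode k a)) =
      LinearMap.trace k H (LinearMap.mulLeft k a ∘ₗ LinearMap.mulRight k b) := by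
  rw [← LinearMap.trace_conj' (LinearMap.mulLeft k a ∘ₗ LinearMap.mulRight k b) r.antipodeEquiv]
  congr 1
  ext x
  obtain ⟨y, rfl⟩ := r.antipodeEquiv.surjective x
  simp only [LinearEquiv.conj_apply, LinearMap.comp_apply, LinearEquiv.coe_coe,
    LinearEquiv.symm_apply_apply, LinearMap.mulLeft_apply, LinearMap.mulRight_apply]
  change _ = antipode k (a * (y * b))
  rw [antipode_mul_antidistrib, antipode_mul_antidistrib, mul_assoc]
  rfl

theorem coregular_ρ_tmul (a b : H) : (coregular r).ρ (a ⊗ₜ op b) =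
    dualLeft H (op (antipode k a)) * dualRight H (r.antipodeEquiv.symm b) :=
  rfl

theorem actTrace_coregular [IsAlgClosed k] {I : Type v} [Fintype I] {S P : I → FDMod k H}
    (hS : IsSimpleRepresentatives S) (hP : ∀ i, IsProjectiveCover (P i) (S i)) (a b : H) :
    actTrace k (coregular r) (a ⊗ₜ[k] op b) =
      ∑ i, ∑ j, ((P i).multiplicity (S j) : k) * (actTrace k (S i) a * actTrace k (S j) b) := by
  -- Transposition gives the trace of x ↦ S(a) x S⁻¹(b) on H, and conjugation by S turns this map
  -- into x ↦ b x S²(a). Thus b meets the projective covers and a the simple modules.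
  have h : actTrace k (coregular r) (a ⊗ₜ[k] op b) =
      LinearMap.trace k H (LinearMap.mulLeft k b ∘ₗ LinearMap.mulRight k
        (antipode k (antipode k a))) := by
    rw [actTrace_eq, coregular_ρ_tmul]
    refine (LinearMap.trace_mul_comm k (dualLeft H (op (antipode k a)))
      (dualRight H (r.antipodeEquiv.symm b))).trans ?_
    rw [trace_dualRight_mul_dualLeft, ← r.trace_mulLeft_comp_mulRight_antipode,
      r.antipode_symm_apply]
  rw [h, trace_mulLeft_comp_mulRight hS hP]
  refine Finset.sum_congr rfl fun i _ => ?_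
  rw [r.actTrace_sq_antipode, actTrace_eq_sum_multiplicity hS (P i), LinearMap.sum_apply,
    Finset.sum_mul]
  refine Finset.sum_congr rfl fun j _ => ?_
  rw [LinearMap.smul_apply, smul_eq_mul]
  ring

/-- On the left legs R⁻¹ R₂₁⁻¹ = Q⁻¹; on the right legs the opposite product reverses R · R₂₁ into
R₂₁ R = Q. -/
theorem bulk_monodromy : (bulk r).monodromy = shuffle k H Hᵐᵒᵖ
    (((r.Q⁻¹ : (H ⊗[k] H)ˣ) : H ⊗[k] H) ⊗ₜ opTensor k H (r.Q : H ⊗[k] H)) := by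
  have h : (bulk r).R = shuffle k H Hᵐᵒᵖ (((r.R21⁻¹ : (H ⊗[k] H)ˣ) : H ⊗[k] H) ⊗ₜ
      opTensor k H (r.R21 : H ⊗[k] H)) := rfl
  have h2 : Algebra.TensorProduct.comm k H H (r.R21 : H ⊗[k] H) = r.R :=
    TensorProduct.comm_comm _ _ _ _
  rw [CatData.monodromy, h, comm_shuffle, ← map_mul, Algebra.TensorProduct.tmul_mul_tmul,
    comm_opTensor, ← opTensor_mul, r.comm_R21_inv, h2, RibbonStructure.Q, mul_inv_rev,
    Units.val_mul, Units.val_mul]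

/-- `θ ⊗ θ'`, as a linear form on `H ⊗ Hᵒᵖ`. -/
def prodDual (θ θ' : Module.Dual k H) : Module.Dual k (H ⊗[k] Hᵐᵒᵖ) :=
  LinearMap.mul' k k ∘ₗ TensorProduct.map θ (θ' ∘ₗ (opLinearEquiv k).symm.toLinearMap)

omit [FiniteDimensional k H] in
theorem prodDual_tmul (θ θ' : Module.Dual k H) (a b : H) :
    prodDual θ θ' (a ⊗ₜ op b) = θ a * θ' b := rfl

omit [FiniteDimensional k H] in
theorem prodDual_sliceLeft_shuffle (α β θ θ' : Module.Dual k H) (x y : H ⊗[k] H) :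
    prodDual θ θ' (sliceLeft (prodDual α β) (shuffle k H Hᵐᵒᵖ (x ⊗ₜ opTensor k H y))) =
      pairing α θ x * pairing β θ' y := by
  induction x with
  | zero => simp
  | add a b ha hb => simp only [TensorProduct.add_tmul, map_add, add_mul, ha, hb]
  | tmul a a' =>
    induction y with
    | zero => simp
    | add b c hb hc => simp only [TensorProduct.tmul_add, map_add, mul_add, hb, hc]
    | tmul b b' =>
      simp only [opTensor_tmul, shuffle_tmul, sliceLeft_tmul, prodDual_tmul, map_smul, smul_eq_mul,
        pairing_tmul]
      ring

theorem chiralCharacter_apply (V : FDMod k H) (α : chiralL r) : chiralCharacter r V α =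
    pairing (coendToDual (chiral r) α) (actTrace k V ∘ₗ LinearMap.mulLeft k r.t)
      (r.Q : H ⊗[k] H) :=
  character_coendAct (chiral r) V α

theorem bulkCharacter_coregular [IsAlgClosed k] {I : Type v} [Fintype I] {S P : I → FDMod k H}
    (hS : IsSimpleRepresentatives S) (hP : ∀ i, IsProjectiveCover (P i) (S i))
    (α β : chiralL r) :
    bulkCharacter r (coregular r) (chiralTensorEquivBulk r (α ⊗ₜ β)) =
      ∑ i, ∑ j, ((P i).multiplicity (S j) : k) *
        (pairing (coendToDual (chiral r) α) (actTrace k (S i) ∘ₗ LinearMap.mulLeft k r.t)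
            ((r.Q⁻¹ : (H ⊗[k] H)ˣ) : H ⊗[k] H) *
          chiralCharacter r (S j) β) := by
  have h1 : coendToDual (bulk r) (chiralTensorEquivBulk r (α ⊗ₜ β)) =
      prodDual (coendToDual (chiral r) α) (coendToDual (chiral r) β) := by
    apply TensorProduct.ext'
    intro a b
    rfl
  have h2 : ∀ z, actTrace k (coregular r) ((bulk r).t * z) =
      ∑ i, ∑ j, ((P i).multiplicity (S j) : k) *
        prodDual (actTrace k (S i) ∘ₗ LinearMap.mulLeft k r.t)
          (actTrace k (S j) ∘ₗ LinearMap.mulLeft k r.t) z := by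
    intro z
    induction z with
    | zero => simp
    | add x y hx hy => simp only [mul_add, map_add, hx, hy, Finset.sum_add_distrib]
    | tmul a b =>
      obtain ⟨b, rfl⟩ := op_surjective b
      rw [show (bulk r).t * (a ⊗ₜ[k] op b) = (r.t * a) ⊗ₜ[k] op (b * r.t) from
        Algebra.TensorProduct.tmul_mul_tmul _ _ _ _, actTrace_coregular r hS hP]
      refine Finset.sum_congr rfl fun i _ => Finset.sum_congr rfl fun j _ => ?_
      -- The pivotal element of the right action lands behind b; cyclicity puts it in front, as in
      -- the chiral character.
      rw [prodDual_tmul, actTrace_mul_comm b]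
      rfl
  refine (character_coendAct (bulk r) (coregular r) _).trans ?_
  rw [h1, h2]
  refine Finset.sum_congr rfl fun i _ => Finset.sum_congr rfl fun j _ => ?_
  rw [bulk_monodromy, prodDual_sliceLeft_shuffle, chiralCharacter_apply]

omit [FiniteDimensional k H] in
theorem actTrace_dual (V : FDMod k H) :
    actTrace k (V.dual (chiral r)) = actTrace k V ∘ₗ (antipode k : H →ₗ[k] H) :=
  LinearMap.ext fun x => LinearMap.trace_transpose' (V.ρ (antipode k x))

/-- The loop around the dual of `V`, with inverse monodromy. -/
theorem pairing_dual_monodromy_inv (V : FDMod k H) (α : chiralL r) :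
    pairing (coendToDual (chiral r) α)
        (actTrace k (V.dual (chiral r)) ∘ₗ LinearMap.mulLeft k r.t)
        ((r.Q⁻¹ : (H ⊗[k] H)ˣ) : H ⊗[k] H) = chiralCharacter r V α := by
  rw [actTrace_dual, LinearMap.comp_assoc, chiralCharacter_apply]
  exact r.pairing_monodromy_inv (actTrace_mul_comm (M := V)) r.antipode_surjective

/-! ### Duals of simple modules -/

/-- By finite dimension a submodule of the dual is the annihilator of its coannihilator W in V. W is
stable because every element of H has the form S(b), and S(b) on V is the transpose of b on the
dual; so W is 0 or V. -/
theorem isSimpleModule_dual (V : FDMod k H) [IsSimpleModule H V] :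
    IsSimpleModule H (V.dual (chiral r)) := by
  have := IsSimpleModule.nontrivial H V
  have : Nontrivial (V.dual (chiral r)) := inferInstanceAs (Nontrivial (Module.Dual k V))
  rw [isSimpleModule_iff]
  refine { eq_bot_or_eq_top := fun N => ?_ }
  let N' : Submodule k (Module.Dual k V) := N.restrictScalars k
  let W : Submodule H V :=
    { N'.dualCoannihilator with
      smul_mem' := by
        intro a x hx
        obtain ⟨b, rfl⟩ := r.antipode_surjective a
        change antipode k b • x ∈ N'.dualCoannihilator
        rw [Submodule.mem_dualCoannihilator]
        intro f hf
        exact (Submodule.mem_dualCoannihilator x).mp hx (show Module.Dual k V from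
          b • (show V.dual (chiral r) from f)) (N.smul_mem b hf) }
  have hW : N'.dualCoannihilator = W.restrictScalars k := rfl
  have hN : N' = (W.restrictScalars k).dualAnnihilator := by
    rw [← hW, Subspace.dualCoannihilator_dualAnnihilator_eq]
  rcases eq_bot_or_eq_top W with h | h
  · right
    refine (Submodule.restrictScalars_eq_top_iff k H _).mp (hN.trans ?_)
    rw [h]
    simp only [Submodule.restrictScalars_bot, Submodule.dualAnnihilator_bot]
    rfl
  · left
    refine (Submodule.restrictScalars_eq_bot_iff k H _).mp (hN.trans ?_)
    rw [h]
    simp only [Submodule.restrictScalars_top, Submodule.dualAnnihilator_top]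
    rfl

/-- Transpose the isomorphism and use linear biduality. Biduality need not be H-linear, but the
composite is, since every element of H is some S(b). -/
theorem iso_of_iso_dual (V W : FDMod k H) (h : Iso (V.dual (chiral r)) (W.dual (chiral r))) :
    Iso W V := by
  obtain ⟨e⟩ := h
  let e' : Module.Dual k V ≃ₗ[k] Module.Dual k W := e.restrictScalars k
  let g : W ≃ₗ[k] V := Module.evalEquiv k W ≪≫ₗ e'.dualMap ≪≫ₗ (Module.evalEquiv k V).symm
  have hg : ∀ (f : Module.Dual k V) (w : W), f (g w) = e' f w := by
    intro f w
    simp [g]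
  refine ⟨{ g with map_smul' := fun a w => ?_ }⟩
  obtain ⟨b, rfl⟩ := r.antipode_surjective a
  change g (antipode k b • w) = antipode k b • g w
  refine (Module.evalEquiv k V).injective (LinearMap.ext fun f => ?_)
  change f (g (antipode k b • w)) = f (antipode k b • g w)
  let f' : V.dual (chiral r) := f
  let bf : Module.Dual k V := b • f'
  have h1 : f (antipode k b • g w) = bf (g w) := rfl
  have h2 : e' bf = b • e f' := e.map_smul b f'
  rw [hg, h1, hg, h2]
  rfl

end

end CardyCartan

end

theorem theorem2 {k H : Type u} [Field k] [IsAlgClosed k] [CharZero k]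
    [Ring H] [HopfAlgebra k H] [FiniteDimensional k H]
    (r : CardyCartan.RibbonStructure k H) (hr : r.IsFactorizable)
    {I : Type v} (S P : I → CardyCartan.FDMod k H)
    (hS : CardyCartan.FDMod.IsSimpleRepresentatives S)
    (hP : ∀ i, CardyCartan.FDMod.IsProjectiveCover (P i) (S i)) :
    -- the simple `H`-modules are modules over the chiral Hopf algebra `L`,
    -- with characters in `Hom_H(L, 1)`
    (∀ i, CardyCartan.FDMod.IsCoendModule (CardyCartan.chiral r) (S i)
        (CardyCartan.FDMod.coendAct (CardyCartan.chiral r) (S i)) ∧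
      CardyCartan.FDMod.IsHom (V := CardyCartan.chiralL r) (W := CardyCartan.FDMod.unit k H)
        (CardyCartan.chiralCharacter r (S i))) ∧
    -- the coregular bimodule `F` is a module over the bulk Hopf algebra `K`,
    -- with character `Z` in `Hom_{H|H}(K, 1)`
    (CardyCartan.FDMod.IsCoendModule (CardyCartan.bulk r) (CardyCartan.coregular r)
        (CardyCartan.FDMod.coendAct (CardyCartan.bulk r) (CardyCartan.coregular r)) ∧
      CardyCartan.FDMod.IsHom (V := CardyCartan.bulkK r)
        (W := CardyCartan.FDMod.unit k (H ⊗[k] Hᵐᵒᵖ))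
        (CardyCartan.bulkCharacter r (CardyCartan.coregular r))) ∧
    -- `Z = ∑ c_{ī,j} χ^L_i ⊗ χ^L_j` with `c_{i,j} = [P_i : S_j]` and `S_ī ≅ S_i^∨`
    ∃ (_ : Fintype I) (bar : I → I),
      (∀ i, CardyCartan.FDMod.Iso (S (bar i)) ((S i).dual (CardyCartan.chiral r))) ∧
      CardyCartan.bulkCharacter r (CardyCartan.coregular r) ∘ₗ
          (CardyCartan.chiralTensorEquivBulk r).toLinearMap =
        ∑ i, ∑ j, ((P (bar i)).multiplicity (S j) : k) •
          (LinearMap.mul' k k ∘ₗ TensorProduct.map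
            (CardyCartan.chiralCharacter r (S i)) (CardyCartan.chiralCharacter r (S j))) := by
  open CardyCartan CardyCartan.FDMod in
  refine ⟨fun i => ⟨isCoendModule_coendAct (chiral_isQuasitriangular r) (S i),
    character_isHom (chiral_isQuasitriangular r) (S i)⟩,
    ⟨isCoendModule_coendAct (bulk_isQuasitriangular r) (coregular r),
    character_isHom (bulk_isQuasitriangular r) (coregular r)⟩, ?_⟩
  have := hS.finite
  have hbar : ∀ i, ∃ j, CardyCartan.FDMod.Iso (S j) ((S i).dual (CardyCartan.chiral r)) := by
    intro i
    have := hS.simple i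
    obtain ⟨j, ⟨e⟩⟩ := hS.exists_iso _ (CardyCartan.isSimpleModule_dual r (S i))
    exact ⟨j, ⟨e.symm⟩⟩
  choose bar hbar using hbar
  -- A simple module is determined by its dual, so i ↦ ī is injective, hence a permutation of the
  -- finite set `I`.
  have hinj : Function.Injective bar := by
    intro i j h
    obtain ⟨e⟩ := hbar i
    obtain ⟨e'⟩ := hbar j
    rw [← h] at e'
    exact (hS.eq_of_iso j i (CardyCartan.iso_of_iso_dual r (S i) (S j) ⟨e.symm.trans e'⟩)).symm
  let σ : I ≃ I := Equiv.ofBijective bar (Finite.injective_iff_bijective.mp hinj)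
  let _ : Fintype I := Fintype.ofFinite I
  refine ⟨inferInstance, bar, hbar, ?_⟩
  apply TensorProduct.ext'
  intro α β
  refine (CardyCartan.bulkCharacter_coregular r hS hP α β).trans ?_
  -- After replacing i by ī, the inverse loop runs around the dual of `S i` and equals χ_i, while
  -- the Cartan entry keeps ī.
  rw [← Equiv.sum_comp σ]
  simp only [LinearMap.sum_apply]
  refine Finset.sum_congr rfl fun i _ => Finset.sum_congr rfl fun j _ => ?_
  obtain ⟨e⟩ := hbar i
  rw [show σ i = bar i from rfl, CardyCartan.actTrace_congr e,
    CardyCartan.pairing_dual_monodromy_inv]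
  rfl
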